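/- Let $N\ge 1$ be an integer, $k\in\mathbb R$, $\lambda=\tfrac14+R^2>\tfrac14$ with $R>0$, and write $e(x)=e^{2\pi i x}$, $\operatorname{Arg}\in(-\pi,\pi]$, and $\Gamma_0(N)=\{\left(\begin{smallmatrix}a&b\\c&d\end{smallmatrix}\right)\in SL(2,\mathbb Z): N\mid c\}$. Let $v$ be one of the following: (i) an $\eta$-multiplier system $v=v_\eta^{2(k+2r)}$, $r\in\mathbb Z$ (for $r=0$ this is the $\eta$-multiplier system of weight $k$). Here, for real $\kappa$, $v_\eta^{2\kappa}$ is the function on $SL(2,\mathbb Z)$ determined by $\eta^{2\kappa}(Az)=v_\eta^{2\kappa}(A)(cz+d)^{\kappa}\eta^{2\kappa}(z)$, given explicitly, for $A=\left(\begin{smallmatrix}a&b\\c&d\end{smallmatrix}\right)$, by $e\big(\kappa(\frac{a+d-3c}{12c}-s(d,c))\big)$ if $c>0$, by $e(\kappa b/12)$ if $c=0$, $d=1$, by $e^{\pi i\kappa}v_\eta^{2\kappa}(-A)$ if $c<0$ and by $e^{-\pi i\kappa}v_\eta^{2\kappa}(-A)$ if $c=0$, $d=-1$, where $s(d,c)=\sum_{n=1}^{c-1}\frac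 nc\left(\left(\frac{dn}c\right)\right)$ is the Dedekind sum, with $((x))=x-\lfloor x\rfloor-\frac12$ for $x\notin\mathbb Z$ and $((x))=0$ for $x\in\mathbb Z$; or (ii) the $\theta$-multiplier system $v=v_\theta$, in which case it is assumed that $4\mid N$. Here $v_\theta$ is determined by $\theta(Az)=v_\theta(A)(cz+d)^{1/2}\theta(z)$ for $\theta(z)=\sum_{n\in\mathbb Z}e(n^2z)$ and $A\in\Gamma_0(4)$, explicitly $v_\theta(A)=\overline{\epsilon_d}\left(\frac cd\right)$, where $\epsilon_d=1$ if $d\equiv1\bmod 4$, $\epsilon_d=i$ if $d\equiv-1\bmod4$, and $\left(\frac cd\right)$ is the Jacobi symbol for $d>0$, extended by $\left(\frac cd\right)=\frac{c}{|c|}\left(\frac{c}{-d}\right)$ for $d<0$, $c\ne0$, and $\left(\frac0{-1}\right)=1$. Let $\mathcal M(\Gamma_0(N),v,k,\lambda)$ be the complex vector space of real-analytic functions $f:\mathbb H\to\mathbb C$ on the upper half-plane $\mathbb H$ such that 1. $f(Az)=v(A)\,e^{ik\operatorname{Arg}(cz+d)}f(z)$ for all $A=\left(\begin{smallmatrix}a&b\\c&d\end{smallmatrix}\right)\in\Gamma_0(N)$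 and $z\in\mathbb H$; 2. $y^2\left(\frac{\partial^2f}{\partial x^2}+\frac{\partial^2f}{\partial y^2}\right)-iky\frac{\partial f}{\partial x}+\lambda f=0$, where $z=x+iy$; 3. $\int_{\mathcal F}|f|^2\,\frac{dx\,dy}{y^2}<\infty$, where $\mathcal F$ is a fundamental domain of $\Gamma_0(N)$ in $\mathbb H$. Let $\alpha\in[0,1)$ be given by $v\left(\begin{smallmatrix}1&1\\0&1\end{smallmatrix}\right)=e(\alpha)$. Then $\mathcal M(\Gamma_0(N),v,k,\lambda)$ has a finite basis $g_1,\dots,g_m$ ($m\ge0$) such that every $g_j$ has a Fourier expansion at $\infty$ with real coefficients: there are $c_j(n)\in\mathbb R$ $(n\in\mathbb Z)$ such that for all $z=x+iy\in\mathbb H$ $$g_j(z)=\sum_{\substack{n\in\mathbb Z\\ n+\alpha\neq0}}\frac{c_j(n)}{\sqrt{|n+\alpha|}}\,W_{\operatorname{sgn}(n+\alpha)\frac k2,\,iR}\big(4\pi|n+\alpha|y\big)\,e\big((n+\alpha)x\big),$$ the series converging absolutely, where $W_{\kappa,\mu}$ is Whittaker's function. -/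

import Mathlib

open UpperHalfPlane MeasureTheory
open scoped MatrixGroups

noncomputable section

namespace MaassWaveform

/-- `e(x) = exp(2πix)`. -/
def e (x : ℝ) : ℂ := Complex.exp (2 * Real.pi * Complex.I * x)

/-! ### The automorphy factor and the two multiplier systems -/

/-- `j_A(z; k) = exp(ik Arg(cz + d))`, with the principal argument `-π < Arg ≤ π`. -/
def autFactor (k : ℝ) (A : SL(2, ℤ)) (z : ℍ) : ℂ :=
  Complex.exp (Complex.I * k * Complex.arg ((A 1 0 : ℂ) * z + (A 1 1 : ℂ)))

/-- The saw-tooth function `((x))`. -/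
def sawtooth (x : ℝ) : ℝ := if Int.fract x = 0 then 0 else Int.fract x - 1 / 2

/-- The Dedekind sum `s(d, c) = ∑_{n=1}^{c-1} (n/c) ((dn/c))`, for `c > 0`. -/
def dedekindSum (d c : ℤ) : ℝ :=
  ∑ n ∈ Finset.Ico 1 c, ((n : ℝ) / c) * sawtooth ((d : ℝ) * n / c)

/-- The eta multiplier system `v_η^{2k}` of weight `k` on `SL(2, ℤ)`, that is, the factor in
`η^{2k}(Az) = v(A) (cz + d)^k η^{2k}(z)` (principal branch of `(cz + d)^k`), for real `k`. For
`A` with `c < 0`, respectively `c = 0, d = -1`, it is obtained from its value at `-A` through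
`v(A) = exp(πik) v(-A)`, respectively `v(A) = exp(-πik) v(-A)`. -/
def etaMultiplier (k : ℝ) (A : SL(2, ℤ)) : ℂ :=
  let a := A 0 0
  let b := A 0 1
  let c := A 1 0
  let d := A 1 1
  if 0 < c then
    e (k * (((a : ℝ) + d - 3 * c) / (12 * c) - dedekindSum d c))
  else if c < 0 then
    e (k / 2) * e (k * (((-a : ℝ) - d + 3 * c) / (-(12 * c)) - dedekindSum (-d) (-c)))
  else if 0 < d then
    e (k * b / 12)
  else
    e (-k / 2) * e (-(k * b) / 12)

/-- The extended quadratic residue symbol `(c/d)`, for `d` odd: the Jacobi symbol if `d > 0`,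
`(c/d) = sgn(c) (c/(-d))` if `d < 0` and `c ≠ 0`, and `(0/d) = 1` if `d = ±1`, `0` otherwise. -/
def extSymbol (c d : ℤ) : ℤ :=
  if c = 0 then (if d = 1 ∨ d = -1 then 1 else 0)
  else if 0 < d then jacobiSym c d.natAbs
  else c.sign * jacobiSym c d.natAbs

/-- `ε_d = 1` if `d ≡ 1 mod 4` and `ε_d = i` if `d ≡ -1 mod 4`. -/
def epsilonFactor (d : ℤ) : ℂ := if d % 4 = 1 then 1 else Complex.I

/-- The theta multiplier system `v_θ(A) = conj(ε_d) (c/d)` of weight `1/2`, that is, the factor in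
`θ(Az) = v_θ(A) (cz + d)^{1/2} θ(z)`, for `A ∈ Γ₀(4)`. -/
def thetaMultiplier (A : SL(2, ℤ)) : ℂ :=
  (starRingEnd ℂ) (epsilonFactor (A 1 1)) * (extSymbol (A 1 0) (A 1 1) : ℂ)

/-! ### Maass waveforms -/

/-- The weight-`k` Laplacian `Δ_k = y² (∂²/∂x² + ∂²/∂y²) - iyk ∂/∂x`. -/
def weightLaplacian (k : ℝ) (f : ℍ → ℂ) (z : ℍ) : ℂ :=
  (z.im : ℂ) ^ 2 *
      (iteratedDeriv 2 (fun x : ℝ => f (ofComplex (x + z.im * Complex.I))) z.re +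
        iteratedDeriv 2 (fun y : ℝ => f (ofComplex (z.re + y * Complex.I))) z.im) -
    Complex.I * z.im * k * deriv (fun x : ℝ => f (ofComplex (x + z.im * Complex.I))) z.re

/-- `F` is a fundamental domain in `ℍ` (up to sets of measure zero) for the group `Γ / {±1}`,
realised as the group of transformations of `ℍ` induced by `Γ`. The measure `volume` on `ℍ` is
the hyperbolic area `dx dy / y²`. -/
def IsFundDomain (Γ : Subgroup SL(2, ℤ)) (F : Set ℍ) : Prop :=
  IsFundamentalDomain (Γ.map (MulAction.toPermHom SL(2, ℤ) ℍ)) F volume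

/-- `f` is a Maass waveform on `Γ` of weight `k`, multiplier system `v` and eigenvalue `lam`. -/
structure IsMaassForm (Γ : Subgroup SL(2, ℤ)) (v : SL(2, ℤ) → ℂ) (k lam : ℝ) (f : ℍ → ℂ) :
    Prop where
  realAnalytic : AnalyticOnNhd ℝ (fun w : ℂ => f (ofComplex w)) upperHalfPlaneSet
  automorphic : ∀ A ∈ Γ, ∀ z : ℍ, f (A • z) = v A * autFactor k A z * f z
  eigenfunction : ∀ z : ℍ, weightLaplacian k f z + lam * f z = 0
  squareIntegrable : ∀ F : Set ℍ, IsFundDomain Γ F →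
    IntegrableOn (fun z => ‖f z‖ ^ 2) F volume

theorem analyticAt_horizontal {f : ℍ → ℂ}
    (hf : AnalyticOnNhd ℝ (fun w : ℂ => f (ofComplex w)) upperHalfPlaneSet) (z : ℍ) :
    AnalyticAt ℝ (fun x : ℝ => f (ofComplex (x + z.im * Complex.I))) z.re := by
  have h1 : AnalyticAt ℝ (fun x : ℝ => ((x : ℂ) + z.im * Complex.I)) z.re :=
    (Complex.ofRealCLM.analyticAt _).add analyticAt_const
  refine AnalyticAt.comp (g := fun w : ℂ => f (ofComplex w)) (hf _ ?_) h1
  simpa [upperHalfPlaneSet] using z.im_pos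

theorem analyticAt_vertical {f : ℍ → ℂ}
    (hf : AnalyticOnNhd ℝ (fun w : ℂ => f (ofComplex w)) upperHalfPlaneSet) (z : ℍ) :
    AnalyticAt ℝ (fun y : ℝ => f (ofComplex (z.re + y * Complex.I))) z.im := by
  have h1 : AnalyticAt ℝ (fun y : ℝ => ((z.re : ℂ) + y * Complex.I)) z.im :=
    analyticAt_const.add ((Complex.ofRealCLM.analyticAt _).mul analyticAt_const)
  refine AnalyticAt.comp (g := fun w : ℂ => f (ofComplex w)) (hf _ ?_) h1
  simpa [upperHalfPlaneSet] using z.im_pos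

theorem weightLaplacian_add (k : ℝ) {f g : ℍ → ℂ}
    (hf : AnalyticOnNhd ℝ (fun w : ℂ => f (ofComplex w)) upperHalfPlaneSet)
    (hg : AnalyticOnNhd ℝ (fun w : ℂ => g (ofComplex w)) upperHalfPlaneSet) (z : ℍ) :
    weightLaplacian k (f + g) z = weightLaplacian k f z + weightLaplacian k g z := by
  have hfx := analyticAt_horizontal hf z
  have hgx := analyticAt_horizontal hg z
  have hfy := analyticAt_vertical hf z
  have hgy := analyticAt_vertical hg z
  simp only [weightLaplacian, Pi.add_apply]
  rw [iteratedDeriv_fun_add hfx.contDiffAt hgx.contDiffAt,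
    iteratedDeriv_fun_add hfy.contDiffAt hgy.contDiffAt,
    deriv_fun_add hfx.differentiableAt hgx.differentiableAt]
  ring

theorem weightLaplacian_smul (k : ℝ) (a : ℂ) {f : ℍ → ℂ}
    (hf : AnalyticOnNhd ℝ (fun w : ℂ => f (ofComplex w)) upperHalfPlaneSet) (z : ℍ) :
    weightLaplacian k (a • f) z = a * weightLaplacian k f z := by
  have hfx := analyticAt_horizontal hf z
  have hfy := analyticAt_vertical hf z
  simp only [weightLaplacian, Pi.smul_apply, smul_eq_mul]
  rw [iteratedDeriv_const_mul a hfx.contDiffAt, iteratedDeriv_const_mul a hfy.contDiffAt,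
    deriv_const_mul a hfx.differentiableAt]
  ring

theorem continuous_of_analytic {f : ℍ → ℂ}
    (hf : AnalyticOnNhd ℝ (fun w : ℂ => f (ofComplex w)) upperHalfPlaneSet) : Continuous f := by
  have h := hf.continuousOn.comp_continuous (f := fun z : ℍ => (z : ℂ)) continuous_coe
    (fun z => z.2)
  have h2 : f = (fun w : ℂ => f (ofComplex w)) ∘ fun z : ℍ => (z : ℂ) := by
    funext z
    simp
  rw [h2]
  exact h

theorem isMaassForm_add {Γ : Subgroup SL(2, ℤ)} {v : SL(2, ℤ) → ℂ} {k lam : ℝ} {f g : ℍ → ℂ}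
    (hf : IsMaassForm Γ v k lam f) (hg : IsMaassForm Γ v k lam g) :
    IsMaassForm Γ v k lam (f + g) where
  realAnalytic := hf.realAnalytic.add hg.realAnalytic
  automorphic A hA z := by
    simp only [Pi.add_apply, hf.automorphic A hA z, hg.automorphic A hA z]
    ring
  eigenfunction z := by
    rw [weightLaplacian_add k hf.realAnalytic hg.realAnalytic, Pi.add_apply]
    linear_combination hf.eigenfunction z + hg.eigenfunction z
  squareIntegrable F hF := by
    have hfc := continuous_of_analytic hf.realAnalytic
    have hgc := continuous_of_analytic hg.realAnalytic
    have h1 := (hf.squareIntegrable F hF).const_mul 2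
    have h2 := (hg.squareIntegrable F hF).const_mul 2
    refine (h1.add h2).mono' (by fun_prop) (Filter.Eventually.of_forall fun z => ?_)
    have h3 := norm_add_le (f z) (g z)
    have h4 := norm_nonneg (f z + g z)
    simp only [Pi.add_apply, norm_pow, norm_norm]
    nlinarith [sq_nonneg (‖f z‖ - ‖g z‖)]

theorem isMaassForm_smul {Γ : Subgroup SL(2, ℤ)} {v : SL(2, ℤ) → ℂ} {k lam : ℝ} {f : ℍ → ℂ}
    (a : ℂ) (hf : IsMaassForm Γ v k lam f) : IsMaassForm Γ v k lam (a • f) where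
  realAnalytic := analyticOnNhd_const.mul hf.realAnalytic
  automorphic A hA z := by
    simp only [Pi.smul_apply, smul_eq_mul, hf.automorphic A hA z]
    ring
  eigenfunction z := by
    rw [weightLaplacian_smul k a hf.realAnalytic, Pi.smul_apply, smul_eq_mul]
    linear_combination a * hf.eigenfunction z
  squareIntegrable F hF := by
    have h1 := (hf.squareIntegrable F hF).const_mul (‖a‖ ^ 2)
    refine h1.congr (Filter.Eventually.of_forall fun z => ?_)
    simp [mul_pow]

theorem isMaassForm_zero (Γ : Subgroup SL(2, ℤ)) (v : SL(2, ℤ) → ℂ) (k lam : ℝ) :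
    IsMaassForm Γ v k lam 0 where
  realAnalytic := analyticOnNhd_const
  automorphic A hA z := by simp
  eigenfunction z := by simp [weightLaplacian]
  squareIntegrable F hF := by simp

/-- The complex vector space `M(Γ, v, k, lam)` of Maass waveforms. -/
def maassSpace (Γ : Subgroup SL(2, ℤ)) (v : SL(2, ℤ) → ℂ) (k lam : ℝ) :
    Submodule ℂ (ℍ → ℂ) where
  carrier := {f | IsMaassForm Γ v k lam f}
  add_mem' := isMaassForm_add
  zero_mem' := isMaassForm_zero Γ v k lam
  smul_mem' a _ hf := isMaassForm_smul a hf

/-! ### Whittaker functions and Fourier expansions at the cusp `∞` -/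

/-- Kummer's function `M(a, b, x) = ∑ (a)_n x^n / ((b)_n n!)`, for `b ∉ {0, -1, -2, …}`. -/
def kummerM (a b x : ℂ) : ℂ :=
  ∑' n : ℕ, (ascPochhammer ℂ n).eval a / (ascPochhammer ℂ n).eval b * (x ^ n / n.factorial)

/-- Tricomi's function `U(a, b, x)`, for `x > 0` and `b` not an integer. -/
def tricomiU (a b : ℂ) (x : ℝ) : ℂ :=
  Complex.Gamma (1 - b) / Complex.Gamma (a - b + 1) * kummerM a b x +
    Complex.Gamma (b - 1) / Complex.Gamma a * (x : ℂ) ^ (1 - b) * kummerM (a - b + 1) (2 - b) x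

/-- Whittaker's function `W_{κ,μ}(x)`, for `x > 0` and `2μ` not an integer. -/
def whittakerW (κ μ : ℂ) (x : ℝ) : ℂ :=
  (Real.exp (-x / 2) : ℂ) * (x : ℂ) ^ (μ + 1 / 2) * tricomiU (μ - κ + 1 / 2) (1 + 2 * μ) x

/-- The `n`-th term of the Fourier expansion at `∞`: it is
`c / √|n+α| · W_{sgn(n+α)k/2, iR}(4π|n+α|y) e((n+α)x)` if `n + α ≠ 0`, and is absent (zero) if
`n + α = 0`. -/
def fourierTerm (k R α : ℝ) (c : ℂ) (n : ℤ) (z : ℍ) : ℂ :=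
  if (n : ℝ) + α = 0 then 0
  else
    c / (Real.sqrt |n + α| : ℂ) *
      whittakerW (SignType.sign ((n : ℝ) + α) * ((k : ℂ) / 2)) (Complex.I * R)
        (4 * Real.pi * |n + α| * z.im) *
      e ((n + α) * z.re)

end MaassWaveform

end

noncomputable section

namespace MaassWaveform
open Filter Topology Set
open scoped ENNReal Pointwise ComplexConjugate

/-! ### Kummer's function -/

/-! The map `f*(z) = conj (f (-z̄))` (`conjFlip`) is an antilinear involution. The reflection `z ↦
-z̄` normalizes `Γ₀(N)`, and both multiplier systems satisfy `conj (v (reflect A)) = v A` away from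
the matrices with `c = 0`, `d < 0` (`IsSymmetric`), so the involution preserves the space of Maass
forms (`isMaassForm_conjFlip`). The fixed points of an antilinear involution span a complex space
(`span_fixed_eq_top`), so once the space is known to be finite dimensional it has a basis of fixed
forms. For a fixed form every Fourier coefficient at `∞` is a real function of `y`.

Each coefficient solves a second order equation in `y`, a rescaled Whittaker equation when the
frequency is nonzero. Square integrability makes such a coefficient non-increasing in modulus high
in the cusp, and a solution bounded at infinity is a multiple of `W`
(`SolvesOn.eq_const_mul_whitW`). As `W` is real for real `κ` and imaginary `μ` (`conj_whitW`), the
constant may be taken real. The frequency zero drops out because `λ > 1/4` makes its solutions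
oscillate with amplitude `√y`, which is not square integrable against `dy / y²`
(`SolvesOn.eq_zero_of_oscillating`).

The decay of `W`, defined through Kummer series, comes from a Laplace integral. It solves the same
equation, its Wronskians with the two series solutions are computed from limits at `0`, and they
identify it as a multiple of `W` (`whitV_eq`). The integral converges only for `Re κ < 1/2`; a
contiguous relation carries rapid decay to all real `κ` (`rapidDecay_whitW`).

Finite dimension follows from a bound `sup |f|² ≤ C ‖f‖₂²` with `C` independent of `f`
(`exists_global_bound`). On a finite measure space, integrating `∑ |g_i|² ≤ C` over an orthonormal
family bounds the dimension by `C` times the volume (`finrank_le_of_sup_bound`). The sup bound is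
proved cusp by cusp. The coefficients of the slashed form satisfy `u'' = q u` with `q` growing
quadratically in the frequency, so a mean value inequality bounds them by their local mean squares
with a gain that makes them summable (`exists_sum_fcoeff_bound`). High in the cusp monotonicity
takes over. Finitely many translates of the fundamental domain cover the strip used
(`exists_lintegral_strip_le`). The sup bound also gives square integrability of `f*` over every
fundamental domain, since these all have the same finite area. -/

theorem summable_succ_mul_coeff {c : ℕ → ℂ} (hc : ∀ r : ℝ, 0 < r → Summable fun n => ‖c n‖ * r ^ n)
    (r : ℝ) (hr : 0 < r) : Summable fun n : ℕ => ‖((n : ℂ) + 1) * c (n + 1)‖ * r ^ n := by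
  -- The radius `2 (r + 1)` pays for `n + 1 ≤ 2 ^ (n + 1)`, and `r + 1 ≥ 1` pays for the index
  -- shift.
  have h := (summable_nat_add_iff 1).2 ((hc (2 * (r + 1)) (by positivity)))
  refine h.of_nonneg_of_le (fun n => by positivity) fun n => ?_
  rw [norm_mul, mul_comm ‖_‖ ‖c _‖, mul_assoc]
  have h1 : ‖(n : ℂ) + 1‖ = n + 1 := by
    rw [← Nat.cast_succ, Complex.norm_natCast]; simp
  have h2 : ((n : ℝ) + 1) ≤ 2 ^ (n + 1) := by exact_mod_cast (Nat.lt_two_pow_self (n := n + 1)).le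
  have h3 : r ^ n ≤ (r + 1) ^ (n + 1) :=
    calc r ^ n ≤ (r + 1) ^ n := by gcongr; linarith
      _ ≤ (r + 1) ^ (n + 1) := pow_le_pow_right₀ (by linarith) (by omega)
  rw [h1, mul_pow]
  gcongr

/-- Summability at every radius passes to the differentiated coefficients, so the result can be
applied again to reach second derivatives. -/
theorem hasDerivAt_tsum_pow {c : ℕ → ℂ} (hc : ∀ r : ℝ, 0 < r → Summable fun n => ‖c n‖ * r ^ n)
    (x : ℂ) : HasDerivAt (fun x : ℂ => ∑' n, c n * x ^ n)
      (∑' n : ℕ, ((n : ℂ) + 1) * c (n + 1) * x ^ n) x := by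
  set r : ℝ := ‖x‖ + 1
  have hr : 0 < r := by positivity
  have hu := summable_succ_mul_coeff hc r hr
  have hu' : Summable fun n : ℕ => ‖(n : ℂ) * c n‖ * r ^ (n - 1) := by
    rw [← summable_nat_add_iff 1]
    simpa using hu
  have h := hasDerivAt_tsum_of_isPreconnected (g := fun n (x : ℂ) => c n * x ^ n)
    (g' := fun n (x : ℂ) => c n * (n * x ^ (n - 1))) (t := Metric.ball 0 r) (y₀ := x) (y := x) hu'
    Metric.isOpen_ball (convex_ball _ _).isPreconnected
    (fun n y _ => (hasDerivAt_pow n y).const_mul (c n)) ?_ (by simp [r]) ?_ (by simp [r])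
  · have hs : Summable fun n : ℕ => c n * (n * x ^ (n - 1)) := by
      refine Summable.of_norm_bounded hu' fun n => ?_
      rw [← mul_assoc, mul_comm (c n), norm_mul, norm_pow]
      gcongr
      simp [r]
    rw [hs.tsum_eq_zero_add] at h
    simp only [CharP.cast_eq_zero, zero_mul, mul_zero, zero_add, Nat.cast_add, Nat.cast_one,
      Nat.add_sub_cancel] at h
    rwa [show (∑' n : ℕ, ((n : ℂ) + 1) * c (n + 1) * x ^ n) =
      ∑' n : ℕ, c (n + 1) * (((n : ℂ) + 1) * x ^ n) from tsum_congr fun n => by ring]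
  · intro n y hy
    rw [← mul_assoc, mul_comm (c n), norm_mul, norm_pow]
    have : ‖y‖ ≤ r := by simpa using (Metric.mem_ball.1 hy).le
    gcongr
  · refine Summable.of_norm_bounded (hc r hr) fun n => ?_
    rw [norm_mul, norm_pow]
    gcongr
    simp [r]

/-- The coefficients of Kummer's series. -/
def kummerCoeff (a b : ℂ) (n : ℕ) : ℂ :=
  (ascPochhammer ℂ n).eval a / (ascPochhammer ℂ n).eval b / n.factorial

theorem kummerM_eq (a b x : ℂ) : kummerM a b x = ∑' n, kummerCoeff a b n * x ^ n :=
  tsum_congr fun n => by simp only [kummerCoeff]; ring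

/-- The ratio of consecutive coefficients with denominators cleared. Convergence, the differential
equation and the contiguous relation are all read off from it coefficientwise. -/
theorem kummerCoeff_succ {b : ℂ} (hb : ∀ n : ℕ, b + n ≠ 0) (a : ℂ) (n : ℕ) :
    kummerCoeff a b (n + 1) * ((b + n) * (n + 1)) = kummerCoeff a b n * (a + n) := by
  have h2 : (n : ℂ) + 1 ≠ 0 := by exact_mod_cast n.succ_ne_zero
  have h3 : (n.factorial : ℂ) ≠ 0 := by exact_mod_cast n.factorial_ne_zero
  have h4 : ∀ m : ℕ, (ascPochhammer ℂ m).eval b ≠ 0 := by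
    intro m
    induction m with
    | zero => simp
    | succ m ih => rw [ascPochhammer_succ_eval]; exact mul_ne_zero ih (hb m)
  have h5 := h4 n
  have h6 := hb n
  simp only [kummerCoeff, ascPochhammer_succ_eval, Nat.factorial_succ]
  push_cast
  field_simp

theorem summable_kummerCoeff {b : ℂ} (hb : ∀ n : ℕ, b + n ≠ 0) (a : ℂ) (r : ℝ) (hr : 0 < r) :
    Summable fun n => ‖kummerCoeff a b n‖ * r ^ n := by
  have hs : Summable fun n => kummerCoeff a b n * (r : ℂ) ^ n := by
    refine summable_of_ratio_norm_eventually_le (r := 1 / 2) (by norm_num) ?_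
    -- Beyond this index `‖b‖ ≤ n / 2`, `‖a‖ ≤ n` and `8 r ≤ n + 1`, so the ratio of consecutive
    -- terms is at most `4 r / (n + 1) ≤ 1 / 2`.
    filter_upwards [eventually_ge_atTop (⌈2 * ‖b‖⌉₊ + ⌈‖a‖⌉₊ + ⌈8 * r⌉₊ + 1)] with n hn
    have hn' : ((⌈2 * ‖b‖⌉₊ : ℝ) + ⌈‖a‖⌉₊ + ⌈8 * r⌉₊ + 1) ≤ n := by exact_mod_cast hn
    have e1 := Nat.le_ceil (2 * ‖b‖)
    have e2 := Nat.le_ceil ‖a‖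
    have e3 := Nat.le_ceil (8 * r)
    have p1 : (0 : ℝ) ≤ ⌈2 * ‖b‖⌉₊ := by positivity
    have p2 : (0 : ℝ) ≤ ⌈‖a‖⌉₊ := by positivity
    have p3 : (0 : ℝ) ≤ ⌈8 * r⌉₊ := by positivity
    have hbn : (n : ℝ) / 2 ≤ ‖b + n‖ := by
      have := norm_sub_le (b + n) b
      rw [add_sub_cancel_left, Complex.norm_natCast] at this
      linarith
    have han : ‖a + n‖ ≤ 2 * n := by
      have := norm_add_le a (n : ℂ)
      rw [Complex.norm_natCast] at this
      linarith
    have h1 : ‖(n : ℂ) + 1‖ = n + 1 := by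
      rw [← Nat.cast_succ, Complex.norm_natCast]; simp
    have hk := congrArg norm (kummerCoeff_succ hb a n)
    simp only [norm_mul, h1] at hk
    have hn0 : (0 : ℝ) < n := by linarith
    have hbn' : 0 < ‖b + n‖ := by linarith
    have hpos : 0 < ‖b + n‖ * (n + 1) := by positivity
    have key : ‖kummerCoeff a b (n + 1)‖ * r ≤ 1 / 2 * ‖kummerCoeff a b n‖ := by
      rw [← mul_le_mul_iff_left₀ hpos]
      calc ‖kummerCoeff a b (n + 1)‖ * r * (‖b + n‖ * (n + 1))
          = ‖kummerCoeff a b n‖ * (‖a + n‖ * r) := by linear_combination r * hk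
        _ ≤ ‖kummerCoeff a b n‖ * (1 / 2 * (‖b + n‖ * (n + 1))) := by
          refine mul_le_mul_of_nonneg_left ?_ (norm_nonneg _)
          calc ‖a + n‖ * r ≤ 2 * n * ((n + 1) / 8) := by gcongr; linarith
            _ = 1 / 2 * (n / 2 * (n + 1)) := by ring
            _ ≤ _ := by gcongr
        _ = _ := by ring
    simp only [norm_mul, norm_pow, Complex.norm_real, Real.norm_eq_abs, abs_of_pos hr, pow_succ]
    calc _ = (‖kummerCoeff a b (n + 1)‖ * r) * r ^ n := by ring
      _ ≤ (1 / 2 * ‖kummerCoeff a b n‖) * r ^ n := by gcongr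
      _ = _ := by ring
  simpa [abs_of_pos hr] using hs.norm

/-- The derivative of Kummer's function. -/
def kummerM₁ (a b x : ℂ) : ℂ := ∑' n : ℕ, ((n : ℂ) + 1) * kummerCoeff a b (n + 1) * x ^ n

/-- The second derivative of Kummer's function. -/
def kummerM₂ (a b x : ℂ) : ℂ :=
  ∑' n : ℕ, ((n : ℂ) + 1) * (((n + 1 : ℕ) + 1) * kummerCoeff a b (n + 1 + 1)) * x ^ n

theorem hasDerivAt_kummerM {b : ℂ} (hb : ∀ n : ℕ, b + n ≠ 0) (a x : ℂ) :
    HasDerivAt (kummerM a b) (kummerM₁ a b x) x := by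
  have h := hasDerivAt_tsum_pow (summable_kummerCoeff hb a) x
  rwa [← funext (kummerM_eq a b)] at h

theorem hasDerivAt_kummerM₁ {b : ℂ} (hb : ∀ n : ℕ, b + n ≠ 0) (a x : ℂ) :
    HasDerivAt (kummerM₁ a b) (kummerM₂ a b x) x :=
  hasDerivAt_tsum_pow (summable_succ_mul_coeff (summable_kummerCoeff hb a)) x

theorem summable_mul_pow {c : ℕ → ℂ} (hc : ∀ r : ℝ, 0 < r → Summable fun n => ‖c n‖ * r ^ n)
    (x : ℂ) : Summable fun n => c n * x ^ n := by
  refine Summable.of_norm_bounded (hc (‖x‖ + 1) (by positivity)) fun n => ?_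
  rw [norm_mul, norm_pow]
  gcongr
  linarith

theorem hasSum_mul_of_succ {c : ℕ → ℂ} {x s : ℂ} (h : HasSum (fun n => c (n + 1) * x ^ n) s)
    (h0 : c 0 = 0) : HasSum (fun n => c n * x ^ n) (x * s) := by
  rw [← hasSum_nat_add_iff' 1]
  simpa [h0, pow_succ, mul_comm, mul_left_comm, mul_assoc] using h.mul_left x

theorem hasSum_kummerM {b : ℂ} (hb : ∀ n : ℕ, b + n ≠ 0) (a x : ℂ) :
    HasSum (fun n => kummerCoeff a b n * x ^ n) (kummerM a b x) := by
  rw [kummerM_eq]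
  exact (summable_mul_pow (summable_kummerCoeff hb a) x).hasSum

theorem hasSum_kummerM₁ {b : ℂ} (hb : ∀ n : ℕ, b + n ≠ 0) (a x : ℂ) :
    HasSum (fun n : ℕ => ((n : ℂ) + 1) * kummerCoeff a b (n + 1) * x ^ n) (kummerM₁ a b x) :=
  (summable_mul_pow (summable_succ_mul_coeff (summable_kummerCoeff hb a)) x).hasSum

theorem hasSum_x_mul_kummerM₁ {b : ℂ} (hb : ∀ n : ℕ, b + n ≠ 0) (a x : ℂ) :
    HasSum (fun n : ℕ => (n * kummerCoeff a b n) * x ^ n) (x * kummerM₁ a b x) :=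
  hasSum_mul_of_succ (c := fun n => n * kummerCoeff a b n)
    (by simpa using hasSum_kummerM₁ hb a x) (by simp)

theorem hasSum_x_mul_kummerM₂ {b : ℂ} (hb : ∀ n : ℕ, b + n ≠ 0) (a x : ℂ) :
    HasSum (fun n : ℕ => (n * ((n + 1) * kummerCoeff a b (n + 1))) * x ^ n)
      (x * kummerM₂ a b x) := by
  refine hasSum_mul_of_succ (c := fun n => n * ((n + 1) * kummerCoeff a b (n + 1))) ?_ (by simp)
  have := (summable_mul_pow (summable_succ_mul_coeff (summable_succ_mul_coeff
    (summable_kummerCoeff hb a))) x).hasSum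
  simpa [kummerM₂] using this

/-- Kummer's differential equation. -/
theorem kummerM_ode {b : ℂ} (hb : ∀ n : ℕ, b + n ≠ 0) (a x : ℂ) :
    x * kummerM₂ a b x + (b - x) * kummerM₁ a b x - a * kummerM a b x = 0 := by
  have h := ((hasSum_x_mul_kummerM₂ hb a x).add ((hasSum_kummerM₁ hb a x).mul_left b)).sub
    ((hasSum_x_mul_kummerM₁ hb a x).add ((hasSum_kummerM hb a x).mul_left a))
  rw [show (fun n : ℕ => _) = fun _ : ℕ => (0 : ℂ) from funext fun n => by
    linear_combination x ^ n * kummerCoeff_succ hb a n] at h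
  have := h.unique hasSum_zero
  linear_combination this

/-- A contiguous relation. -/
theorem kummerM_contiguous {b : ℂ} (hb : ∀ n : ℕ, b + n ≠ 0) (a x : ℂ) :
    (x + a - b) * kummerM a b x - x * kummerM₁ a b x = (a - b) * kummerM (a - 1) b x := by
  have hk : ∀ n : ℕ, kummerCoeff (a - 1) b (n + 1) * ((b + n) * (n + 1)) =
      kummerCoeff a b n * (a - 1) := by
    intro n
    have h1 := kummerCoeff_succ hb (a - 1) n
    -- Both sides are the Pochhammer symbol `(a - 1)_{n+1}`, with its last or its first factor split
    -- off.
    have h2 : (ascPochhammer ℂ n).eval (a - 1) * (a - 1 + n) =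
        (a - 1) * (ascPochhammer ℂ n).eval a := by
      rw [← ascPochhammer_succ_eval, ascPochhammer_succ_left]
      simp
    rw [h1]
    simp only [kummerCoeff]
    linear_combination ((ascPochhammer ℂ n).eval b)⁻¹ * ((n.factorial : ℂ))⁻¹ * h2
  have h := (((hasSum_kummerM hb (a - 1) x).mul_left (a - b)).sub
    ((hasSum_kummerM hb a x).mul_left (a - b))).add (hasSum_x_mul_kummerM₁ hb a x)
  have h' : HasSum (fun n : ℕ => ((a - b) * kummerCoeff (a - 1) b n - (a - b) * kummerCoeff a b n
      + n * kummerCoeff a b n) * x ^ n) (x * kummerM a b x) := by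
    refine hasSum_mul_of_succ ?_ (by simp [kummerCoeff])
    convert hasSum_kummerM hb a x using 2 with n
    have h1 := hk n
    have h2 := kummerCoeff_succ hb a n
    have h3 : (n : ℂ) + 1 ≠ 0 := by exact_mod_cast n.succ_ne_zero
    have h4 : (b + n) * ((n : ℂ) + 1) ≠ 0 := mul_ne_zero (hb n) h3
    congr 1
    refine mul_right_cancel₀ h4 ?_
    push_cast
    linear_combination (a - b) * h1 + (n + 1 - (a - b)) * h2
  have h5 := h.unique (h'.congr_fun fun n => by ring)
  linear_combination -h5

/-! ### Second order equations `u'' = q u` on `(0, ∞)` -/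

/-- `u` solves `u'' = q u` on `(0, ∞)`, with derivative `u'`. -/
structure SolvesOn (q : ℝ → ℂ) (u u' : ℝ → ℂ) : Prop where
  deriv₁ : ∀ x, 0 < x → HasDerivAt u (u' x) x
  deriv₂ : ∀ x, 0 < x → HasDerivAt u' (q x * u x) x

/-- The Wronskian. -/
def wronskian (u u' w w' : ℝ → ℂ) (x : ℝ) : ℂ := u x * w' x - u' x * w x

/-- The equation has no first order term, so the Wronskian has derivative zero. -/
theorem SolvesOn.wronskian_eq {q u u' w w' : ℝ → ℂ} (hu : SolvesOn q u u') (hw : SolvesOn q w w')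
    {x y : ℝ} (hx : 0 < x) (hy : 0 < y) : wronskian u u' w w' x = wronskian u u' w w' y := by
  have h : ∀ x, 0 < x → HasDerivAt (wronskian u u' w w') 0 x := fun x hx => by
    have := ((hu.deriv₁ x hx).mul (hw.deriv₂ x hx)).sub ((hu.deriv₂ x hx).mul (hw.deriv₁ x hx))
    refine this.congr_deriv ?_
    ring
  exact isOpen_Ioi.is_const_of_deriv_eq_zero isPreconnected_Ioi
    (fun x hx => (h x hx).differentiableAt.differentiableWithinAt)
    (fun x hx => (h x hx).deriv) hx hy

/-- The constant value is read off at the singular point `0`, where the leading behaviour of the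
solutions is explicit. -/
theorem SolvesOn.wronskian_eq_of_tendsto {q u u' w w' : ℝ → ℂ} (hu : SolvesOn q u u')
    (hw : SolvesOn q w w') {L : ℂ} (h : Tendsto (wronskian u u' w w') (𝓝[>] 0) (𝓝 L))
    {x : ℝ} (hx : 0 < x) : wronskian u u' w w' x = L := by
  refine tendsto_nhds_unique ?_ h
  refine tendsto_const_nhds.congr' ?_
  filter_upwards [self_mem_nhdsWithin] with y hy
  exact hu.wronskian_eq hw hx hy

theorem SolvesOn.const_mul {q u u' : ℝ → ℂ} (hu : SolvesOn q u u') (c : ℂ) :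
    SolvesOn q (fun x => c * u x) (fun x => c * u' x) :=
  ⟨fun x hx => (hu.deriv₁ x hx).const_mul c,
    fun x hx => ((hu.deriv₂ x hx).const_mul c).congr_deriv (by ring)⟩

theorem SolvesOn.add {q u u' w w' : ℝ → ℂ} (hu : SolvesOn q u u') (hw : SolvesOn q w w') :
    SolvesOn q (fun x => u x + w x) (fun x => u' x + w' x) :=
  ⟨fun x hx => (hu.deriv₁ x hx).add (hw.deriv₁ x hx),
    fun x hx => ((hu.deriv₂ x hx).add (hw.deriv₂ x hx)).congr_deriv (by ring)⟩

/-! ### Whittaker's equation -/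

/-- The potential of Whittaker's equation. -/
def whitQ (κ μ : ℂ) (x : ℝ) : ℂ := 1 / 4 - κ / x - (1 / 4 - μ ^ 2) / x ^ 2

/-- The factor `e^{-x/2} x^{μ + 1/2}`. -/
def whitFactor (μ : ℂ) (x : ℝ) : ℂ := (Real.exp (-x / 2) : ℂ) * (x : ℂ) ^ (μ + 1 / 2)

theorem hasDerivAt_whitFactor (μ : ℂ) {x : ℝ} (hx : 0 < x) :
    HasDerivAt (whitFactor μ) ((-1 / 2 + (μ + 1 / 2) / x) * whitFactor μ x) x := by
  have h1 : HasDerivAt (fun x : ℝ => (Real.exp (-x / 2) : ℂ))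
      ((Real.exp (-x / 2) * (-1 / 2) : ℝ) : ℂ) x := by
    have : HasDerivAt (fun x : ℝ => Real.exp (-x / 2)) (Real.exp (-x / 2) * (-1 / 2)) x :=
      ((hasDerivAt_id x).neg.div_const 2).exp
    exact this.ofReal_comp
  have hx' : (x : ℂ) ≠ 0 := by exact_mod_cast hx.ne'
  have h2 : HasDerivAt (fun x : ℝ => (x : ℂ) ^ (μ + 1 / 2))
      ((μ + 1 / 2) * (x : ℂ) ^ (μ + 1 / 2 - 1)) x := by
    have := ((hasDerivAt_id (x : ℂ)).cpow_const (c := μ + 1 / 2)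
      (Complex.ofReal_mem_slitPlane.2 hx)).comp_ofReal
    simpa using this
  refine (h1.mul h2).congr_deriv ?_
  rw [Complex.cpow_sub _ _ hx', Complex.cpow_one]
  simp only [whitFactor]
  push_cast
  field_simp

/-- Multiplication by `e^{-x/2} x^{μ+1/2}` carries Kummer's equation with `a = μ - κ + 1/2`, `b = 1
+ 2μ` to Whittaker's. The solution `E` is left arbitrary so that both the power series and the
Laplace integral can be inserted. -/
theorem solvesOn_of_kummer {κ μ : ℂ} {E E₁ E₂ : ℝ → ℂ}
    (h1 : ∀ x, 0 < x → HasDerivAt E (E₁ x) x) (h2 : ∀ x, 0 < x → HasDerivAt E₁ (E₂ x) x)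
    (h3 : ∀ x : ℝ, 0 < x → x * E₂ x + (1 + 2 * μ - x) * E₁ x - (μ - κ + 1 / 2) * E x = 0) :
    SolvesOn (whitQ κ μ) (fun x => whitFactor μ x * E x)
      (fun x => whitFactor μ x * (E₁ x + (-1 / 2 + (μ + 1 / 2) / x) * E x)) := by
  refine ⟨fun x hx => ?_, fun x hx => ?_⟩
  · refine ((hasDerivAt_whitFactor μ hx).mul (h1 x hx)).congr_deriv ?_
    ring
  · have hx' : (x : ℂ) ≠ 0 := by exact_mod_cast hx.ne'
    have hd : HasDerivAt (fun x : ℝ => (-1 / 2 + (μ + 1 / 2) / x : ℂ))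
        (-(μ + 1 / 2) / (x : ℂ) ^ 2) x := by
      have := (((hasDerivAt_id (x : ℂ)).inv hx').const_mul (μ + 1 / 2)).const_add (-1 / 2 : ℂ)
      have := this.comp_ofReal
      refine (this.congr_deriv ?_).congr_of_eventuallyEq (Eventually.of_forall fun y => ?_)
      · simp only [id]
        ring
      · simp [div_eq_mul_inv]
    refine ((hasDerivAt_whitFactor μ hx).mul ((h2 x hx).add (hd.mul (h1 x hx)))).congr_deriv ?_
    have := h3 x hx
    simp only [whitQ, Pi.add_apply, Pi.mul_apply]
    field_simp
    linear_combination 16 * x * whitFactor μ x * this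

/-- The solution `e^{-x/2} x^{μ+1/2} M(μ - κ + 1/2, 1 + 2μ, x)` of Whittaker's equation. -/
def whitM (κ μ : ℂ) (x : ℝ) : ℂ := whitFactor μ x * kummerM (μ - κ + 1 / 2) (1 + 2 * μ) x

/-- The derivative of `whitM`. -/
def whitM' (κ μ : ℂ) (x : ℝ) : ℂ := whitFactor μ x * (kummerM₁ (μ - κ + 1 / 2) (1 + 2 * μ) x +
  (-1 / 2 + (μ + 1 / 2) / x) * kummerM (μ - κ + 1 / 2) (1 + 2 * μ) x)

theorem solvesOn_whitM {μ : ℂ} (hb : ∀ n : ℕ, 1 + 2 * μ + n ≠ 0) (κ : ℂ) :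
    SolvesOn (whitQ κ μ) (whitM κ μ) (whitM' κ μ) :=
  solvesOn_of_kummer (fun x _ => (hasDerivAt_kummerM hb _ x).comp_ofReal)
    (fun x _ => (hasDerivAt_kummerM₁ hb _ x).comp_ofReal) fun x _ => kummerM_ode hb _ x

theorem one_add_two_mul_ne {μ : ℂ} (hμ : μ.im ≠ 0) (n : ℕ) : 1 + 2 * μ + n ≠ 0 := fun h => by
  have := congrArg Complex.im h
  simp at this
  exact hμ this

theorem kummerM_zero (a b : ℂ) : kummerM a b 0 = 1 := by
  rw [kummerM_eq, tsum_eq_single 0 (fun n hn => by simp [hn])]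
  simp [kummerCoeff]

theorem continuous_kummerM {b : ℂ} (hb : ∀ n : ℕ, b + n ≠ 0) (a : ℂ) : Continuous (kummerM a b) :=
  continuous_iff_continuousAt.2 fun x => (hasDerivAt_kummerM hb a x).continuousAt

theorem continuous_kummerM₁ {b : ℂ} (hb : ∀ n : ℕ, b + n ≠ 0) (a : ℂ) :
    Continuous (kummerM₁ a b) :=
  continuous_iff_continuousAt.2 fun x => (hasDerivAt_kummerM₁ hb a x).continuousAt

theorem tendsto_ofReal_of_continuous {F : ℂ → ℂ} (hF : Continuous F) :
    Tendsto (fun x : ℝ => F x) (𝓝[>] 0) (𝓝 (F 0)) := by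
  have := (hF.comp Complex.continuous_ofReal).tendsto 0
  simpa [Function.comp_def] using this.mono_left nhdsWithin_le_nhds

theorem whitFactor_mul_neg (μ : ℂ) {x : ℝ} (hx : 0 < x) :
    whitFactor μ x * whitFactor (-μ) x = (Real.exp (-x) : ℂ) * x := by
  have hx' : (x : ℂ) ≠ 0 := by exact_mod_cast hx.ne'
  simp only [whitFactor]
  rw [mul_mul_mul_comm, ← Complex.cpow_add _ _ hx', ← Complex.ofReal_mul, ← Real.exp_add,
    show μ + 1 / 2 + (-μ + 1 / 2) = 1 by ring, Complex.cpow_one]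
  ring_nf

theorem whitFactor_sq (μ : ℂ) {x : ℝ} (hx : 0 < x) :
    whitFactor μ x * whitFactor μ x = (Real.exp (-x) : ℂ) * (x : ℂ) ^ (1 + 2 * μ) := by
  have hx' : (x : ℂ) ≠ 0 := by exact_mod_cast hx.ne'
  simp only [whitFactor]
  rw [mul_mul_mul_comm, ← Complex.cpow_add _ _ hx', ← Complex.ofReal_mul, ← Real.exp_add]
  ring_nf

theorem tendsto_exp_neg : Tendsto (fun x : ℝ => (Real.exp (-x) : ℂ)) (𝓝[>] 0) (𝓝 1) := by
  have : Continuous fun x : ℂ => Complex.exp (-x) := by fun_prop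
  simpa using tendsto_ofReal_of_continuous this

theorem whitQ_neg (κ μ : ℂ) : whitQ κ (-μ) = whitQ κ μ := by
  funext x
  simp [whitQ]

/-- The two prefactors multiply to `e^{-x} x`, so as `x → 0` only the `1/x` terms of the logarithmic
derivatives survive; they contribute `(-μ + 1/2) - (μ + 1/2) = -2μ`. -/
theorem wronskian_whitM {μ : ℂ} (hμ : μ.im ≠ 0) (κ : ℂ) {x : ℝ} (hx : 0 < x) :
    wronskian (whitM κ μ) (whitM' κ μ) (whitM κ (-μ)) (whitM' κ (-μ)) x = -2 * μ := by
  have hb := one_add_two_mul_ne hμ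
  have hb' := one_add_two_mul_ne (μ := -μ) (by simpa using hμ)
  have hs := solvesOn_whitM hb' κ
  rw [whitQ_neg] at hs
  refine (solvesOn_whitM hb κ).wronskian_eq_of_tendsto hs ?_ hx
  have hA := tendsto_ofReal_of_continuous (continuous_kummerM hb (μ - κ + 1 / 2))
  have hB := tendsto_ofReal_of_continuous (continuous_kummerM hb' (-μ - κ + 1 / 2))
  have hA₁ := tendsto_ofReal_of_continuous (continuous_kummerM₁ hb (μ - κ + 1 / 2))
  have hB₁ := tendsto_ofReal_of_continuous (continuous_kummerM₁ hb' (-μ - κ + 1 / 2))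
  have hx0 : Tendsto (fun x : ℝ => (x : ℂ)) (𝓝[>] 0) (𝓝 0) := by
    simpa using tendsto_ofReal_of_continuous (F := fun x => x) continuous_id
  rw [kummerM_zero] at hA hB
  have h1 := hx0.mul ((hA.mul hB₁).sub (hA₁.mul hB))
  have h2 := (hA.mul hB).const_mul (2 * μ)
  have h := tendsto_exp_neg.mul (h1.sub h2)
  simp only [zero_mul, mul_one, zero_sub, one_mul] at h
  rw [neg_mul]
  refine h.congr' ?_
  filter_upwards [self_mem_nhdsWithin] with x hx
  have hx' : (x : ℂ) ≠ 0 := by exact_mod_cast (mem_Ioi.1 hx).ne'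
  have hf := whitFactor_mul_neg μ hx
  simp only [wronskian, whitM, whitM']
  generalize kummerM (μ - κ + 1 / 2) (1 + 2 * μ) x = A at *
  generalize kummerM₁ (μ - κ + 1 / 2) (1 + 2 * μ) x = A₁ at *
  generalize kummerM (-μ - κ + 1 / 2) (1 + 2 * -μ) x = B at *
  generalize kummerM₁ (-μ - κ + 1 / 2) (1 + 2 * -μ) x = B₁ at *
  generalize whitFactor μ x = p at *
  generalize whitFactor (-μ) x = q at *
  linear_combination (-(A * B₁ - A₁ * B) + 2 * μ / x * (A * B)) * hf +
    (2 * μ * (Real.exp (-x) : ℂ) * (A * B)) * (mul_inv_cancel₀ hx')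

/-- Wronskians express every function as a combination of the two `whitM`. -/
theorem eq_whitM (κ : ℂ) {μ : ℂ} (hμ : μ.im ≠ 0) (u u' : ℝ → ℂ)
    {x : ℝ} (hx : 0 < x) :
    -2 * μ * u x = wronskian u u' (whitM κ (-μ)) (whitM' κ (-μ)) x * whitM κ μ x -
      wronskian u u' (whitM κ μ) (whitM' κ μ) x * whitM κ (-μ) x := by
  rw [← wronskian_whitM hμ κ hx]
  simp only [wronskian]
  ring

/-- The contiguous relation for `whitM`. -/
theorem whitM_contiguous {μ : ℂ} (hμ : μ.im ≠ 0) (κ : ℂ) {x : ℝ} (hx : 0 < x) :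
    (x / 2 - κ) * whitM κ μ x - x * whitM' κ μ x = (-1 / 2 - μ - κ) * whitM (κ + 1) μ x := by
  have h := kummerM_contiguous (one_add_two_mul_ne hμ) (μ - κ + 1 / 2) x
  have hx' : (x : ℂ) ≠ 0 := by exact_mod_cast hx.ne'
  rw [show μ - κ + 1 / 2 - 1 = μ - (κ + 1) + 1 / 2 by ring] at h
  simp only [whitM, whitM']
  generalize kummerM (μ - κ + 1 / 2) (1 + 2 * μ) x = A at *
  generalize kummerM₁ (μ - κ + 1 / 2) (1 + 2 * μ) x = A₁ at *
  generalize kummerM (μ - (κ + 1) + 1 / 2) (1 + 2 * μ) x = B at *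
  field_simp
  linear_combination 2 * whitFactor μ x * h

/-! ### The Laplace integral -/

/-- The integrand `e^{-xt} t^p (1+t)^s`. -/
def laplaceKernel (p s : ℂ) (x t : ℝ) : ℂ :=
  (Real.exp (-(x * t)) : ℂ) * ((t : ℂ) ^ p * ((1 + t : ℝ) : ℂ) ^ s)

/-- `∫_0^∞ e^{-xt} t^p (1+t)^s dt`. -/
def laplaceInt (p s : ℂ) (x : ℝ) : ℂ := ∫ t in Ioi (0 : ℝ), laplaceKernel p s x t

theorem norm_laplaceKernel (p s : ℂ) (x : ℝ) {t : ℝ} (ht : 0 < t) :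
    ‖laplaceKernel p s x t‖ = Real.exp (-(x * t)) * (t ^ p.re * (1 + t) ^ s.re) := by
  rw [laplaceKernel, norm_mul, norm_mul, Complex.norm_cpow_eq_rpow_re_of_pos ht,
    Complex.norm_cpow_eq_rpow_re_of_pos (by linarith), Complex.norm_real, Real.norm_eq_abs,
    abs_of_pos (Real.exp_pos _)]

theorem continuousOn_laplaceKernel (p s : ℂ) (x : ℝ) :
    ContinuousOn (laplaceKernel p s x) (Ioi 0) := by
  intro t ht
  have ht : 0 < t := ht
  have h1 : ContinuousAt (fun t : ℝ => (t : ℂ) ^ p) t :=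
    (Complex.continuousAt_ofReal_cpow_const t p (Or.inr ht.ne'))
  have h2 : ContinuousAt (fun t : ℝ => ((1 + t : ℝ) : ℂ) ^ s) t :=
    (Complex.continuousAt_ofReal_cpow_const (1 + t) s (Or.inr (by linarith))).comp
      (f := fun t : ℝ => 1 + t) (by fun_prop)
  have h3 : ContinuousAt (fun t : ℝ => (Real.exp (-(x * t)) : ℂ)) t := by fun_prop
  exact (h3.mul (h1.mul h2)).continuousWithinAt

/-- Half of the exponential absorbs the growing power, through `(x/2)^n (1+t)^n / n! ≤
e^{x(1+t)/2}`; the other half leaves a Gamma-type integral, convergent at `0` because `Re p > -1`.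
-/
theorem integrableOn_laplaceKernel {p : ℂ} (hp : -1 < p.re) (s : ℂ) {x : ℝ} (hx : 0 < x) :
    IntegrableOn (laplaceKernel p s x) (Ioi 0) := by
  obtain ⟨n, hn⟩ := exists_nat_ge s.re
  have h1 : IntegrableOn (fun t : ℝ => t ^ p.re * Real.exp (-(x / 2) * t ^ (1 : ℝ))) (Ioi 0) :=
    integrableOn_rpow_mul_exp_neg_mul_rpow hp one_pos (by positivity)
  have h2 := h1.const_mul (n.factorial * (2 / x) ^ n * Real.exp (x / 2))
  refine h2.mono' ((continuousOn_laplaceKernel p s x).aestronglyMeasurable measurableSet_Ioi) ?_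
  refine (ae_restrict_iff' measurableSet_Ioi).2 (Eventually.of_forall fun t ht => ?_)
  have ht : 0 < t := ht
  rw [norm_laplaceKernel p s x ht, Real.rpow_one]
  have h3 : (1 + t) ^ s.re ≤ (1 + t) ^ n := by
    rw [← Real.rpow_natCast]
    exact Real.rpow_le_rpow_of_exponent_le (by linarith) hn
  have h4 := Real.pow_div_factorial_le_exp (x / 2 * (1 + t)) (by positivity) n
  rw [div_le_iff₀ (by positivity), mul_pow] at h4
  have h5 : (1 + t) ^ n ≤ n.factorial * (2 / x) ^ n * Real.exp (x / 2 * (1 + t)) := by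
    have : (1 + t) ^ n = (2 / x) ^ n * ((x / 2) ^ n * (1 + t) ^ n) := by
      rw [← mul_assoc, ← mul_pow, show 2 / x * (x / 2) = 1 by field_simp]
      simp
    rw [this]
    calc _ ≤ (2 / x) ^ n * (Real.exp (x / 2 * (1 + t)) * n.factorial) := by gcongr
      _ = _ := by ring
  have h6 : Real.exp (-(x * t)) * Real.exp (x / 2 * (1 + t)) =
      Real.exp (x / 2) * Real.exp (-(x / 2) * t) := by
    rw [← Real.exp_add, ← Real.exp_add]
    ring_nf
  calc Real.exp (-(x * t)) * (t ^ p.re * (1 + t) ^ s.re)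
      ≤ Real.exp (-(x * t)) * (t ^ p.re *
          (n.factorial * (2 / x) ^ n * Real.exp (x / 2 * (1 + t)))) := by
        gcongr
        exact h3.trans h5
    _ = n.factorial * (2 / x) ^ n * t ^ p.re *
        (Real.exp (-(x * t)) * Real.exp (x / 2 * (1 + t))) := by ring
    _ = _ := by rw [h6]; ring

theorem laplaceKernel_add_one_left (p s : ℂ) (x : ℝ) {t : ℝ} (ht : 0 < t) :
    laplaceKernel (p + 1) s x t = t * laplaceKernel p s x t := by
  have ht' : (t : ℂ) ≠ 0 := by exact_mod_cast ht.ne'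
  rw [laplaceKernel, Complex.cpow_add _ _ ht', Complex.cpow_one, laplaceKernel]
  ring

theorem laplaceKernel_add_one_right (p s : ℂ) (x : ℝ) {t : ℝ} (ht : 0 < t) :
    laplaceKernel p (s + 1) x t = laplaceKernel (p + 1) s x t + laplaceKernel p s x t := by
  have ht' : ((1 + t : ℝ) : ℂ) ≠ 0 := by exact_mod_cast (by linarith : 1 + t ≠ 0)
  rw [laplaceKernel_add_one_left p s x ht, laplaceKernel, Complex.cpow_add _ _ ht',
    Complex.cpow_one, laplaceKernel]
  push_cast
  ring

theorem laplaceInt_add_one_right {p : ℂ} (hp : -1 < p.re) (s : ℂ) {x : ℝ} (hx : 0 < x) :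
    laplaceInt p (s + 1) x = laplaceInt (p + 1) s x + laplaceInt p s x := by
  rw [laplaceInt, laplaceInt, laplaceInt, ← integral_add
    (integrableOn_laplaceKernel (by simp; linarith) s hx) (integrableOn_laplaceKernel hp s hx)]
  exact setIntegral_congr_fun measurableSet_Ioi fun t ht => laplaceKernel_add_one_right p s x ht

theorem hasDerivAt_laplaceInt {p : ℂ} (hp : -1 < p.re) (s : ℂ) {x : ℝ} (hx : 0 < x) :
    HasDerivAt (laplaceInt p s) (-laplaceInt (p + 1) s x) x := by
  have hp' : -1 < (p + 1).re := by simp; linarith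
  have hx2 : 0 < x / 2 := by positivity
  have h := hasDerivAt_integral_of_dominated_loc_of_deriv_le (μ := volume.restrict (Ioi (0 : ℝ)))
    (F := laplaceKernel p s) (F' := fun x t => -laplaceKernel (p + 1) s x t) (x₀ := x)
    (s := Ioi (x / 2)) (bound := fun t => ‖laplaceKernel (p + 1) s (x / 2) t‖)
    (Ioi_mem_nhds (by linarith)) (Eventually.of_forall fun y =>
      (continuousOn_laplaceKernel p s y).aestronglyMeasurable measurableSet_Ioi)
    (integrableOn_laplaceKernel hp s hx)
    ((continuousOn_laplaceKernel _ s x).aestronglyMeasurable measurableSet_Ioi).neg ?_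
    (integrableOn_laplaceKernel hp' s hx2).norm ?_
  · have h2 := h.2
    rw [integral_neg] at h2
    exact h2
  · refine (ae_restrict_iff' measurableSet_Ioi).2 (Eventually.of_forall fun t ht y hy => ?_)
    have ht : 0 < t := ht
    have hy : x / 2 < y := hy
    rw [norm_neg, norm_laplaceKernel _ _ _ ht, norm_laplaceKernel _ _ _ ht]
    gcongr
  · refine (ae_restrict_iff' measurableSet_Ioi).2 (Eventually.of_forall fun t ht y _ => ?_)
    rw [laplaceKernel_add_one_left p s y ht]
    have h1 : HasDerivAt (fun y : ℝ => (Real.exp (-(y * t)) : ℂ))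
        ((Real.exp (-(y * t)) * -(1 * t) : ℝ) : ℂ) y :=
      (((hasDerivAt_id y).mul_const t).neg.exp).ofReal_comp
    refine (h1.mul_const _).congr_deriv ?_
    simp only [laplaceKernel]
    push_cast
    ring

theorem hasDerivAt_ofReal_cpow' (p : ℂ) {t : ℝ} (ht : 0 < t) :
    HasDerivAt (fun t : ℝ => (t : ℂ) ^ p) (p * (t : ℂ) ^ (p - 1)) t := by
  have := ((hasDerivAt_id (t : ℂ)).cpow_const (c := p)
    (Complex.ofReal_mem_slitPlane.2 ht)).comp_ofReal
  simpa using this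

/-- Integration by parts. -/
theorem laplaceInt_parts {p : ℂ} (hp : 0 < p.re) (s : ℂ) {x : ℝ} (hx : 0 < x) :
    -x * laplaceInt p s x + p * laplaceInt (p - 1) s x + s * laplaceInt p (s - 1) x = 0 := by
  have i1 := integrableOn_laplaceKernel (by linarith : -1 < p.re) s hx
  have i2 := integrableOn_laplaceKernel (p := p - 1) (by simpa using hp) s hx
  have i3 := integrableOn_laplaceKernel (by linarith : -1 < p.re) (s - 1) hx
  have hd : ∀ t ∈ Ioi (0 : ℝ), HasDerivAt (laplaceKernel p s x) (-x * laplaceKernel p s x t +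
      p * laplaceKernel (p - 1) s x t + s * laplaceKernel p (s - 1) x t) t := by
    intro t ht
    have ht : 0 < t := ht
    have h1 : HasDerivAt (fun t : ℝ => (Real.exp (-(x * t)) : ℂ))
        ((Real.exp (-(x * t)) * -(x * 1) : ℝ) : ℂ) t :=
      (((hasDerivAt_id t).const_mul x).neg.exp).ofReal_comp
    have h2 := hasDerivAt_ofReal_cpow' p ht
    have h3 : HasDerivAt (fun t : ℝ => ((1 + t : ℝ) : ℂ) ^ s)
        (s * ((1 + t : ℝ) : ℂ) ^ (s - 1)) t := by
      have := (hasDerivAt_ofReal_cpow' s (by linarith : 0 < 1 + t)).scomp t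
        ((hasDerivAt_id t).const_add 1)
      simpa [Function.comp_def] using this
    refine (h1.mul (h2.mul h3)).congr_deriv ?_
    simp only [laplaceKernel, Pi.mul_apply]
    push_cast
    ring
  have hint := ((i1.const_mul (-x : ℂ)).add (i2.const_mul p)).add (i3.const_mul s)
  have hp0 : p ≠ 0 := fun h => by simp [h] at hp
  have h0 : ContinuousAt (laplaceKernel p s x) 0 := by
    have h1 : ContinuousAt (fun t : ℝ => (t : ℂ) ^ p) 0 :=
      Complex.continuousAt_ofReal_cpow_const 0 p (Or.inl hp)
    have h2 : ContinuousAt (fun t : ℝ => ((1 + t : ℝ) : ℂ) ^ s) 0 :=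
      (Complex.continuousAt_ofReal_cpow_const (1 + 0) s (Or.inr (by norm_num))).comp
        (f := fun t : ℝ => 1 + t) (by fun_prop)
    have h3 : ContinuousAt (fun t : ℝ => (Real.exp (-(x * t)) : ℂ)) 0 := by fun_prop
    exact h3.mul (h1.mul h2)
  have hinf := tendsto_zero_of_hasDerivAt_of_integrableOn_Ioi hd hint i1
  have h := integral_Ioi_of_hasDerivAt_of_tendsto h0.continuousWithinAt hd hint hinf
  have hz : laplaceKernel p s x 0 = 0 := by simp [laplaceKernel, Complex.zero_cpow hp0]
  have i12 : IntegrableOn (fun t => -x * laplaceKernel p s x t + p * laplaceKernel (p - 1) s x t)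
    (Ioi 0) := (i1.const_mul (-x : ℂ)).add (i2.const_mul p)
  rw [integral_add i12 (i3.const_mul s),
    integral_add (i1.const_mul (-x : ℂ)) (i2.const_mul p), integral_const_mul, integral_const_mul,
    integral_const_mul, hz, sub_zero] at h
  exact h

/-- Integration by parts with `s = b - a`, after which a factor `1 + t` is expanded so that every
power of `1 + t` becomes `b - a - 1`. The entries are the second derivative, the derivative and the
value of one and the same integral. -/
theorem laplaceInt_kummer {a : ℂ} (ha : 0 < a.re) (b : ℂ) {x : ℝ} (hx : 0 < x) :
    x * laplaceInt (a + 1) (b - a - 1) x + (b - x) * -laplaceInt a (b - a - 1) x -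
      a * laplaceInt (a - 1) (b - a - 1) x = 0 := by
  have h := laplaceInt_parts ha (b - a) hx
  have e1 := laplaceInt_add_one_right (by linarith : -1 < a.re) (b - a - 1) hx
  have e2 := laplaceInt_add_one_right (p := a - 1) (by simpa using ha) (b - a - 1) hx
  rw [sub_add_cancel] at e1 e2
  rw [sub_add_cancel] at e2
  rw [e1, e2] at h
  linear_combination -h

theorem ofReal_cpow_eq_exp (p : ℂ) {t : ℝ} (ht : 0 < t) :
    (t : ℂ) ^ p = Complex.exp (p * (Real.log t : ℂ)) := by
  rw [Complex.cpow_def_of_ne_zero (by exact_mod_cast ht.ne'), Complex.ofReal_log ht.le, mul_comm]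

/-- Euler's beta integral on the half-line. -/
theorem integral_Ioi_cpow_mul_one_add_cpow (u v : ℂ) :
    ∫ t in Ioi (0 : ℝ), (t : ℂ) ^ (u - 1) * ((1 + t : ℝ) : ℂ) ^ (-u - v) =
      Complex.betaIntegral u v := by
  -- The substitution is `t = x / (1 - x)`, written `(1 - x)⁻¹ - 1`. All powers are then turned into
  -- exponentials of real logarithms, so that only a linear identity of exponents remains.
  have himg : (fun x : ℝ => (1 - x)⁻¹ - 1) '' Ioo 0 1 = Ioi 0 := by
    ext t
    constructor
    · rintro ⟨x, ⟨h0, h1⟩, rfl⟩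
      have : 1 < (1 - x)⁻¹ := (one_lt_inv₀ (by linarith)).2 (by linarith)
      simpa using this
    · intro ht
      have ht : 0 < t := ht
      have h1 : (1 + t)⁻¹ < 1 := inv_lt_one_of_one_lt₀ (by linarith)
      have h2 : 0 < (1 + t)⁻¹ := by positivity
      exact ⟨1 - (1 + t)⁻¹, ⟨by linarith, by linarith⟩, by simp⟩
  have hinj : InjOn (fun x : ℝ => (1 - x)⁻¹ - 1) (Ioo 0 1) := fun x _ y _ h => by
    have h : (1 - x)⁻¹ - 1 = (1 - y)⁻¹ - 1 := h
    have := inv_injective (sub_left_injective h)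
    linarith
  have hder : ∀ x ∈ Ioo (0 : ℝ) 1, HasDerivWithinAt (fun x : ℝ => (1 - x)⁻¹ - 1)
      (((1 - x) ^ 2)⁻¹) (Ioo 0 1) x := fun x hx => by
    have h1 : (1 - x) ≠ 0 := by linarith [hx.2]
    have := (((hasDerivAt_id x).const_sub 1).inv h1).sub_const 1
    refine (this.congr_deriv ?_).hasDerivWithinAt
    simp [div_eq_mul_inv]
  rw [← himg, integral_image_eq_integral_abs_deriv_smul measurableSet_Ioo hder hinj,
    Complex.betaIntegral, intervalIntegral.integral_of_le zero_le_one, integral_Ioc_eq_integral_Ioo]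
  refine setIntegral_congr_fun measurableSet_Ioo fun x hx => ?_
  have h0 : 0 < x := hx.1
  have h1 : 0 < 1 - x := by linarith [hx.2]
  have e1 : (1 - x)⁻¹ - 1 = x / (1 - x) := by field_simp; ring
  have e2 : 1 + ((1 - x)⁻¹ - 1) = (1 - x)⁻¹ := by ring
  have e3 : (((((1 - x) ^ 2)⁻¹ : ℝ)) : ℂ) = Complex.exp (-2 * (Real.log (1 - x) : ℂ)) := by
    have : ((1 - x) ^ 2)⁻¹ = Real.exp (-2 * Real.log (1 - x)) := by
      rw [neg_mul, Real.exp_neg, ← Real.log_rpow h1, Real.exp_log (by positivity)]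
      norm_num
    rw [this]
    push_cast
    rfl
  have e4 : (1 - x : ℂ) = ((1 - x : ℝ) : ℂ) := by push_cast; rfl
  rw [e2, e1, e4, ofReal_cpow_eq_exp _ h0, ofReal_cpow_eq_exp _ h1,
    ofReal_cpow_eq_exp _ (div_pos h0 h1), ofReal_cpow_eq_exp _ (inv_pos.2 h1),
    abs_of_pos (by positivity), Complex.real_smul, e3, Real.log_div h0.ne' h1.ne', Real.log_inv,
    ← Complex.exp_add, ← Complex.exp_add, ← Complex.exp_add]
  congr 1
  push_cast
  ring

/-! ### Limits of the Laplace integral as `x → 0⁺`. -/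

theorem integrableOn_laplaceKernel_zero {p s : ℂ} (hp : -1 < p.re) (hps : p.re + s.re < -1)
    (hs : s.re ≤ 0) : IntegrableOn (laplaceKernel p s 0) (Ioi 0) := by
  have hsplit : Ioi (0 : ℝ) = Ioc 0 1 ∪ Ioi 1 := (Ioc_union_Ioi_eq_Ioi zero_le_one).symm
  rw [hsplit]
  refine IntegrableOn.union ?_ ?_
  · have h : IntegrableOn (fun t : ℝ => t ^ p.re) (Ioc 0 1) :=
      (intervalIntegrable_iff_integrableOn_Ioc_of_le zero_le_one).1
        (intervalIntegral.intervalIntegrable_rpow' hp)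
    refine h.mono' (((continuousOn_laplaceKernel p s 0).mono
      Ioc_subset_Ioi_self).aestronglyMeasurable measurableSet_Ioc) ?_
    refine (ae_restrict_iff' measurableSet_Ioc).2 (Eventually.of_forall fun t ht => ?_)
    rw [norm_laplaceKernel p s 0 ht.1]
    have h1 : (1 + t) ^ s.re ≤ 1 := Real.rpow_le_one_of_one_le_of_nonpos (by linarith [ht.1]) hs
    have h2 : 0 ≤ t ^ p.re := Real.rpow_nonneg ht.1.le _
    simpa using mul_le_of_le_one_right h2 h1
  · have h := integrableOn_Ioi_rpow_of_lt hps one_pos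
    refine h.mono' (((continuousOn_laplaceKernel p s 0).mono
      (Ioi_subset_Ioi zero_le_one)).aestronglyMeasurable measurableSet_Ioi) ?_
    refine (ae_restrict_iff' measurableSet_Ioi).2 (Eventually.of_forall fun t ht => ?_)
    have ht : 0 < t := one_pos.trans ht
    rw [norm_laplaceKernel p s 0 ht, Real.rpow_add ht]
    have h1 : (1 + t) ^ s.re ≤ t ^ s.re := Real.rpow_le_rpow_of_nonpos ht (by linarith) hs
    simp only [zero_mul, neg_zero, Real.exp_zero, one_mul]
    gcongr

theorem tendsto_laplaceInt_zero {p s : ℂ} (hp : -1 < p.re) (hps : p.re + s.re < -1)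
    (hs : s.re ≤ 0) : Tendsto (laplaceInt p s) (𝓝[>] 0) (𝓝 (Complex.betaIntegral (p + 1)
      (-s - p - 1))) := by
  rw [← integral_Ioi_cpow_mul_one_add_cpow]
  refine tendsto_integral_filter_of_dominated_convergence (fun t => ‖laplaceKernel p s 0 t‖)
    (Eventually.of_forall fun y =>
      (continuousOn_laplaceKernel p s y).aestronglyMeasurable measurableSet_Ioi) ?_
    (integrableOn_laplaceKernel_zero hp hps hs).norm ?_
  · filter_upwards [self_mem_nhdsWithin] with x hx
    have hx : 0 < x := hx
    refine (ae_restrict_iff' measurableSet_Ioi).2 (Eventually.of_forall fun t ht => ?_)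
    have ht : 0 < t := ht
    rw [norm_laplaceKernel _ _ _ ht, norm_laplaceKernel _ _ _ ht]
    gcongr
  · refine Eventually.of_forall fun t => ?_
    have h1 : Continuous fun x : ℝ => laplaceKernel p s x t := by
      unfold laplaceKernel
      fun_prop
    have h2 := (h1.tendsto 0).mono_left (nhdsWithin_le_nhds (s := Ioi 0))
    convert h2 using 2
    simp only [laplaceKernel, zero_mul, neg_zero, Real.exp_zero, Complex.ofReal_one, one_mul]
    ring_nf

/-- The substitution `s = x t`; the powers of `x` balance as `b = a + (b - a - 1) + 1`. In this form
the limit `x → 0` can be taken inside the integral. -/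
theorem cpow_mul_laplaceInt {a b : ℂ} {x : ℝ} (hx : 0 < x) :
    (x : ℂ) ^ b * laplaceInt a (b - a - 1) x =
      ∫ s in Ioi (0 : ℝ), (Real.exp (-s) : ℂ) * ((s : ℂ) ^ a * ((x + s : ℝ) : ℂ) ^ (b - a - 1)) := by
  have h := integral_comp_mul_left_Ioi (fun s : ℝ => (Real.exp (-s) : ℂ) *
    ((s : ℂ) ^ a * ((x + s : ℝ) : ℂ) ^ (b - a - 1))) 0 hx
  rw [mul_zero] at h
  have hx' : (x : ℂ) ≠ 0 := by exact_mod_cast hx.ne'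
  rw [eq_inv_smul_iff₀ hx.ne'] at h
  rw [← h, laplaceInt, ← integral_const_mul, Complex.real_smul, ← integral_const_mul]
  refine setIntegral_congr_fun measurableSet_Ioi fun t ht => ?_
  have ht : 0 < t := ht
  simp only [laplaceKernel]
  rw [show x + x * t = x * (1 + t) by ring, ofReal_cpow_eq_exp _ hx, ofReal_cpow_eq_exp _ ht,
    ofReal_cpow_eq_exp _ (by linarith : 0 < 1 + t), ofReal_cpow_eq_exp _ (mul_pos hx ht),
    ofReal_cpow_eq_exp _ (by positivity : 0 < x * (1 + t)), Real.log_mul hx.ne' ht.ne',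
    Real.log_mul hx.ne' (by linarith)]
  have hx2 : (x : ℂ) = Complex.exp (Real.log x : ℂ) := by
    rw [← Complex.ofReal_exp, Real.exp_log hx]
  have key : Complex.exp (b * (Real.log x : ℂ)) = x * (Complex.exp (a * (Real.log x : ℂ)) *
      Complex.exp ((b - a - 1) * (Real.log x : ℂ))) := by
    nth_rewrite 1 [hx2]
    rw [← Complex.exp_add, ← Complex.exp_add]
    ring_nf
  rw [key, Complex.ofReal_add, Complex.ofReal_add, mul_add, mul_add, Complex.exp_add,
    Complex.exp_add]
  ring

/-- On the line `Re b = 1` the two powers have moduli `s^{Re a}` and `(x + s)^{-Re a}`, with product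
at most `1`, so `e^{-s}` dominates; the limiting integrand is that of `Γ(b)`. -/
theorem tendsto_cpow_mul_laplaceInt {a b : ℂ} (ha : 0 < a.re) (hb : b.re = 1) :
    Tendsto (fun x : ℝ => (x : ℂ) ^ b * laplaceInt a (b - a - 1) x) (𝓝[>] 0)
      (𝓝 (Complex.Gamma b)) := by
  rw [Complex.Gamma_eq_integral (by rw [hb]; exact one_pos), Complex.GammaIntegral]
  have h : Tendsto (fun x : ℝ => ∫ s in Ioi (0 : ℝ), (Real.exp (-s) : ℂ) *
      ((s : ℂ) ^ a * ((x + s : ℝ) : ℂ) ^ (b - a - 1))) (𝓝[>] 0)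
      (𝓝 (∫ s in Ioi (0 : ℝ), (Real.exp (-s) : ℂ) * (s : ℂ) ^ (b - 1))) := by
    refine tendsto_integral_filter_of_dominated_convergence (fun s => Real.exp (-s)) ?_ ?_
      (integrableOn_exp_neg_Ioi 0) ?_
    · filter_upwards [self_mem_nhdsWithin] with x hx
      have hx : 0 < x := hx
      refine ContinuousOn.aestronglyMeasurable (fun t ht => ?_) measurableSet_Ioi
      have ht : 0 < t := ht
      have h1 : ContinuousAt (fun t : ℝ => (t : ℂ) ^ a) t :=
        (Complex.continuousAt_ofReal_cpow_const t a (Or.inr ht.ne'))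
      have h2 : ContinuousAt (fun t : ℝ => ((x + t : ℝ) : ℂ) ^ (b - a - 1)) t :=
        (Complex.continuousAt_ofReal_cpow_const (x + t) _ (Or.inr (by linarith))).comp
          (f := fun t : ℝ => x + t) (by fun_prop)
      have h3 : ContinuousAt (fun t : ℝ => (Real.exp (-t) : ℂ)) t := by fun_prop
      exact (h3.mul (h1.mul h2)).continuousWithinAt
    · filter_upwards [self_mem_nhdsWithin] with x hx
      have hx : 0 < x := hx
      refine (ae_restrict_iff' measurableSet_Ioi).2 (Eventually.of_forall fun t ht => ?_)
      have ht : 0 < t := ht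
      rw [norm_mul, norm_mul, Complex.norm_cpow_eq_rpow_re_of_pos ht,
        Complex.norm_cpow_eq_rpow_re_of_pos (by linarith), Complex.norm_real, Real.norm_eq_abs,
        abs_of_pos (Real.exp_pos _)]
      refine mul_le_of_le_one_right (Real.exp_pos _).le ?_
      rw [show (b - a - 1).re = -a.re by simp [hb], Real.rpow_neg (by linarith), ← div_eq_mul_inv,
        div_le_one (by positivity)]
      gcongr
      linarith
    · refine (ae_restrict_iff' measurableSet_Ioi).2 (Eventually.of_forall fun t ht => ?_)
      have ht : 0 < t := ht
      have ht' : (t : ℂ) ≠ 0 := by exact_mod_cast ht.ne'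
      have h2 : ContinuousAt (fun x : ℝ => ((x + t : ℝ) : ℂ) ^ (b - a - 1)) 0 :=
        (Complex.continuousAt_ofReal_cpow_const (0 + t) _ (Or.inr (by linarith))).comp
          (f := fun x : ℝ => x + t) (by fun_prop)
      have h3 := ((h2.tendsto.mono_left (nhdsWithin_le_nhds (s := Ioi 0))).const_mul
        ((t : ℂ) ^ a)).const_mul (Real.exp (-t) : ℂ)
      convert h3 using 2
      rw [zero_add, ← Complex.cpow_add _ _ ht']
      ring_nf
  refine h.congr' ?_
  filter_upwards [self_mem_nhdsWithin] with x hx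
  exact (cpow_mul_laplaceInt hx).symm

/-- For `Re b = 1` the integral with exponents `a - 1` and `b - a - 1` is not absolutely convergent
at `x = 0`: their real parts add up to exactly `-1`. In this combination the exponent of `1 + t`
drops by one, and a beta integral appears in the limit. -/
theorem laplaceInt_sub_mul {a b : ℂ} (ha : 0 < a.re) {x : ℝ} (hx : 0 < x) :
    (1 - b) * laplaceInt (a - 1) (b - a - 1) x + x * laplaceInt a (b - a - 1) x =
      (a + 1 - b) * laplaceInt (a - 1) (b - a - 2) x := by
  have h := laplaceInt_parts ha (b - a - 1) hx
  have e := laplaceInt_add_one_right (p := a - 1) (by simpa using ha) (b - a - 2) hx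
  rw [sub_add_cancel, show b - a - 2 + 1 = b - a - 1 by ring] at e
  rw [show b - a - 1 - 1 = b - a - 2 by ring] at h
  linear_combination -h - (b - a - 1) * e

theorem tendsto_laplaceInt_sub_mul {a b : ℂ} (ha : 0 < a.re) (hb : b.re = 1)
    (hab : a + 1 - b ≠ 0) :
    Tendsto (fun x : ℝ => (1 - b) * laplaceInt (a - 1) (b - a - 1) x +
      x * laplaceInt a (b - a - 1) x) (𝓝[>] 0)
      (𝓝 (Complex.Gamma a * Complex.Gamma (2 - b) / Complex.Gamma (a + 1 - b))) := by
  have h := (tendsto_laplaceInt_zero (p := a - 1) (s := b - a - 2) (by simpa using ha)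
    (by simp [hb]; linarith) (by simp [hb]; linarith)).const_mul (a + 1 - b)
  rw [show a - 1 + 1 = a by ring, show -(b - a - 2) - (a - 1) - 1 = 2 - b by ring,
    Complex.betaIntegral_eq_Gamma_mul_div a (2 - b) ha (by simp [hb]),
    show a + (2 - b) = (a + 1 - b) + 1 by ring, Complex.Gamma_add_one _ hab, mul_div_assoc',
    mul_div_mul_left _ _ hab] at h
  refine h.congr' ?_
  filter_upwards [self_mem_nhdsWithin] with x hx
  exact (laplaceInt_sub_mul ha hx).symm

theorem tendsto_cpow_zero {b : ℂ} (hb : 0 < b.re) :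
    Tendsto (fun x : ℝ => (x : ℂ) ^ b) (𝓝[>] 0) (𝓝 0) := by
  have h := (Complex.continuousAt_ofReal_cpow_const 0 b (Or.inl hb)).tendsto
  rw [Complex.ofReal_zero, Complex.zero_cpow (fun h => by simp [h] at hb)] at h
  exact h.mono_left nhdsWithin_le_nhds

theorem tendsto_ofReal_zero : Tendsto (fun x : ℝ => (x : ℂ)) (𝓝[>] 0) (𝓝 0) := by
  simpa using tendsto_ofReal_of_continuous (F := fun x => x) continuous_id

theorem tendsto_cpow_mul_laplaceInt_zero {a b : ℂ} (ha : 0 < a.re) (hb : b.re = 1)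
    (hb1 : b ≠ 1) (hab : a + 1 - b ≠ 0) :
    Tendsto (fun x : ℝ => (x : ℂ) ^ b * laplaceInt (a - 1) (b - a - 1) x) (𝓝[>] 0) (𝓝 0) := by
  have h1 := (tendsto_cpow_zero (b := b) (by simp [hb])).mul (tendsto_laplaceInt_sub_mul ha hb hab)
  have h2 := tendsto_ofReal_zero.mul (tendsto_cpow_mul_laplaceInt ha hb)
  have h := (h1.sub h2).const_mul (1 - b)⁻¹
  simp only [zero_mul, sub_zero, mul_zero] at h
  refine h.congr fun x => ?_
  have : 1 - b ≠ 0 := sub_ne_zero.2 hb1.symm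
  field_simp
  ring

theorem tendsto_mul_laplaceInt_zero {a b : ℂ} (ha : 0 < a.re) (hb : b.re = 1)
    (hb1 : b ≠ 1) (hab : a + 1 - b ≠ 0) :
    Tendsto (fun x : ℝ => (x : ℂ) * laplaceInt (a - 1) (b - a - 1) x) (𝓝[>] 0) (𝓝 0) := by
  have h := tendsto_cpow_mul_laplaceInt_zero ha hb hb1 hab
  rw [tendsto_zero_iff_norm_tendsto_zero] at h ⊢
  refine h.congr' ?_
  filter_upwards [self_mem_nhdsWithin] with x hx
  have hx : 0 < x := hx
  rw [norm_mul, norm_mul, Complex.norm_cpow_eq_rpow_re_of_pos hx, hb, Real.rpow_one,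
    Complex.norm_real, Real.norm_eq_abs, abs_of_pos hx]

/-! ### The recessive solution of Whittaker's equation -/

/-- Whittaker's function `W_{κ,μ}` as a combination of the solutions `whitM`. -/
def whitW (κ μ : ℂ) (x : ℝ) : ℂ :=
  Complex.Gamma (-2 * μ) / Complex.Gamma (1 / 2 - μ - κ) * whitM κ μ x +
    Complex.Gamma (2 * μ) / Complex.Gamma (1 / 2 + μ - κ) * whitM κ (-μ) x

/-- The derivative of `whitW`. -/
def whitW' (κ μ : ℂ) (x : ℝ) : ℂ :=
  Complex.Gamma (-2 * μ) / Complex.Gamma (1 / 2 - μ - κ) * whitM' κ μ x +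
    Complex.Gamma (2 * μ) / Complex.Gamma (1 / 2 + μ - κ) * whitM' κ (-μ) x

/-- The factor `x^{-2μ}` in the second term of Tricomi's function turns `x^{μ+1/2}` into
`x^{-μ+1/2}`, which makes that term the series solution at `-μ`. -/
theorem whittakerW_eq {κ μ : ℂ} {x : ℝ} (hx : 0 < x) : whittakerW κ μ x = whitW κ μ x := by
  have hx' : (x : ℂ) ≠ 0 := by exact_mod_cast hx.ne'
  have h : (x : ℂ) ^ (μ + 1 / 2) * (x : ℂ) ^ (-(2 * μ)) = (x : ℂ) ^ (-μ + 1 / 2) := by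
    rw [← Complex.cpow_add _ _ hx']
    ring_nf
  simp only [whittakerW, tricomiU, whitW, whitM, whitFactor]
  rw [← h, show 1 - (1 + 2 * μ) = -(2 * μ) by ring,
    show μ - κ + 1 / 2 - (1 + 2 * μ) + 1 = 1 / 2 - μ - κ by ring,
    show 1 + 2 * μ - 1 = 2 * μ by ring, show 2 - (1 + 2 * μ) = 1 + 2 * -μ by ring,
    show -μ - κ + 1 / 2 = 1 / 2 - μ - κ by ring, show μ - κ + 1 / 2 = 1 / 2 + μ - κ by ring,
    neg_mul]
  ring

theorem solvesOn_whitW {μ : ℂ} (hμ : μ.im ≠ 0) (κ : ℂ) :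
    SolvesOn (whitQ κ μ) (whitW κ μ) (whitW' κ μ) := by
  have h1 := solvesOn_whitM (one_add_two_mul_ne hμ) κ
  have h2 := solvesOn_whitM (one_add_two_mul_ne (μ := -μ) (by simpa using hμ)) κ
  rw [whitQ_neg] at h2
  exact (h1.const_mul _).add (h2.const_mul _)

/-- The solution of Whittaker's equation given by the Laplace integral. -/
def whitV (κ μ : ℂ) (x : ℝ) : ℂ :=
  whitFactor μ x * laplaceInt (μ - κ + 1 / 2 - 1) (1 + 2 * μ - (μ - κ + 1 / 2) - 1) x

/-- The derivative of `whitV`. -/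
def whitV' (κ μ : ℂ) (x : ℝ) : ℂ :=
  whitFactor μ x * (-laplaceInt (μ - κ + 1 / 2) (1 + 2 * μ - (μ - κ + 1 / 2) - 1) x +
    (-1 / 2 + (μ + 1 / 2) / x) *
      laplaceInt (μ - κ + 1 / 2 - 1) (1 + 2 * μ - (μ - κ + 1 / 2) - 1) x)

theorem solvesOn_whitV {κ μ : ℂ} (ha : 0 < (μ - κ + 1 / 2).re) :
    SolvesOn (whitQ κ μ) (whitV κ μ) (whitV' κ μ) := by
  have h1 : ∀ x, 0 < x → HasDerivAt
      (laplaceInt (μ - κ + 1 / 2 - 1) (1 + 2 * μ - (μ - κ + 1 / 2) - 1))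
      (-laplaceInt (μ - κ + 1 / 2) (1 + 2 * μ - (μ - κ + 1 / 2) - 1) x) x := fun x hx => by
    have h := hasDerivAt_laplaceInt (p := μ - κ + 1 / 2 - 1)
      (by rw [Complex.sub_re, Complex.one_re]; linarith) (1 + 2 * μ - (μ - κ + 1 / 2) - 1) hx
    rwa [sub_add_cancel] at h
  have h2 : ∀ x, 0 < x → HasDerivAt
      (fun x => -laplaceInt (μ - κ + 1 / 2) (1 + 2 * μ - (μ - κ + 1 / 2) - 1) x)
      (laplaceInt (μ - κ + 1 / 2 + 1) (1 + 2 * μ - (μ - κ + 1 / 2) - 1) x) x := fun x hx => by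
    have h := (hasDerivAt_laplaceInt (p := μ - κ + 1 / 2) (by linarith)
      (1 + 2 * μ - (μ - κ + 1 / 2) - 1) hx).neg
    rwa [neg_neg] at h
  exact solvesOn_of_kummer h1 h2 fun x hx => laplaceInt_kummer ha _ hx

/-- The logarithmic derivatives of the common prefactor cancel, which leaves `e^{-x} x^{1+2μ}` times
`V M' - V' M` for the bare Kummer solutions. The first product tends to `0` and the second to `Γ(1 +
2μ)`. -/
theorem wronskian_whitV_whitM {κ μ : ℂ} (hκ : κ.im = 0) (hμ : μ.im ≠ 0) (hμr : μ.re = 0)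
    (ha : 0 < (μ - κ + 1 / 2).re) {x : ℝ} (hx : 0 < x) :
    wronskian (whitV κ μ) (whitV' κ μ) (whitM κ μ) (whitM' κ μ) x =
      Complex.Gamma (1 + 2 * μ) := by
  have hb := one_add_two_mul_ne hμ
  refine (solvesOn_whitV ha).wronskian_eq_of_tendsto (solvesOn_whitM hb κ) ?_ hx
  have hbr : (1 + 2 * μ).re = 1 := by simp [hμr]
  have hb1 : 1 + 2 * μ ≠ 1 := fun h => hμ (by simpa using congrArg Complex.im h)
  have hab : (μ - κ + 1 / 2) + 1 - (1 + 2 * μ) ≠ 0 := fun h => hμ (by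
    have := congrArg Complex.im h
    simp [hκ] at this
    linarith)
  have l1 := tendsto_cpow_mul_laplaceInt ha hbr
  have l2 := tendsto_cpow_mul_laplaceInt_zero ha hbr hb1 hab
  have hA := tendsto_ofReal_of_continuous (continuous_kummerM hb (μ - κ + 1 / 2))
  have hA₁ := tendsto_ofReal_of_continuous (continuous_kummerM₁ hb (μ - κ + 1 / 2))
  rw [kummerM_zero] at hA
  have h := tendsto_exp_neg.mul ((l2.mul hA₁).add (l1.mul hA))
  simp only [zero_mul, mul_one, zero_add, one_mul] at h
  refine h.congr' ?_
  filter_upwards [self_mem_nhdsWithin] with x hx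
  have hf := whitFactor_sq μ hx
  simp only [wronskian, whitM, whitM', whitV, whitV']
  linear_combination (-laplaceInt (μ - κ + 1 / 2 - 1) (1 + 2 * μ - (μ - κ + 1 / 2) - 1) x *
    kummerM₁ (μ - κ + 1 / 2) (1 + 2 * μ) x -
    laplaceInt (μ - κ + 1 / 2) (1 + 2 * μ - (μ - κ + 1 / 2) - 1) x *
    kummerM (μ - κ + 1 / 2) (1 + 2 * μ) x) * hf

/-- Here the prefactors multiply to `e^{-x} x`, and the surviving terms are the combination in
`tendsto_laplaceInt_sub_mul` with `1 - b = -2μ`. -/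
theorem wronskian_whitV_whitM_neg {κ μ : ℂ} (hκ : κ.im = 0) (hμ : μ.im ≠ 0) (hμr : μ.re = 0)
    (ha : 0 < (μ - κ + 1 / 2).re) {x : ℝ} (hx : 0 < x) :
    wronskian (whitV κ μ) (whitV' κ μ) (whitM κ (-μ)) (whitM' κ (-μ)) x =
      Complex.Gamma (μ - κ + 1 / 2) * Complex.Gamma (1 - 2 * μ) /
        Complex.Gamma (1 / 2 - μ - κ) := by
  have hb := one_add_two_mul_ne (μ := -μ) (by simpa using hμ)
  have hs := solvesOn_whitM hb κ
  rw [whitQ_neg] at hs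
  refine (solvesOn_whitV ha).wronskian_eq_of_tendsto hs ?_ hx
  have hbr : (1 + 2 * μ).re = 1 := by simp [hμr]
  have hb1 : 1 + 2 * μ ≠ 1 := fun h => hμ (by simpa using congrArg Complex.im h)
  have hab : (μ - κ + 1 / 2) + 1 - (1 + 2 * μ) ≠ 0 := fun h => hμ (by
    have := congrArg Complex.im h
    simp [hκ] at this
    linarith)
  have l1 := tendsto_laplaceInt_sub_mul ha hbr hab
  have l2 := tendsto_mul_laplaceInt_zero ha hbr hb1 hab
  rw [show 2 - (1 + 2 * μ) = 1 - 2 * μ by ring,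
    show μ - κ + 1 / 2 + 1 - (1 + 2 * μ) = 1 / 2 - μ - κ by ring] at l1
  have hB := tendsto_ofReal_of_continuous (continuous_kummerM hb (-μ - κ + 1 / 2))
  have hB₁ := tendsto_ofReal_of_continuous (continuous_kummerM₁ hb (-μ - κ + 1 / 2))
  rw [kummerM_zero] at hB
  have h := tendsto_exp_neg.mul ((l2.mul hB₁).add (l1.mul hB))
  simp only [zero_mul, mul_one, zero_add, one_mul] at h
  refine h.congr' ?_
  filter_upwards [self_mem_nhdsWithin] with x hx
  have hx' : (x : ℂ) ≠ 0 := by exact_mod_cast (mem_Ioi.1 hx).ne'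
  have hf := whitFactor_mul_neg μ hx
  simp only [wronskian, whitM, whitM', whitV, whitV']
  generalize laplaceInt (μ - κ + 1 / 2 - 1) (1 + 2 * μ - (μ - κ + 1 / 2) - 1) x = V at *
  generalize laplaceInt (μ - κ + 1 / 2) (1 + 2 * μ - (μ - κ + 1 / 2) - 1) x = V₁ at *
  generalize kummerM (-μ - κ + 1 / 2) (1 + 2 * -μ) x = B at *
  generalize kummerM₁ (-μ - κ + 1 / 2) (1 + 2 * -μ) x = B₁ at *
  linear_combination (-(V * B₁ + V₁ * B) + 2 * μ / x * (V * B)) * hf +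
    (2 * μ * (Real.exp (-x) : ℂ) * (V * B)) * (mul_inv_cancel₀ hx')

/-- By `eq_whitM` the two Wronskians at `±μ` give the coefficients of the Laplace solution in the
series solutions; `Γ(1 ± 2μ) = ±2μ Γ(±2μ)` matches them with those of `W`. -/
theorem whitV_eq {κ μ : ℂ} (hκ : κ.im = 0) (hμ : μ.im ≠ 0) (hμr : μ.re = 0)
    (ha : 0 < (μ - κ + 1 / 2).re) {x : ℝ} (hx : 0 < x) :
    whitV κ μ x = Complex.Gamma (μ - κ + 1 / 2) * whitW κ μ x := by
  have h := eq_whitM κ hμ (whitV κ μ) (whitV' κ μ) hx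
  rw [wronskian_whitV_whitM hκ hμ hμr ha hx, wronskian_whitV_whitM_neg hκ hμ hμr ha hx] at h
  have hμ0 : μ ≠ 0 := fun h => hμ (by simp [h])
  have hG : Complex.Gamma (μ - κ + 1 / 2) ≠ 0 := Complex.Gamma_ne_zero_of_re_pos ha
  have e1 : Complex.Gamma (1 - 2 * μ) = -2 * μ * Complex.Gamma (-2 * μ) := by
    rw [← Complex.Gamma_add_one _ (by simpa using hμ0)]
    ring_nf
  have e2 : Complex.Gamma (1 + 2 * μ) = 2 * μ * Complex.Gamma (2 * μ) := by
    rw [← Complex.Gamma_add_one _ (by simpa using hμ0)]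
    ring_nf
  rw [e1, e2] at h
  refine mul_left_cancel₀ (a := -2 * μ) (by simpa using hμ0) ?_
  rw [h]
  simp only [whitW]
  rw [show 1 / 2 + μ - κ = μ - κ + 1 / 2 by ring]
  generalize Complex.Gamma (1 / 2 - μ - κ) = G at *
  generalize Complex.Gamma (μ - κ + 1 / 2) = G' at *
  field_simp
  ring

/-- `u` decays faster than every power at infinity. -/
def RapidDecay (u : ℝ → ℂ) : Prop := ∀ j : ℕ, Tendsto (fun x : ℝ => (x : ℂ) ^ j * u x) atTop (𝓝 0)

theorem RapidDecay.add {u w : ℝ → ℂ} (hu : RapidDecay u) (hw : RapidDecay w) :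
    RapidDecay fun x => u x + w x := fun j => by
  simpa [mul_add] using (hu j).add (hw j)

theorem RapidDecay.x_mul {u : ℝ → ℂ} (hu : RapidDecay u) : RapidDecay fun x => x * u x :=
  fun j => (hu (j + 1)).congr fun x => by ring

theorem RapidDecay.congr {u w : ℝ → ℂ} (hu : RapidDecay u) (h : ∀ x, 0 < x → w x = u x) :
    RapidDecay w := fun j => (hu j).congr' <| by
  filter_upwards [eventually_gt_atTop 0] with x hx
  rw [h x hx]

theorem RapidDecay.bounded_mul {u b : ℝ → ℂ} (hu : RapidDecay u) {C : ℝ}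
    (hb : ∀ x, 1 ≤ x → ‖b x‖ ≤ C) : RapidDecay fun x => b x * u x := fun j => by
  have h1 := (hu j).norm.const_mul C
  rw [norm_zero, mul_zero] at h1
  refine squeeze_zero_norm' ?_ h1
  filter_upwards [eventually_ge_atTop 1] with x hx
  rw [mul_left_comm, norm_mul]
  gcongr
  exact hb x hx

theorem RapidDecay.const_mul {u : ℝ → ℂ} (hu : RapidDecay u) (c : ℂ) :
    RapidDecay fun x => c * u x :=
  hu.bounded_mul (b := fun _ => c) (C := ‖c‖) fun _ _ => le_rfl

theorem RapidDecay.tendsto {u : ℝ → ℂ} (hu : RapidDecay u) : Tendsto u atTop (𝓝 0) := by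
  simpa using hu 0

theorem rapidDecay_whitFactor (μ : ℂ) : RapidDecay (whitFactor μ) := fun j => by
  rw [tendsto_zero_iff_norm_tendsto_zero]
  refine (tendsto_rpow_mul_exp_neg_mul_atTop_nhds_zero (j + (μ + 1 / 2).re) (1 / 2)
    (by norm_num)).congr' ?_
  filter_upwards [eventually_gt_atTop 0] with x hx
  rw [whitFactor, norm_mul, norm_mul, norm_pow, Complex.norm_real, Complex.norm_real,
    Real.norm_eq_abs, Real.norm_eq_abs, abs_of_pos hx, abs_of_pos (Real.exp_pos _),
    Complex.norm_cpow_eq_rpow_re_of_pos hx, Real.rpow_add hx, Real.rpow_natCast]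
  ring_nf

theorem norm_laplaceInt_le {p : ℂ} (hp : -1 < p.re) (s : ℂ) :
    ∃ C, ∀ x, 1 ≤ x → ‖laplaceInt p s x‖ ≤ C := by
  refine ⟨∫ t in Ioi (0 : ℝ), ‖laplaceKernel p s 1 t‖, fun x hx => ?_⟩
  refine norm_integral_le_of_norm_le (integrableOn_laplaceKernel hp s one_pos).norm ?_
  refine (ae_restrict_iff' measurableSet_Ioi).2 (Eventually.of_forall fun t ht => ?_)
  have ht : 0 < t := ht
  rw [norm_laplaceKernel _ _ _ ht, norm_laplaceKernel _ _ _ ht]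
  gcongr

theorem rapidDecay_whitV {κ μ : ℂ} (ha : 0 < (μ - κ + 1 / 2).re) :
    RapidDecay (whitV κ μ) ∧ RapidDecay (whitV' κ μ) := by
  obtain ⟨C, hC⟩ := norm_laplaceInt_le (p := μ - κ + 1 / 2 - 1)
    (by rw [Complex.sub_re, Complex.one_re]; linarith) (1 + 2 * μ - (μ - κ + 1 / 2) - 1)
  obtain ⟨C', hC'⟩ := norm_laplaceInt_le (p := μ - κ + 1 / 2)
    (by linarith) (1 + 2 * μ - (μ - κ + 1 / 2) - 1)
  have hf := rapidDecay_whitFactor μ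
  refine ⟨(hf.bounded_mul hC).congr fun x _ => by rw [whitV, mul_comm],
    (hf.bounded_mul (b := fun x => -laplaceInt (μ - κ + 1 / 2) (1 + 2 * μ - (μ - κ + 1 / 2) - 1) x +
      (-1 / 2 + (μ + 1 / 2) / x) * laplaceInt (μ - κ + 1 / 2 - 1)
        (1 + 2 * μ - (μ - κ + 1 / 2) - 1) x) (C := C' + (‖(-1 / 2 : ℂ)‖ + ‖μ + 1 / 2‖) * C)
      fun x hx => ?_).congr fun x _ => by rw [whitV', mul_comm]⟩
  refine (norm_add_le _ _).trans (add_le_add (by rw [norm_neg]; exact hC' x hx) ?_)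
  rw [norm_mul]
  have h1 : ‖(-1 / 2 : ℂ) + (μ + 1 / 2) / x‖ ≤ ‖(-1 / 2 : ℂ)‖ + ‖μ + 1 / 2‖ := by
    refine (norm_add_le _ _).trans (add_le_add le_rfl ?_)
    rw [norm_div, Complex.norm_real, Real.norm_eq_abs, abs_of_pos (by linarith)]
    exact div_le_self (norm_nonneg _) hx
  gcongr
  exact hC x hx

theorem rapidDecay_whitW_of_pos {κ μ : ℂ} (hκ : κ.im = 0) (hμ : μ.im ≠ 0) (hμr : μ.re = 0)
    (ha : 0 < (μ - κ + 1 / 2).re) : RapidDecay (whitW κ μ) ∧ RapidDecay (whitW' κ μ) := by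
  have hG : Complex.Gamma (μ - κ + 1 / 2) ≠ 0 := Complex.Gamma_ne_zero_of_re_pos ha
  have h := rapidDecay_whitV ha
  have h1 : ∀ x, 0 < x → whitV κ μ x = Complex.Gamma (μ - κ + 1 / 2) * whitW κ μ x :=
    fun x hx => whitV_eq hκ hμ hμr ha hx
  have h2 : ∀ x, 0 < x → whitV' κ μ x = Complex.Gamma (μ - κ + 1 / 2) * whitW' κ μ x := by
    intro x hx
    refine ((solvesOn_whitV ha).deriv₁ x hx).unique ?_
    refine (((solvesOn_whitW hμ κ).deriv₁ x hx).const_mul _).congr_of_eventuallyEq ?_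
    filter_upwards [eventually_gt_nhds hx] with y hy
    exact h1 y hy
  refine ⟨(h.1.const_mul (Complex.Gamma (μ - κ + 1 / 2))⁻¹).congr fun x hx => ?_,
    (h.2.const_mul (Complex.Gamma (μ - κ + 1 / 2))⁻¹).congr fun x hx => ?_⟩
  · rw [h1 x hx, inv_mul_cancel_left₀ hG]
  · rw [h2 x hx, inv_mul_cancel_left₀ hG]

/-- The device for increasing `κ`. As `κ` is real and `μ` is not, the quantities `1/2 ± μ - (κ + 1)`
are nonzero, so the Gamma recursion applies and the coefficients of the two series solutions shift
consistently. -/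
theorem whitW_contiguous {κ μ : ℂ} (hκ : κ.im = 0) (hμ : μ.im ≠ 0) {x : ℝ} (hx : 0 < x) :
    whitW (κ + 1) μ x = (x / 2 - κ) * whitW κ μ x - x * whitW' κ μ x := by
  have h1 := whitM_contiguous hμ κ hx
  have h2 := whitM_contiguous (μ := -μ) (by simpa using hμ) κ hx
  have n1 : 1 / 2 - μ - (κ + 1) ≠ 0 := fun h => hμ (by simpa [hκ] using congrArg Complex.im h)
  have n2 : 1 / 2 + μ - (κ + 1) ≠ 0 := fun h => hμ (by simpa [hκ] using congrArg Complex.im h)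
  have g1 := Complex.Gamma_add_one _ n1
  have g2 := Complex.Gamma_add_one _ n2
  rw [show 1 / 2 - μ - (κ + 1) + 1 = 1 / 2 - μ - κ by ring] at g1
  rw [show 1 / 2 + μ - (κ + 1) + 1 = 1 / 2 + μ - κ by ring] at g2
  simp only [whitW, whitW']
  rw [g1, g2]
  have e1 : whitM (κ + 1) μ x = (1 / 2 - μ - (κ + 1))⁻¹ *
      ((x / 2 - κ) * whitM κ μ x - x * whitM' κ μ x) := by
    rw [h1, show -1 / 2 - μ - κ = 1 / 2 - μ - (κ + 1) by ring, inv_mul_cancel_left₀ n1]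
  have e2 : whitM (κ + 1) (-μ) x = (1 / 2 + μ - (κ + 1))⁻¹ *
      ((x / 2 - κ) * whitM κ (-μ) x - x * whitM' κ (-μ) x) := by
    rw [h2, show -1 / 2 - -μ - κ = 1 / 2 + μ - (κ + 1) by ring, inv_mul_cancel_left₀ n2]
  rw [e1, e2]
  simp only [div_eq_mul_inv, mul_inv]
  ring

theorem whitW'_contiguous {κ μ : ℂ} (hκ : κ.im = 0) (hμ : μ.im ≠ 0) {x : ℝ} (hx : 0 < x) :
    whitW' (κ + 1) μ x = 1 / 2 * whitW κ μ x + (x / 2 - κ) * whitW' κ μ x -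
      (whitW' κ μ x + x * (whitQ κ μ x * whitW κ μ x)) := by
  refine ((solvesOn_whitW hμ (κ + 1)).deriv₁ x hx).unique ?_
  have hW := solvesOn_whitW hμ κ
  have hid : HasDerivAt (fun x : ℝ => (x : ℂ)) 1 x := Complex.ofRealCLM.hasDerivAt
  have h := (((hid.div_const 2).sub_const κ).mul (hW.deriv₁ x hx)).sub
    (hid.mul (hW.deriv₂ x hx))
  rw [one_mul] at h
  refine h.congr_of_eventuallyEq ?_
  filter_upwards [eventually_gt_nhds hx] with y hy
  exact whitW_contiguous hκ hμ hy

theorem norm_whitQ_le (κ μ : ℂ) : ∀ x : ℝ, 1 ≤ x →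
    ‖whitQ κ μ x‖ ≤ ‖(1 / 4 : ℂ)‖ + ‖κ‖ + ‖1 / 4 - μ ^ 2‖ := fun x hx => by
  have h2 : (1 : ℝ) ≤ x ^ 2 := one_le_pow₀ hx
  refine (norm_sub_le _ _).trans (add_le_add ((norm_sub_le _ _).trans (add_le_add le_rfl ?_)) ?_)
  · rw [norm_div, Complex.norm_real, Real.norm_eq_abs, abs_of_pos (by linarith)]
    exact div_le_self (norm_nonneg _) hx
  · rw [norm_div, norm_pow, Complex.norm_real, Real.norm_eq_abs, abs_of_pos (by linarith)]
    exact div_le_self (norm_nonneg _) h2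

/-- Induction on a natural number above `Re κ`. For `Re κ < 0` the Laplace integral applies. The
contiguous relations express `W` and `W'` at `κ` through those at `κ - 1` with coefficients of
polynomial growth, harmless to rapid decay. -/
theorem rapidDecay_whitW {κ μ : ℂ} (hκ : κ.im = 0) (hμ : μ.im ≠ 0) (hμr : μ.re = 0) :
    RapidDecay (whitW κ μ) ∧ RapidDecay (whitW' κ μ) := by
  obtain ⟨n, hn⟩ := exists_nat_gt κ.re
  induction n generalizing κ with
  | zero =>
    refine rapidDecay_whitW_of_pos hκ hμ hμr ?_
    simp only [Nat.cast_zero] at hn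
    simp [hμr]
    linarith
  | succ n ih =>
    obtain ⟨h1, h2⟩ := ih (κ := κ - 1) (by simp [hκ]) (by push_cast at hn; simp; linarith)
    have hκ' : (κ - 1).im = 0 := by simp [hκ]
    have hq := (h1.bounded_mul (norm_whitQ_le (κ - 1) μ)).x_mul
    constructor
    · refine (((h1.x_mul.const_mul (1 / 2)).add (h1.const_mul (-(κ - 1)))).add
        (h2.x_mul.const_mul (-1))).congr fun x hx => ?_
      have := whitW_contiguous hκ' hμ hx
      rw [sub_add_cancel] at this
      rw [this]
      ring
    · refine ((((h1.const_mul (1 / 2)).add (h2.x_mul.const_mul (1 / 2))).add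
        (h2.const_mul (-(κ - 1) - 1))).add (hq.const_mul (-1))).congr fun x hx => ?_
      have := whitW'_contiguous hκ' hμ hx
      rw [sub_add_cancel] at this
      rw [this]
      ring

/-- A solution of Whittaker's equation which is bounded at infinity is a multiple of `W`. -/
theorem SolvesOn.eq_const_mul_whitW {κ μ : ℂ} (hκ : κ.im = 0) (hμ : μ.im ≠ 0) (hμr : μ.re = 0)
    {u u' : ℝ → ℂ} (hu : SolvesOn (whitQ κ μ) u u') {C Y : ℝ} (hC : ∀ x, Y ≤ x → ‖u x‖ ≤ C) :
    ∃ c : ℂ, ∀ x, 0 < x → u x = c * whitW κ μ x := by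
  have hW := solvesOn_whitW hμ κ
  obtain ⟨hd, hd'⟩ := rapidDecay_whitW hκ hμ hμr
  set w := wronskian u u' (whitW κ μ) (whitW' κ μ) 1
  have hwr : ∀ x, 0 < x → wronskian u u' (whitW κ μ) (whitW' κ μ) x = w :=
    fun x hx => hu.wronskian_eq hW hx one_pos
  have hC0 : 0 ≤ C := (norm_nonneg _).trans (hC Y le_rfl)
  -- Nothing is known about `u'` at infinity, so the Wronskian is not estimated pointwise. Instead
  -- `w + (u W)' = 2 u W'` is integrated over `[X, X + 1]`, which gives `‖w‖ ≤ 4 C ε` with `ε` as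
  -- small as desired.
  have hw0 : w = 0 := by
    by_contra hne
    have hpos : 0 < ‖w‖ := norm_pos_iff.2 hne
    set ε := ‖w‖ / (4 * (C + 1))
    have hε : 0 < ε := by positivity
    have e1 := (hd.tendsto.norm).eventually (gt_mem_nhds (by simpa using hε))
    have e2 := (hd'.tendsto.norm).eventually (gt_mem_nhds (by simpa using hε))
    obtain ⟨X, hX⟩ := eventually_atTop.1 (e1.and (e2.and ((eventually_ge_atTop Y).and
      (eventually_gt_atTop 0))))
    have hder : ∀ x ∈ Icc X (X + 1), HasDerivWithinAt (fun x : ℝ => w * x + u x * whitW κ μ x)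
        (2 * (u x * whitW' κ μ x)) (Icc X (X + 1)) x := fun x hx => by
      have hx0 := (hX x hx.1).2.2.2
      have hid : HasDerivAt (fun x : ℝ => (x : ℂ)) 1 x := Complex.ofRealCLM.hasDerivAt
      refine (((hid.const_mul w).add ((hu.deriv₁ x hx0).mul (hW.deriv₁ x hx0))).congr_deriv
        ?_).hasDerivWithinAt
      rw [← hwr x hx0, wronskian]
      ring
    have h := norm_image_sub_le_of_norm_deriv_le_segment' hder (C := 2 * (C * ε))
      (fun x hx => by
        have h := hX x hx.1
        have h2 : ‖u x‖ ≤ C := hC x h.2.2.1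
        rw [norm_mul, norm_mul, Complex.norm_ofNat]
        gcongr
        exact h.2.1.le) (X + 1) (right_mem_Icc.2 (by linarith))
    have b1 : ‖u X * whitW κ μ X‖ ≤ C * ε := by
      have h := hX X le_rfl
      rw [norm_mul]
      gcongr
      exacts [hC X h.2.2.1, h.1.le]
    have b2 : ‖u (X + 1) * whitW κ μ (X + 1)‖ ≤ C * ε := by
      have h := hX (X + 1) (by linarith)
      rw [norm_mul]
      gcongr
      exacts [hC _ h.2.2.1, h.1.le]
    have h3 : ‖w‖ ≤ 4 * (C * ε) := by
      have e : w = (w * ((X + 1 : ℝ) : ℂ) + u (X + 1) * whitW κ μ (X + 1) -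
          (w * X + u X * whitW κ μ X)) - u (X + 1) * whitW κ μ (X + 1) + u X * whitW κ μ X := by
        push_cast
        ring
      rw [e]
      refine (norm_add_le _ _).trans ?_
      have := norm_sub_le (w * ((X + 1 : ℝ) : ℂ) + u (X + 1) * whitW κ μ (X + 1) -
          (w * X + u X * whitW κ μ X)) (u (X + 1) * whitW κ μ (X + 1))
      linarith
    have h4 : 4 * (C * ε) < ‖w‖ := by
      have : 4 * ((C + 1) * ε) = ‖w‖ := by
        simp only [ε]
        field_simp
      nlinarith
    linarith
  have hb := one_add_two_mul_ne hμ
  have hs := solvesOn_whitM (one_add_two_mul_ne (μ := -μ) (by simpa using hμ)) κ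
  rw [whitQ_neg] at hs
  set p := wronskian u u' (whitM κ μ) (whitM' κ μ) 1
  set q := wronskian u u' (whitM κ (-μ)) (whitM' κ (-μ)) 1
  set A := Complex.Gamma (-2 * μ) / Complex.Gamma (1 / 2 - μ - κ)
  set B := Complex.Gamma (2 * μ) / Complex.Gamma (1 / 2 + μ - κ)
  have hpq : A * p + B * q = 0 := by
    rw [← hw0]
    simp only [w, p, q, wronskian, whitW, whitW', A, B]
    ring
  have hμ0 : μ ≠ 0 := fun h => hμ (by simp [h])
  have hB : B ≠ 0 := by
    refine div_ne_zero (Complex.Gamma_ne_zero fun m h => hμ ?_)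
      (Complex.Gamma_ne_zero fun m h => hμ ?_)
    · simpa using congrArg Complex.im h
    · simpa [hκ] using congrArg Complex.im h
  -- Vanishing of the Wronskian with `W` says `A p + B q = 0`; eliminating `q` from `eq_whitM`
  -- leaves this multiple of `W`.
  refine ⟨p / (2 * μ * B), fun x hx => ?_⟩
  have h := eq_whitM κ hμ u u' hx
  rw [hu.wronskian_eq hs hx one_pos, hu.wronskian_eq (solvesOn_whitM hb κ) hx one_pos] at h
  change _ = q * _ - p * _ at h
  change _ = _ * (A * whitM κ μ x + B * whitM κ (-μ) x)
  field_simp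
  linear_combination -B * h - whitM κ μ x * hpq

/-! ### Reality -/

theorem conj_kummerM (a b : ℂ) (x : ℝ) :
    (starRingEnd ℂ) (kummerM a b x) = kummerM ((starRingEnd ℂ) a) ((starRingEnd ℂ) b) x := by
  have h : ∀ (n : ℕ) (a : ℂ), (starRingEnd ℂ) ((ascPochhammer ℂ n).eval a) =
      (ascPochhammer ℂ n).eval ((starRingEnd ℂ) a) := fun n a => by
    induction n with
    | zero => simp
    | succ n ih => simp [ascPochhammer_succ_eval, ih]
  rw [kummerM, Complex.conj_tsum]
  refine tsum_congr fun n => ?_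
  simp [h]

theorem conj_whitFactor (μ : ℂ) {x : ℝ} (hx : 0 < x) :
    (starRingEnd ℂ) (whitFactor μ x) = whitFactor ((starRingEnd ℂ) μ) x := by
  simp only [whitFactor, map_mul, Complex.conj_ofReal]
  have h2 : (starRingEnd ℂ) (1 / 2) = 1 / 2 := by
    rw [show (1 / 2 : ℂ) = ((1 / 2 : ℝ) : ℂ) by norm_num]
    exact Complex.conj_ofReal _
  rw [ofReal_cpow_eq_exp _ hx, ofReal_cpow_eq_exp _ hx, ← Complex.exp_conj, map_mul, map_add, h2,
    Complex.conj_ofReal]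

/-- Conjugation replaces the imaginary `μ` by `-μ` and hence exchanges the two terms. -/
theorem conj_whitW {κ μ : ℂ} (hκ : (starRingEnd ℂ) κ = κ) (hμ : (starRingEnd ℂ) μ = -μ) {x : ℝ}
    (hx : 0 < x) : (starRingEnd ℂ) (whitW κ μ x) = whitW κ μ x := by
  simp only [whitW, whitM, map_add, map_mul, map_div₀, ← Complex.Gamma_conj, conj_whitFactor _ hx,
    conj_kummerM, hκ, hμ, map_sub, map_neg, map_one, map_ofNat, neg_neg]
  rw [show 1 / 2 - -μ - κ = 1 / 2 + μ - κ by ring, show -2 * -μ = 2 * μ by ring,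
    show (2 : ℂ) * -μ = -2 * μ by ring, show 1 / 2 + -μ - κ = 1 / 2 - μ - κ by ring]
  ring

/-! ### Estimates for solutions of `u'' = q u` with real `q` -/

theorem SolvesOn.hasDerivAt_norm_sq {q u u' : ℝ → ℂ} (hu : SolvesOn q u u') {x : ℝ} (hx : 0 < x) :
    HasDerivAt (fun x => ‖u x‖ ^ 2) (2 * inner ℝ (u x) (u' x)) x :=
  (hu.deriv₁ x hx).norm_sq

theorem SolvesOn.hasDerivAt_inner {q : ℝ → ℝ} {u u' : ℝ → ℂ} (hu : SolvesOn (fun x => q x) u u')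
    {x : ℝ} (hx : 0 < x) : HasDerivAt (fun x => 2 * inner ℝ (u x) (u' x))
      (2 * (‖u' x‖ ^ 2 + q x * ‖u x‖ ^ 2)) x := by
  refine (((hu.deriv₁ x hx).inner ℝ (hu.deriv₂ x hx)).const_mul 2).congr_deriv ?_
  rw [← Complex.real_smul, real_inner_smul_right, real_inner_self_eq_norm_sq,
    real_inner_self_eq_norm_sq]
  ring

theorem SolvesOn.continuousOn {q u u' : ℝ → ℂ} (hu : SolvesOn q u u') : ContinuousOn u (Ioi 0) :=
  fun x hx => (hu.deriv₁ x hx).continuousAt.continuousWithinAt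

/-- A mean value inequality for nonnegative functions with `g'' ≥ 2 m g`. -/
theorem mean_value_inequality {g g₁ g₂ : ℝ → ℝ} {m y δ : ℝ} (hδ : 0 < δ)
    (h1 : ∀ t ∈ Icc (y - δ) (y + δ), HasDerivAt g (g₁ t) t)
    (h2 : ∀ t ∈ Icc (y - δ) (y + δ), HasDerivAt g₁ (g₂ t) t)
    (h3 : ∀ t ∈ Icc (y - δ) (y + δ), 2 * m * g t ≤ g₂ t) :
    2 * g y + m / δ * ((∫ t in (y - δ)..y, g t * (t - y + δ) ^ 2) +
      ∫ t in y..(y + δ), g t * (y + δ - t) ^ 2) ≤ 1 / δ * ∫ t in (y - δ)..(y + δ), g t := by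
  have hg : ContinuousOn g (Icc (y - δ) (y + δ)) := fun t ht => (h1 t ht).continuousAt.continuousWithinAt
  have hg₁ : ContinuousOn g₁ (Icc (y - δ) (y + δ)) :=
    fun t ht => (h2 t ht).continuousAt.continuousWithinAt
  have sL : Icc (y - δ) y ⊆ Icc (y - δ) (y + δ) := Icc_subset_Icc_right (by linarith)
  have sR : Icc y (y + δ) ⊆ Icc (y - δ) (y + δ) := Icc_subset_Icc_left (by linarith)
  have cL : ContinuousOn (fun t => g t * (t - y + δ) ^ 2) (Icc (y - δ) y) :=
    (hg.mono sL).mul (by fun_prop)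
  have cR : ContinuousOn (fun t => g t * (y + δ - t) ^ 2) (Icc y (y + δ)) :=
    (hg.mono sR).mul (by fun_prop)
  -- The weight `(t - y + δ)² / (2δ)` against `g''` is integrated by parts twice: in the derivative
  -- of this primitive the `g'` terms cancel. With the mirrored weight on the right half, the
  -- boundary terms `± g'(y) δ / 2` cancel in the sum.
  have hL := intervalIntegral.integral_le_sub_of_hasDeriv_right_of_le (a := y - δ) (b := y)
    (g := fun t => g₁ t * (t - y + δ) ^ 2 / (2 * δ) - g t * (t - y + δ) / δ)
    (g' := fun t => g₂ t * (t - y + δ) ^ 2 / (2 * δ) - g t / δ)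
    (φ := fun t => m / δ * (g t * (t - y + δ) ^ 2) - 1 / δ * g t) (by linarith) ?_ ?_ ?_ ?_
  · have hR := intervalIntegral.integral_le_sub_of_hasDeriv_right_of_le (a := y) (b := y + δ)
      (g := fun t => g₁ t * (y + δ - t) ^ 2 / (2 * δ) + g t * (y + δ - t) / δ)
      (g' := fun t => g₂ t * (y + δ - t) ^ 2 / (2 * δ) - g t / δ)
      (φ := fun t => m / δ * (g t * (y + δ - t) ^ 2) - 1 / δ * g t) (by linarith) ?_ ?_ ?_ ?_
    · have iL : IntervalIntegrable g volume (y - δ) y :=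
        (hg.mono sL).intervalIntegrable_of_Icc (by linarith)
      have iR : IntervalIntegrable g volume y (y + δ) :=
        (hg.mono sR).intervalIntegrable_of_Icc (by linarith)
      rw [intervalIntegral.integral_sub ((cL.intervalIntegrable_of_Icc (by linarith)).const_mul _)
        (iL.const_mul _), intervalIntegral.integral_const_mul,
        intervalIntegral.integral_const_mul] at hL
      rw [intervalIntegral.integral_sub ((cR.intervalIntegrable_of_Icc (by linarith)).const_mul _)
        (iR.const_mul _), intervalIntegral.integral_const_mul,
        intervalIntegral.integral_const_mul] at hR
      rw [← intervalIntegral.integral_add_adjacent_intervals iL iR]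
      have e1 : g₁ y * (y - y + δ) ^ 2 / (2 * δ) - g y * (y - y + δ) / δ -
          (g₁ (y - δ) * (y - δ - y + δ) ^ 2 / (2 * δ) - g (y - δ) * (y - δ - y + δ) / δ) =
          g₁ y * δ / 2 - g y := by
        field_simp
        ring
      have e2 : g₁ (y + δ) * (y + δ - (y + δ)) ^ 2 / (2 * δ) + g (y + δ) * (y + δ - (y + δ)) / δ -
          (g₁ y * (y + δ - y) ^ 2 / (2 * δ) + g y * (y + δ - y) / δ) =
          -(g₁ y * δ / 2) - g y := by
        field_simp
        ring
      rw [e1] at hL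
      rw [e2] at hR
      rw [mul_add, mul_add]
      linarith
    · exact (((hg₁.mono sR).mul (by fun_prop)).div_const _).add
        (((hg.mono sR).mul (by fun_prop)).div_const _)
    · intro t ht
      have ht' := sR (Ioo_subset_Icc_self ht)
      have hs : HasDerivAt (fun t => y + δ - t) (-1) t := (hasDerivAt_id t).const_sub _
      refine ((((h2 t ht').mul (hs.pow 2)).div_const (2 * δ)).add
        (((h1 t ht').mul hs).div_const δ)).hasDerivWithinAt.congr_deriv ?_
      simp
      field_simp
      ring
    · exact ((cR.const_mul _).sub ((hg.mono sR).const_mul _)).integrableOn_Icc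
    · intro t ht
      have := h3 t (sR (Ioo_subset_Icc_self ht))
      have h4 : 0 ≤ (y + δ - t) ^ 2 / (2 * δ) := by positivity
      have h5 := mul_le_mul_of_nonneg_right this h4
      have e : 2 * m * g t * ((y + δ - t) ^ 2 / (2 * δ)) = m / δ * (g t * (y + δ - t) ^ 2) := by
        field_simp
      have e' : 1 / δ * g t = g t / δ := by ring
      rw [e, ← mul_div_assoc] at h5
      rw [e']
      linarith
  · exact (((hg₁.mono sL).mul (by fun_prop)).div_const _).sub
      (((hg.mono sL).mul (by fun_prop)).div_const _)
  · intro t ht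
    have ht' := sL (Ioo_subset_Icc_self ht)
    have hs : HasDerivAt (fun t => t - y + δ) 1 t := ((hasDerivAt_id t).sub_const _).add_const _
    refine ((((h2 t ht').mul (hs.pow 2)).div_const (2 * δ)).sub
      (((h1 t ht').mul hs).div_const δ)).hasDerivWithinAt.congr_deriv ?_
    simp
    field_simp
    ring
  · exact ((cL.const_mul _).sub ((hg.mono sL).const_mul _)).integrableOn_Icc
  · intro t ht
    have := h3 t (sL (Ioo_subset_Icc_self ht))
    have h4 : 0 ≤ (t - y + δ) ^ 2 / (2 * δ) := by positivity
    have h5 := mul_le_mul_of_nonneg_right this h4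
    have e : 2 * m * g t * ((t - y + δ) ^ 2 / (2 * δ)) = m / δ * (g t * (t - y + δ) ^ 2) := by
      field_simp
    have e' : 1 / δ * g t = g t / δ := by ring
    rw [e, ← mul_div_assoc] at h5
    rw [e']
    linarith

/-- Solutions of `u'' = q u` with `q ≥ m ≥ -Q` are controlled by their mean square, with a gain
for large `m`. -/
theorem SolvesOn.norm_sq_le {q : ℝ → ℝ} {u u' : ℝ → ℂ} (hu : SolvesOn (fun x => q x) u u')
    {m Q y δ : ℝ} (hδ : 0 < δ) (hy : 2 * δ < y) (hQ : 0 ≤ Q) (hm : -Q ≤ m)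
    (hq : ∀ t ∈ Icc (y - 2 * δ) (y + 2 * δ), m ≤ q t) :
    (m + Q + 1) * ‖u y‖ ^ 2 ≤ (1 / (2 * δ ^ 3) + (Q + 1) * (1 / δ + Q * δ) / 2) *
      ∫ t in (y - 2 * δ)..(y + 2 * δ), ‖u t‖ ^ 2 := by
  set g : ℝ → ℝ := fun t => ‖u t‖ ^ 2
  have hpos : ∀ t ∈ Icc (y - 2 * δ) (y + 2 * δ), 0 < t := fun t ht => by linarith [ht.1]
  have hg0 : ∀ t, 0 ≤ g t := fun t => by positivity
  have h1 : ∀ t ∈ Icc (y - 2 * δ) (y + 2 * δ), HasDerivAt g (2 * inner ℝ (u t) (u' t)) t :=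
    fun t ht => hu.hasDerivAt_norm_sq (hpos t ht)
  have h2 : ∀ t ∈ Icc (y - 2 * δ) (y + 2 * δ), HasDerivAt (fun t => 2 * inner ℝ (u t) (u' t))
      (2 * (‖u' t‖ ^ 2 + q t * ‖u t‖ ^ 2)) t := fun t ht => hu.hasDerivAt_inner (hpos t ht)
  have h3 : ∀ t ∈ Icc (y - 2 * δ) (y + 2 * δ), 2 * m * g t ≤ 2 * (‖u' t‖ ^ 2 + q t * ‖u t‖ ^ 2) := by
    intro t ht
    have := mul_le_mul_of_nonneg_right (hq t ht) (hg0 t)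
    have h0 : 0 ≤ ‖u' t‖ ^ 2 := by positivity
    simp only [g] at this ⊢
    linarith
  have hsub : Icc (y - δ) (y + δ) ⊆ Icc (y - 2 * δ) (y + 2 * δ) :=
    Icc_subset_Icc (by linarith) (by linarith)
  have hg : ContinuousOn g (Icc (y - 2 * δ) (y + 2 * δ)) :=
    fun t ht => (h1 t ht).continuousAt.continuousWithinAt
  have ii : ∀ a b, y - 2 * δ ≤ a → a ≤ b → b ≤ y + 2 * δ → IntervalIntegrable g volume a b :=
    fun a b ha hab hb => (hg.mono (Icc_subset_Icc ha hb)).intervalIntegrable_of_Icc hab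
  have ik : ∀ a b c d, y - 2 * δ ≤ a → a ≤ b → b ≤ y + 2 * δ →
      IntervalIntegrable (fun t => g t * (c * t + d) ^ 2) volume a b :=
    fun a b c d ha hab hb => ((hg.mono (Icc_subset_Icc ha hb)).mul
      (by fun_prop)).intervalIntegrable_of_Icc hab
  set I₁ := ∫ t in (y - δ)..(y + δ), g t
  set I₂ := ∫ t in (y - 2 * δ)..(y + 2 * δ), g t
  have hI : I₁ ≤ I₂ :=
    intervalIntegral.integral_mono_interval (by linarith) (by linarith) (by linarith)
      (Eventually.of_forall hg0) (ii _ _ (by linarith) (by linarith) (by linarith))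
  have hI₁ : 0 ≤ I₁ := intervalIntegral.integral_nonneg (by linarith) fun t _ => hg0 t
  have hsplit : I₁ = (∫ t in (y - δ)..y, g t) + ∫ t in y..(y + δ), g t :=
    (intervalIntegral.integral_add_adjacent_intervals (ii _ _ (by linarith) (by linarith)
      (by linarith)) (ii _ _ (by linarith) (by linarith) (by linarith))).symm
  -- the crude bound
  have hA : g y ≤ (1 / δ + Q * δ) / 2 * I₁ := by
    have h := mean_value_inequality (m := -Q) hδ (fun t ht => h1 t (hsub ht))
      (fun t ht => h2 t (hsub ht)) (fun t ht => (h3 t (hsub ht)).trans' (by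
        have := hg0 t
        nlinarith))
    have kL : (∫ t in (y - δ)..y, g t * (t - y + δ) ^ 2) ≤ δ ^ 2 * ∫ t in (y - δ)..y, g t := by
      rw [← intervalIntegral.integral_const_mul]
      refine intervalIntegral.integral_mono_on (by linarith) ?_ ((ii _ _ (by linarith)
        (by linarith) (by linarith)).const_mul _) fun t ht => ?_
      · simpa [sub_eq_add_neg, add_assoc] using ik (y - δ) y 1 (-y + δ) (by linarith) (by linarith)
          (by linarith)
      · rw [mul_comm]
        gcongr
        · linarith [ht.1]
        · linarith [ht.2]
    have kR : (∫ t in y..(y + δ), g t * (y + δ - t) ^ 2) ≤ δ ^ 2 * ∫ t in y..(y + δ), g t := by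
      rw [← intervalIntegral.integral_const_mul]
      refine intervalIntegral.integral_mono_on (by linarith) ?_ ((ii _ _ (by linarith)
        (by linarith) (by linarith)).const_mul _) fun t ht => ?_
      · have := ik y (y + δ) (-1) (y + δ) (by linarith) (by linarith) (by linarith)
        refine this.congr fun t _ => ?_
        ring
      · rw [mul_comm]
        gcongr
        · linarith [ht.2]
        · linarith [ht.1]
    have h5 : Q / δ * ((∫ t in (y - δ)..y, g t * (t - y + δ) ^ 2) +
        ∫ t in y..(y + δ), g t * (y + δ - t) ^ 2) ≤ Q / δ * (δ ^ 2 * I₁) := by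
      rw [hsplit, mul_add (δ ^ 2)]
      gcongr
    have e : Q / δ * (δ ^ 2 * I₁) = Q * δ * I₁ := by field_simp
    rw [neg_div, neg_mul] at h
    linarith
  -- the bound with a gain
  have hB : m * g y ≤ 1 / (2 * δ ^ 3) * I₂ := by
    rcases le_or_gt m 0 with hm0 | hm0
    · calc m * g y ≤ 0 := mul_nonpos_of_nonpos_of_nonneg hm0 (hg0 y)
        _ ≤ _ := mul_nonneg (by positivity) (hI₁.trans hI)
    -- Two scales are combined. Radius `δ` bounds `g y` by `I₁ / (2δ)`; at radius `2δ` the weight is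
    -- at least `δ²` on the inner interval, so `m δ² I₁ ≤ I₂`. Their product is the gain.
    · have h := mean_value_inequality (m := m) hδ (fun t ht => h1 t (hsub ht))
        (fun t ht => h2 t (hsub ht)) (fun t ht => h3 t (hsub ht))
      have h' := mean_value_inequality (m := m) (mul_pos two_pos hδ) h1 h2 h3
      have n1 : 0 ≤ ∫ t in (y - δ)..y, g t * (t - y + δ) ^ 2 :=
        intervalIntegral.integral_nonneg (by linarith) fun t _ => mul_nonneg (hg0 t) (sq_nonneg _)
      have n2 : 0 ≤ ∫ t in y..(y + δ), g t * (y + δ - t) ^ 2 :=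
        intervalIntegral.integral_nonneg (by linarith) fun t _ => mul_nonneg (hg0 t) (sq_nonneg _)
      have h6 : 2 * g y ≤ 1 / δ * I₁ := by
        have : 0 ≤ m / δ * ((∫ t in (y - δ)..y, g t * (t - y + δ) ^ 2) +
          ∫ t in y..(y + δ), g t * (y + δ - t) ^ 2) := by positivity
        linarith
      have kL : δ ^ 2 * (∫ t in (y - δ)..y, g t) ≤
          ∫ t in (y - 2 * δ)..y, g t * (t - y + 2 * δ) ^ 2 := by
        rw [← intervalIntegral.integral_const_mul]
        have i1 : IntervalIntegrable (fun t => g t * (t - y + 2 * δ) ^ 2) volume (y - 2 * δ) y := by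
          simpa [sub_eq_add_neg, add_assoc] using ik (y - 2 * δ) y 1 (-y + 2 * δ) (by linarith)
            (by linarith) (by linarith)
        calc ∫ t in (y - δ)..y, δ ^ 2 * g t ≤ ∫ t in (y - δ)..y, g t * (t - y + 2 * δ) ^ 2 := by
              refine intervalIntegral.integral_mono_on (by linarith) ((ii _ _ (by linarith)
                (by linarith) (by linarith)).const_mul _) (i1.mono_set ?_) fun t ht => ?_
              · rw [uIcc_of_le (by linarith), uIcc_of_le (by linarith)]
                exact Icc_subset_Icc_left (by linarith)
              · rw [mul_comm]
                gcongr
                linarith [ht.1]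
          _ ≤ _ := intervalIntegral.integral_mono_interval (by linarith) (by linarith) le_rfl
              (Eventually.of_forall fun t => mul_nonneg (hg0 t) (sq_nonneg _)) i1
      have kR : δ ^ 2 * (∫ t in y..(y + δ), g t) ≤
          ∫ t in y..(y + 2 * δ), g t * (y + 2 * δ - t) ^ 2 := by
        rw [← intervalIntegral.integral_const_mul]
        have i1 : IntervalIntegrable (fun t => g t * (y + 2 * δ - t) ^ 2) volume y (y + 2 * δ) := by
          have := ik y (y + 2 * δ) (-1) (y + 2 * δ) (by linarith) (by linarith) (by linarith)
          refine this.congr fun t _ => ?_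
          ring
        calc ∫ t in y..(y + δ), δ ^ 2 * g t ≤ ∫ t in y..(y + δ), g t * (y + 2 * δ - t) ^ 2 := by
              refine intervalIntegral.integral_mono_on (by linarith) ((ii _ _ (by linarith)
                (by linarith) (by linarith)).const_mul _) (i1.mono_set ?_) fun t ht => ?_
              · rw [uIcc_of_le (by linarith), uIcc_of_le (by linarith)]
                exact Icc_subset_Icc_right (by linarith)
              · rw [mul_comm]
                gcongr
                linarith [ht.2]
          _ ≤ _ := intervalIntegral.integral_mono_interval le_rfl (by linarith) (by linarith)
              (Eventually.of_forall fun t => mul_nonneg (hg0 t) (sq_nonneg _)) i1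
      have h7 : m * δ ^ 2 * I₁ ≤ I₂ := by
        have h8 : m / (2 * δ) * (δ ^ 2 * I₁) ≤ m / (2 * δ) *
            ((∫ t in (y - 2 * δ)..y, g t * (t - y + 2 * δ) ^ 2) +
            ∫ t in y..(y + 2 * δ), g t * (y + 2 * δ - t) ^ 2) := by
          rw [hsplit, mul_add (δ ^ 2)]
          gcongr
        have h9 : m / (2 * δ) * (δ ^ 2 * I₁) ≤ 1 / (2 * δ) * I₂ := by
          have := hg0 y
          linarith
        have h10 := mul_le_mul_of_nonneg_left h9 (by positivity : 0 ≤ 2 * δ)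
        have e1 : 2 * δ * (m / (2 * δ) * (δ ^ 2 * I₁)) = m * δ ^ 2 * I₁ := by field_simp
        have e2 : 2 * δ * (1 / (2 * δ) * I₂) = I₂ := by field_simp
        rwa [e1, e2] at h10
      calc m * g y ≤ m * (1 / (2 * δ) * I₁) := by
            gcongr
            have : 1 / (2 * δ) * I₁ = (1 / δ * I₁) / 2 := by field_simp
            linarith
        _ = 1 / (2 * δ ^ 3) * (m * δ ^ 2 * I₁) := by field_simp
        _ ≤ _ := by gcongr
  have hA' : (Q + 1) * g y ≤ (Q + 1) * ((1 / δ + Q * δ) / 2 * I₂) := by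
    gcongr
    refine hA.trans ?_
    gcongr
  have : (m + Q + 1) * g y = m * g y + (Q + 1) * g y := by ring
  change (m + Q + 1) * g y ≤ _ * I₂
  rw [this]
  linarith

/-- A solution of `u'' = q u` with `q ≥ 0` near infinity which is square integrable against
`dy / y²` decreases in absolute value. -/
theorem SolvesOn.antitone_norm_sq {q : ℝ → ℝ} {u u' : ℝ → ℂ} (hu : SolvesOn (fun x => q x) u u')
    {Y : ℝ} (hY : 0 < Y) (hq : ∀ t, Y ≤ t → 0 ≤ q t)
    (hi : IntegrableOn (fun y => ‖u y‖ ^ 2 / y ^ 2) (Ioi Y)) :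
    AntitoneOn (fun y => ‖u y‖ ^ 2) (Ici Y) := by
  have hpos : ∀ t ∈ Ici Y, 0 < t := fun t ht => hY.trans_le ht
  have h1 : ∀ t ∈ Ici Y, HasDerivAt (fun y => ‖u y‖ ^ 2) (2 * inner ℝ (u t) (u' t)) t :=
    fun t ht => hu.hasDerivAt_norm_sq (hpos t ht)
  have h2 : ∀ t ∈ Ici Y, HasDerivAt (fun t => 2 * inner ℝ (u t) (u' t))
      (2 * (‖u' t‖ ^ 2 + q t * ‖u t‖ ^ 2)) t := fun t ht => hu.hasDerivAt_inner (hpos t ht)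
  have hmono : MonotoneOn (fun t => 2 * inner ℝ (u t) (u' t)) (Ici Y) := by
    refine monotoneOn_of_hasDerivWithinAt_nonneg (convex_Ici Y)
      (fun t ht => (h2 t ht).continuousAt.continuousWithinAt)
      (fun t ht => (h2 t (interior_subset ht)).hasDerivWithinAt) fun t ht => ?_
    have := hq t (interior_subset ht)
    positivity
  refine antitoneOn_of_hasDerivWithinAt_nonpos (convex_Ici Y)
    (fun t ht => (h1 t ht).continuousAt.continuousWithinAt)
    (fun t ht => (h1 t (interior_subset ht)).hasDerivWithinAt) fun t ht => ?_
  have ht : t ∈ Ici Y := interior_subset ht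
  -- A positive derivative at `t` persists by convexity, so `|u|²` grows at least linearly. For `s >
  -- 2t` one has `s - t ≥ s / 2`, hence `|u|² / s² ≥ c / (2 s)`, which is not integrable.
  by_contra! hc
  set c := 2 * inner ℝ (u t) (u' t)
  have ht0 := hpos t ht
  have hlin : ∀ s, t ≤ s → c * (s - t) ≤ ‖u s‖ ^ 2 := by
    intro s hs
    have := (convex_Icc t s).mul_sub_le_image_sub_of_le_deriv (f := fun y => ‖u y‖ ^ 2) (C := c)
      (fun x hx => (h1 x (ht.trans hx.1)).continuousAt.continuousWithinAt)
      (fun x hx => (h1 x (ht.trans (interior_subset hx).1)).differentiableAt.differentiableWithinAt)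
      (fun x hx => by
        have hx' := interior_subset hx
        rw [(h1 x (ht.trans hx'.1)).deriv]
        exact hmono ht (ht.trans hx'.1) hx'.1)
      t (left_mem_Icc.2 hs) s (right_mem_Icc.2 hs) hs
    have h0 : 0 ≤ ‖u t‖ ^ 2 := by positivity
    linarith
  have hn := not_integrableOn_Ioi_inv (a := 2 * t)
  refine hn ?_
  have hi2 : IntegrableOn (fun y => 2 / c * (‖u y‖ ^ 2 / y ^ 2)) (Ioi (2 * t)) :=
    (hi.mono_set (Ioi_subset_Ioi (by linarith [mem_Ici.1 ht]))).const_mul _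
  refine hi2.mono' (by fun_prop) ?_
  refine (ae_restrict_iff' measurableSet_Ioi).2 (Eventually.of_forall fun s hs => ?_)
  have hs : 2 * t < s := hs
  have hs0 : 0 < s := by linarith
  rw [Real.norm_eq_abs, abs_of_pos (inv_pos.2 hs0), ← mul_div_assoc, le_div_iff₀ (by positivity),
    div_mul_eq_mul_div, le_div_iff₀ hc]
  have h3 := hlin s (by linarith)
  have e : s⁻¹ * s ^ 2 = s := by field_simp
  rw [e]
  nlinarith

/-- The equation `u'' = -(λ/y²) u` with `λ > 1/4` has no nonzero solution which is square
integrable against `dy / y²` at infinity. -/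
theorem SolvesOn.eq_zero_of_oscillating {lam : ℝ} (hlam : 1 / 4 < lam) {u u' : ℝ → ℂ}
    (hu : SolvesOn (fun y => ((-lam / y ^ 2 : ℝ) : ℂ)) u u')
    (hi : IntegrableOn (fun y => ‖u y‖ ^ 2 / y ^ 2) (Ioi 1)) {y : ℝ} (hy : 0 < y) : u y = 0 := by
  set r := lam - 1 / 4
  have hr : 0 < r := by simp only [r]; linarith
  -- In the form `u = √y w(log y)` the equation reads `w'' = -r w`, and `v = √y w'(log y)`.
  -- Accordingly `E = |w'|² + r |w|²` is conserved, and `H = 2⟨w, w'⟩` has logarithmic derivative `y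
  -- H' = 2E - 4r |w|²`.
  set v : ℝ → ℂ := fun y => y * u' y - (1 / 2 : ℝ) • u y
  have hv : ∀ y, 0 < y → HasDerivAt v ((1 / (2 * y)) • v y - (r / y) • u y) y := by
    intro y hy
    have hid : HasDerivAt (fun x : ℝ => (x : ℂ)) 1 y := Complex.ofRealCLM.hasDerivAt
    refine ((hid.mul (hu.deriv₂ y hy)).sub ((hu.deriv₁ y hy).const_smul (1 / 2 : ℝ))).congr_deriv ?_
    have hy' : (y : ℂ) ≠ 0 := by exact_mod_cast hy.ne'
    simp only [v, r, Complex.real_smul]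
    push_cast
    field_simp
    ring
  have hu' : ∀ y, 0 < y → HasDerivAt u ((1 / y) • v y + (1 / (2 * y)) • u y) y := by
    intro y hy
    refine (hu.deriv₁ y hy).congr_deriv ?_
    have hy' : (y : ℂ) ≠ 0 := by exact_mod_cast hy.ne'
    simp only [v, Complex.real_smul]
    push_cast
    field_simp
    ring
  set E : ℝ → ℝ := fun y => (‖v y‖ ^ 2 + r * ‖u y‖ ^ 2) / y
  have hE : ∀ y, 0 < y → HasDerivAt E 0 y := by
    intro y hy
    refine (((hv y hy).norm_sq.add ((hu' y hy).norm_sq.const_mul r)).div (hasDerivAt_id y)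
      hy.ne').congr_deriv ?_
    simp only [inner_add_right, inner_sub_right, real_inner_smul_right, real_inner_self_eq_norm_sq,
      real_inner_comm (u y) (v y), Pi.add_apply, id]
    field_simp
    ring
  have hEc : ∀ y, 0 < y → E y = E 1 := fun y hy =>
    isOpen_Ioi.is_const_of_deriv_eq_zero isPreconnected_Ioi
      (fun x hx => (hE x hx).differentiableAt.differentiableWithinAt)
      (fun x hx => (hE x hx).deriv) hy (mem_Ioi.2 one_pos)
  set H : ℝ → ℝ := fun y => 2 * inner ℝ (u y) (v y) / y
  have hH : ∀ y, 0 < y → HasDerivAt H (2 * E 1 * y⁻¹ - 4 * r * (‖u y‖ ^ 2 / y ^ 2)) y := by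
    intro y hy
    refine ((((hu' y hy).inner ℝ (hv y hy)).const_mul 2).div (hasDerivAt_id y)
      hy.ne').congr_deriv ?_
    rw [← hEc y hy]
    simp only [inner_sub_right, inner_add_left, real_inner_smul_right,
      real_inner_smul_left, real_inner_self_eq_norm_sq, E, id]
    field_simp
    ring
  have hHb : ∀ y, 0 < y → |H y| ≤ (1 + 1 / r) * E 1 := by
    intro y hy
    rw [← hEc y hy]
    simp only [H, E]
    rw [abs_div, abs_of_pos hy, mul_div_assoc', abs_mul, abs_two]
    refine div_le_div_of_nonneg_right ?_ hy.le
    have h1 := abs_real_inner_le_norm (u y) (v y)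
    have h2 : 2 * (‖u y‖ * ‖v y‖) ≤ ‖u y‖ ^ 2 + ‖v y‖ ^ 2 := by
      nlinarith [sq_nonneg (‖u y‖ - ‖v y‖)]
    have h3 : (1 + 1 / r) * (‖v y‖ ^ 2 + r * ‖u y‖ ^ 2) =
        ‖u y‖ ^ 2 + ‖v y‖ ^ 2 + (r * ‖u y‖ ^ 2 + ‖v y‖ ^ 2 / r) := by
      field_simp
      ring
    have h4 : 0 ≤ r * ‖u y‖ ^ 2 + ‖v y‖ ^ 2 / r := by positivity
    linarith
  have hE0 : 0 ≤ E 1 := by simp only [E]; positivity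
  set B := ∫ y in Ioi 1, ‖u y‖ ^ 2 / y ^ 2
  -- Integration of `H'` over `[1, T]`: as `H` and the integral of `|u|² / y²` are bounded, `E log
  -- T` stays bounded, which forces `E = 0`.
  have hbound : ∀ T, 1 ≤ T → 2 * E 1 * Real.log T ≤ 2 * ((1 + 1 / r) * E 1) + 4 * r * B := by
    intro T hT
    have hc : ContinuousOn (fun y => ‖u y‖ ^ 2 / y ^ 2) (Icc 1 T) := by
      refine ContinuousOn.div ((hu.continuousOn.mono fun t ht => ?_).norm.pow 2) (by fun_prop) ?_
      · exact one_pos.trans_le ht.1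
      · intro t ht
        have : 0 < t := one_pos.trans_le ht.1
        positivity
    have i1 := hc.intervalIntegrable_of_Icc (μ := volume) hT
    have i2 : IntervalIntegrable (fun y : ℝ => y⁻¹) volume 1 T := by
      refine intervalIntegral.intervalIntegrable_inv (fun t ht => ?_) continuousOn_id
      rw [uIcc_of_le hT] at ht
      exact (one_pos.trans_le ht.1).ne'
    have h := intervalIntegral.integral_eq_sub_of_hasDerivAt (f := H) (a := 1) (b := T)
      (fun t ht => hH t (by rw [uIcc_of_le hT] at ht; exact one_pos.trans_le ht.1))
      ((i2.const_mul _).sub (i1.const_mul _))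
    rw [intervalIntegral.integral_sub (i2.const_mul _) (i1.const_mul _),
      intervalIntegral.integral_const_mul, intervalIntegral.integral_const_mul,
      integral_inv_of_pos one_pos (by linarith), div_one] at h
    have h5 : (∫ y in (1 : ℝ)..T, ‖u y‖ ^ 2 / y ^ 2) ≤ B := by
      rw [intervalIntegral.integral_of_le hT]
      exact setIntegral_mono_set hi (Eventually.of_forall fun y => by positivity)
        (Ioc_subset_Ioi_self).eventuallyLE
    have h6 := abs_le.1 (hHb T (by linarith))
    have h7 := abs_le.1 (hHb 1 one_pos)
    have h8 := mul_le_mul_of_nonneg_left h5 (by positivity : 0 ≤ 4 * r)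
    linarith
  have hE1 : E 1 = 0 := by
    by_contra hne
    have hpos : 0 < E 1 := lt_of_le_of_ne hE0 (Ne.symm hne)
    set K := (2 * ((1 + 1 / r) * E 1) + 4 * r * B) / (2 * E 1)
    have hB : 0 ≤ B := setIntegral_nonneg measurableSet_Ioi fun y _ => by positivity
    have hK : 0 ≤ K := by positivity
    have h := hbound (Real.exp (K + 1)) (Real.one_le_exp (by linarith))
    rw [Real.log_exp] at h
    have : 2 * E 1 * K = 2 * ((1 + 1 / r) * E 1) + 4 * r * B := by
      simp only [K]
      field_simp
    nlinarith
  have h := hEc y hy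
  rw [hE1] at h
  simp only [E] at h
  rw [div_eq_zero_iff, or_iff_left hy.ne'] at h
  have h1 : 0 ≤ ‖v y‖ ^ 2 := by positivity
  have h2 : 0 ≤ r * ‖u y‖ ^ 2 := by positivity
  have h3 : r * ‖u y‖ ^ 2 = 0 := by linarith
  simpa [hr.ne'] using h3

/-! ### Partial derivatives of functions on the upper half-plane -/

/-- The partial derivative `∂/∂x`. -/
def Dx (F : ℂ → ℂ) (w : ℂ) : ℂ := fderiv ℝ F w 1

/-- The partial derivative `∂/∂y`. -/
def Dy (F : ℂ → ℂ) (w : ℂ) : ℂ := fderiv ℝ F w Complex.I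

theorem mem_U {w : ℂ} : w ∈ upperHalfPlaneSet ↔ 0 < w.im := Iff.rfl

theorem isOpen_U : IsOpen upperHalfPlaneSet := isOpen_upperHalfPlaneSet

theorem add_mul_I_mem_U (x : ℝ) {y : ℝ} (hy : 0 < y) :
    (x + y * Complex.I : ℂ) ∈ upperHalfPlaneSet := by
  simpa [mem_U] using hy

theorem analyticOnNhd_Dx {F : ℂ → ℂ} (hF : AnalyticOnNhd ℝ F upperHalfPlaneSet) :
    AnalyticOnNhd ℝ (Dx F) upperHalfPlaneSet := fun w hw =>
  ((ContinuousLinearMap.apply ℝ ℂ (1 : ℂ)).analyticAt _).comp (hF.fderiv w hw)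

theorem analyticOnNhd_Dy {F : ℂ → ℂ} (hF : AnalyticOnNhd ℝ F upperHalfPlaneSet) :
    AnalyticOnNhd ℝ (Dy F) upperHalfPlaneSet := fun w hw =>
  ((ContinuousLinearMap.apply ℝ ℂ Complex.I).analyticAt _).comp (hF.fderiv w hw)

theorem hasDerivAt_Dx {F : ℂ → ℂ} (hF : AnalyticOnNhd ℝ F upperHalfPlaneSet) (x : ℝ) {y : ℝ}
    (hy : 0 < y) : HasDerivAt (fun x : ℝ => F (x + y * Complex.I)) (Dx F (x + y * Complex.I)) x := by
  have h1 := (hF _ (add_mul_I_mem_U x hy)).differentiableAt.hasFDerivAt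
  have h2 : HasDerivAt (fun x : ℝ => (x : ℂ) + y * Complex.I) 1 x :=
    Complex.ofRealCLM.hasDerivAt.add_const _
  exact h1.comp_hasDerivAt x h2

theorem hasDerivAt_Dy {F : ℂ → ℂ} (hF : AnalyticOnNhd ℝ F upperHalfPlaneSet) (x : ℝ) {y : ℝ}
    (hy : 0 < y) : HasDerivAt (fun y : ℝ => F (x + y * Complex.I)) (Dy F (x + y * Complex.I)) y := by
  have h1 := (hF _ (add_mul_I_mem_U x hy)).differentiableAt.hasFDerivAt
  have h2 : HasDerivAt (fun y : ℝ => (x : ℂ) + y * Complex.I) Complex.I y := by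
    have : HasDerivAt (fun y : ℝ => (y : ℂ)) 1 y := Complex.ofRealCLM.hasDerivAt
    simpa using (this.mul_const Complex.I).const_add (x : ℂ)
  exact h1.comp_hasDerivAt y h2

/-- `F` is a real-analytic eigenfunction of the weight `k` Laplacian on the upper half-plane. -/
structure IsEigen (k lam : ℝ) (F : ℂ → ℂ) : Prop where
  analytic : AnalyticOnNhd ℝ F upperHalfPlaneSet
  eqn : ∀ w ∈ upperHalfPlaneSet, (w.im : ℂ) ^ 2 * (Dx (Dx F) w + Dy (Dy F) w) -
    Complex.I * w.im * k * Dx F w + lam * F w = 0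

theorem weightLaplacian_eq {f : ℍ → ℂ} (k : ℝ)
    (hf : AnalyticOnNhd ℝ (fun w : ℂ => f (ofComplex w)) upperHalfPlaneSet) (z : ℍ) :
    weightLaplacian k f z = (z.im : ℂ) ^ 2 * (Dx (Dx fun w : ℂ => f (ofComplex w)) z +
      Dy (Dy fun w : ℂ => f (ofComplex w)) z) -
      Complex.I * z.im * k * Dx (fun w : ℂ => f (ofComplex w)) z := by
  have hz : (z : ℂ) = z.re + z.im * Complex.I := (Complex.re_add_im (z : ℂ)).symm
  have h1 : deriv (fun x : ℝ => f (ofComplex (x + z.im * Complex.I))) =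
      fun x : ℝ => Dx (fun w : ℂ => f (ofComplex w)) (x + z.im * Complex.I) :=
    funext fun x => (hasDerivAt_Dx hf x z.im_pos).deriv
  have h2 : deriv (fun y : ℝ => f (ofComplex (z.re + y * Complex.I))) =ᶠ[𝓝 z.im]
      fun y : ℝ => Dy (fun w : ℂ => f (ofComplex w)) (z.re + y * Complex.I) := by
    filter_upwards [eventually_gt_nhds z.im_pos] with y hy
    exact (hasDerivAt_Dy hf z.re hy).deriv
  rw [weightLaplacian, iteratedDeriv_succ, iteratedDeriv_one, iteratedDeriv_succ, iteratedDeriv_one,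
    h2.deriv_eq, h1, (hasDerivAt_Dx (analyticOnNhd_Dx hf) z.re z.im_pos).deriv,
    (hasDerivAt_Dy (analyticOnNhd_Dy hf) z.re z.im_pos).deriv]
  beta_reduce
  rw [← hz]

theorem isEigen_iff {f : ℍ → ℂ} {k lam : ℝ} : IsEigen k lam (fun w : ℂ => f (ofComplex w)) ↔
    AnalyticOnNhd ℝ (fun w : ℂ => f (ofComplex w)) upperHalfPlaneSet ∧
      ∀ z : ℍ, weightLaplacian k f z + lam * f z = 0 := by
  refine ⟨fun h => ⟨h.1, fun z => ?_⟩, fun h => ⟨h.1, fun w hw => ?_⟩⟩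
  · rw [weightLaplacian_eq k h.1]
    simpa using h.2 z z.2
  · have := h.2 ⟨w, hw⟩
    rw [weightLaplacian_eq k h.1] at this
    simpa [ofComplex_apply_of_im_pos hw] using this

/-! ### Integrals over horizontal segments -/

/-- `∫_0^L F(x + iy) dx`. -/
def rowInt (L : ℝ) (F : ℂ → ℂ) (y : ℝ) : ℂ := ∫ x in (0 : ℝ)..L, F (x + y * Complex.I)

theorem continuous_row {F : ℂ → ℂ} (hF : AnalyticOnNhd ℝ F upperHalfPlaneSet) {y : ℝ}
    (hy : 0 < y) : Continuous fun x : ℝ => F (x + y * Complex.I) :=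
  continuous_iff_continuousAt.2 fun x => (hasDerivAt_Dx hF x hy).continuousAt

theorem hasDerivAt_rowInt {F : ℂ → ℂ} (hF : AnalyticOnNhd ℝ F upperHalfPlaneSet) (L : ℝ) {y : ℝ}
    (hy : 0 < y) : HasDerivAt (rowInt L F) (rowInt L (Dy F) y) y := by
  have hK : IsCompact ((fun p : ℝ × ℝ => (p.1 + p.2 * Complex.I : ℂ)) ''
      (uIcc 0 L ×ˢ Icc (y / 2) (2 * y))) :=
    (isCompact_uIcc.prod isCompact_Icc).image (by fun_prop)
  have hKU : ((fun p : ℝ × ℝ => (p.1 + p.2 * Complex.I : ℂ)) ''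
      (uIcc 0 L ×ˢ Icc (y / 2) (2 * y))) ⊆ upperHalfPlaneSet := by
    rintro _ ⟨p, hp, rfl⟩
    exact add_mul_I_mem_U p.1 (by linarith [hp.2.1])
  obtain ⟨M, hM⟩ := hK.exists_bound_of_continuousOn ((analyticOnNhd_Dy hF).continuousOn.mono hKU)
  refine (intervalIntegral.hasDerivAt_integral_of_dominated_loc_of_deriv_le
    (F := fun (y x : ℝ) => F (x + y * Complex.I))
    (F' := fun (y x : ℝ) => Dy F (x + y * Complex.I)) (s := Ioo (y / 2) (2 * y))
    (bound := fun _ => M) (Ioo_mem_nhds (by linarith) (by linarith)) ?_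
    ((continuous_row hF hy).intervalIntegrable _ _)
    (continuous_row (analyticOnNhd_Dy hF) hy).aestronglyMeasurable ?_
    intervalIntegrable_const ?_).2
  · filter_upwards [eventually_gt_nhds hy] with t ht
    exact (continuous_row hF ht).aestronglyMeasurable
  · refine Eventually.of_forall fun x hx t ht => hM _ ⟨(x, t), ⟨?_, Ioo_subset_Icc_self ht⟩, rfl⟩
    exact uIoc_subset_uIcc hx
  · exact Eventually.of_forall fun x hx t ht => hasDerivAt_Dy hF x (by linarith [ht.1])

theorem continuousOn_rowInt {F : ℂ → ℂ} (hF : AnalyticOnNhd ℝ F upperHalfPlaneSet) (L : ℝ) :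
    ContinuousOn (rowInt L F) (Ioi 0) := fun _ hy =>
  (hasDerivAt_rowInt hF L hy).continuousAt.continuousWithinAt

/-! ### Fourier coefficients -/

theorem e_add (x y : ℝ) : e (x + y) = e x * e y := by
  rw [e, e, e, ← Complex.exp_add]
  push_cast
  ring_nf

theorem e_zero : e 0 = 1 := by simp [e]

theorem e_int (n : ℤ) : e n = 1 := by
  rw [e, show 2 * (Real.pi : ℂ) * Complex.I * ((n : ℝ) : ℂ) = n * (2 * Real.pi * Complex.I) by
    push_cast; ring]
  exact Complex.exp_int_mul_two_pi_mul_I n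

theorem norm_e (x : ℝ) : ‖e x‖ = 1 := by
  rw [e, show 2 * (Real.pi : ℂ) * Complex.I * (x : ℂ) = ((2 * Real.pi * x : ℝ) : ℂ) * Complex.I by
    push_cast; ring]
  exact Complex.norm_exp_ofReal_mul_I _

theorem conj_e (x : ℝ) : (starRingEnd ℂ) (e x) = e (-x) := by
  rw [e, e, ← Complex.exp_conj, show 2 * (Real.pi : ℂ) * Complex.I * (x : ℂ) =
    ((2 * Real.pi * x : ℝ) : ℂ) * Complex.I by push_cast; ring, map_mul, Complex.conj_ofReal,
    Complex.conj_I]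
  push_cast
  ring_nf

theorem hasDerivAt_e (ν x : ℝ) :
    HasDerivAt (fun x : ℝ => e (ν * x)) (2 * Real.pi * Complex.I * ν * e (ν * x)) x := by
  have hid : HasDerivAt (fun x : ℝ => (x : ℂ)) 1 x := Complex.ofRealCLM.hasDerivAt
  have h := ((hid.const_mul (ν : ℂ)).const_mul (2 * Real.pi * Complex.I)).cexp
  simp only [e]
  push_cast
  refine h.congr_deriv ?_
  ring

theorem analyticOnNhd_mul_e {F : ℂ → ℂ} (hF : AnalyticOnNhd ℝ F upperHalfPlaneSet) (ν : ℝ) :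
    AnalyticOnNhd ℝ (fun w => F w * e (ν * w.re)) upperHalfPlaneSet := by
  refine hF.mul fun w _ => ?_
  have h1 : AnalyticAt ℝ (fun w : ℂ => ((ν * w.re : ℝ) : ℂ)) w :=
    (Complex.ofRealCLM.comp (ν • Complex.reCLM)).analyticAt w
  have h2 : AnalyticAt ℂ (fun z : ℂ => Complex.exp (2 * Real.pi * Complex.I * z))
      ((ν * w.re : ℝ) : ℂ) := by fun_prop
  exact AnalyticAt.comp (g := fun z : ℂ => Complex.exp (2 * Real.pi * Complex.I * z))
    (f := fun w : ℂ => ((ν * w.re : ℝ) : ℂ)) (h2.restrictScalars (𝕜 := ℝ)) h1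

theorem Dy_mul_e {F : ℂ → ℂ} (hF : AnalyticOnNhd ℝ F upperHalfPlaneSet) (ν : ℝ) {w : ℂ}
    (hw : w ∈ upperHalfPlaneSet) :
    Dy (fun w => F w * e (ν * w.re)) w = Dy F w * e (ν * w.re) := by
  have h1 := hasDerivAt_Dy (analyticOnNhd_mul_e hF ν) w.re hw
  have h2 := (hasDerivAt_Dy hF w.re hw).mul_const (e (ν * w.re))
  rw [Complex.re_add_im] at h1 h2
  refine h1.unique (h2.congr_of_eventuallyEq (Eventually.of_forall fun y => ?_))
  simp

/-- The Fourier coefficient `(1/L) ∫_0^L F(x+iy) e(-νx) dx`. -/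
def fcoeff (L ν : ℝ) (F : ℂ → ℂ) (y : ℝ) : ℂ :=
  (L : ℂ)⁻¹ * rowInt L (fun w => F w * e (-ν * w.re)) y

theorem hasDerivAt_fcoeff {F : ℂ → ℂ} (hF : AnalyticOnNhd ℝ F upperHalfPlaneSet) (L ν : ℝ) {y : ℝ}
    (hy : 0 < y) : HasDerivAt (fcoeff L ν F) (fcoeff L ν (Dy F) y) y := by
  refine ((hasDerivAt_rowInt (analyticOnNhd_mul_e hF (-ν)) L hy).const_mul _).congr_deriv ?_
  simp only [fcoeff, rowInt]
  congr 1
  exact intervalIntegral.integral_congr fun x _ => Dy_mul_e hF _ (add_mul_I_mem_U x hy)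

theorem Dx_add_period {F : ℂ → ℂ} {L : ℝ} {c : ℂ} (hF : AnalyticOnNhd ℝ F upperHalfPlaneSet)
    (hp : ∀ w ∈ upperHalfPlaneSet, F (w + L) = c * F w) :
    ∀ w ∈ upperHalfPlaneSet, Dx F (w + L) = c * Dx F w := by
  intro w hw
  have h1 := hasDerivAt_Dx hF (w.re + L) hw
  have h2 := (h1.comp_add_const w.re L)
  have h3 := (hasDerivAt_Dx hF w.re hw).const_mul c
  have e1 : (((w.re + L : ℝ) : ℂ) + w.im * Complex.I) = w + L := by
    conv_rhs => rw [← Complex.re_add_im w]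
    push_cast
    ring
  rw [e1] at h2
  rw [Complex.re_add_im] at h3
  refine h2.unique (h3.congr_of_eventuallyEq (Eventually.of_forall fun x => ?_))
  beta_reduce
  rw [← hp _ (add_mul_I_mem_U x hw)]
  push_cast
  ring_nf

/-- Integration by parts; the boundary terms cancel because the quasi-period factor of `F` over a
length `L` is that of `e(νx)`. -/
theorem fcoeff_Dx {F : ℂ → ℂ} {L ν : ℝ} (hF : AnalyticOnNhd ℝ F upperHalfPlaneSet)
    (hp : ∀ w ∈ upperHalfPlaneSet, F (w + L) = e (ν * L) * F w) {y : ℝ} (hy : 0 < y) :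
    fcoeff L ν (Dx F) y = 2 * Real.pi * Complex.I * ν * fcoeff L ν F y := by
  have hd : ∀ x : ℝ, HasDerivAt (fun x : ℝ => F (x + y * Complex.I) * e (-ν * x))
      (Dx F (x + y * Complex.I) * e (-ν * x) -
        2 * Real.pi * Complex.I * ν * (F (x + y * Complex.I) * e (-ν * x))) x := fun x => by
    refine ((hasDerivAt_Dx hF x hy).mul (hasDerivAt_e (-ν) x)).congr_deriv ?_
    push_cast
    ring
  have ce : Continuous fun x : ℝ => e (-ν * x) :=
    continuous_iff_continuousAt.2 fun x => (hasDerivAt_e (-ν) x).continuousAt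
  have c1 : Continuous fun x : ℝ => Dx F (x + y * Complex.I) * e (-ν * x) :=
    (continuous_row (analyticOnNhd_Dx hF) hy).mul ce
  have c2 : Continuous fun x : ℝ => F (x + y * Complex.I) * e (-ν * x) :=
    (continuous_row hF hy).mul ce
  have h := intervalIntegral.integral_eq_sub_of_hasDerivAt (a := 0) (b := L) (fun x _ => hd x)
    ((c1.sub (c2.const_mul _)).intervalIntegrable _ _)
  rw [intervalIntegral.integral_sub (c1.intervalIntegrable _ _)
    ((c2.const_mul _).intervalIntegrable _ _), intervalIntegral.integral_const_mul] at h
  have hb := hp _ (add_mul_I_mem_U 0 hy)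
  have hz : F (L + y * Complex.I) * e (-ν * L) - F ((0 : ℝ) + y * Complex.I) * e (-ν * 0) = 0 := by
    rw [show (L + y * Complex.I : ℂ) = ((0 : ℝ) + y * Complex.I : ℂ) + L by push_cast; ring, hb,
      mul_zero, e_zero, mul_one, mul_right_comm, ← e_add, neg_mul, add_neg_cancel, e_zero, one_mul,
      sub_self]
  rw [hz, sub_eq_zero] at h
  simp only [fcoeff, rowInt]
  simp only [Complex.add_re, Complex.ofReal_re, Complex.mul_re, Complex.I_re, mul_zero,
    Complex.ofReal_im, Complex.I_im, mul_one, sub_self, add_zero]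
  rw [h]
  ring

/-- The potential in the equation for the Fourier coefficients. -/
def fourierQ (k lam ν y : ℝ) : ℝ := 4 * Real.pi ^ 2 * ν ^ 2 - 2 * Real.pi * k * ν / y - lam / y ^ 2

/-- Integrating the eigenvalue equation against `e(-νx)` replaces `∂/∂x` by `2πiν`. The weight term
becomes the `1/y` part of the potential. -/
theorem solvesOn_fcoeff {k lam L ν : ℝ} {F : ℂ → ℂ} (hF : IsEigen k lam F)
    (hp : ∀ w ∈ upperHalfPlaneSet, F (w + L) = e (ν * L) * F w) :
    SolvesOn (fun y => (fourierQ k lam ν y : ℂ)) (fcoeff L ν F) (fcoeff L ν (Dy F)) := by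
  refine ⟨fun y hy => hasDerivAt_fcoeff hF.analytic L ν hy, fun y hy => ?_⟩
  refine (hasDerivAt_fcoeff (analyticOnNhd_Dy hF.analytic) L ν hy).congr_deriv ?_
  have a1 := analyticOnNhd_Dx hF.analytic
  have hy' : (y : ℂ) ≠ 0 := by exact_mod_cast hy.ne'
  have h1 := fcoeff_Dx hF.analytic hp hy
  have h2 := fcoeff_Dx a1 (Dx_add_period hF.analytic hp) hy
  have e1 : ∀ G : ℂ → ℂ, AnalyticOnNhd ℝ G upperHalfPlaneSet →
      IntervalIntegrable (fun x : ℝ => G (x + y * Complex.I) *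
        e (-ν * (x + y * Complex.I : ℂ).re)) volume 0 L := fun G hG =>
    (continuous_row (analyticOnNhd_mul_e hG (-ν)) hy).intervalIntegrable _ _
  have key : fcoeff L ν (Dy (Dy F)) y = -fcoeff L ν (Dx (Dx F)) y +
      Complex.I * k / y * fcoeff L ν (Dx F) y - lam / y ^ 2 * fcoeff L ν F y := by
    have i1 := e1 _ (analyticOnNhd_Dx a1)
    have i2 := e1 _ a1
    have i3 := e1 _ hF.analytic
    simp only [fcoeff, rowInt]
    have : (∫ x in (0 : ℝ)..L, Dy (Dy F) (x + y * Complex.I) *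
        e (-ν * (x + y * Complex.I : ℂ).re)) = ∫ x in (0 : ℝ)..L,
        ((-1 : ℂ) * (Dx (Dx F) (x + y * Complex.I) * e (-ν * (x + y * Complex.I : ℂ).re)) +
        Complex.I * k / y * (Dx F (x + y * Complex.I) * e (-ν * (x + y * Complex.I : ℂ).re)) -
        lam / y ^ 2 * (F (x + y * Complex.I) * e (-ν * (x + y * Complex.I : ℂ).re))) := by
      refine intervalIntegral.integral_congr fun x _ => ?_
      have := hF.eqn _ (add_mul_I_mem_U x hy)
      rw [show (x + y * Complex.I : ℂ).im = y by simp] at this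
      generalize e (-ν * (x + y * Complex.I : ℂ).re) = E at *
      field_simp
      linear_combination E * this
    rw [this, intervalIntegral.integral_sub ((i1.const_mul _).add (i2.const_mul _))
      (i3.const_mul _), intervalIntegral.integral_add (i1.const_mul _) (i2.const_mul _),
      intervalIntegral.integral_const_mul, intervalIntegral.integral_const_mul,
      intervalIntegral.integral_const_mul]
    ring
  rw [key, h2, h1, fourierQ]
  push_cast
  field_simp
  linear_combination (4 * Real.pi ^ 2 * ν ^ 2 * y ^ 2 - 2 * Real.pi * y * k * ν) *
    fcoeff L ν F y * (-Complex.I_sq)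

/-! ### Fourier series along horizontal lines -/

/-- `∫_0^L ‖F(x + iy)‖² dx`. -/
def rowSq (L : ℝ) (F : ℂ → ℂ) (y : ℝ) : ℝ := ∫ x in (0 : ℝ)..L, ‖F (x + y * Complex.I)‖ ^ 2

/-- Since `|F|² = F · conj F` is again real-analytic, the continuity of `rowInt` applies. -/
theorem continuousOn_rowSq {F : ℂ → ℂ} (hF : AnalyticOnNhd ℝ F upperHalfPlaneSet) (L : ℝ) :
    ContinuousOn (rowSq L F) (Ioi 0) := by
  have hc : AnalyticOnNhd ℝ (fun w => F w * (starRingEnd ℂ) (F w)) upperHalfPlaneSet :=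
    hF.mul fun w hw => (Complex.conjCLE.toContinuousLinearMap.analyticAt _).comp (hF w hw)
  have h := (Complex.continuous_re.comp_continuousOn (continuousOn_rowInt hc L))
  refine h.congr fun y _ => ?_
  have : rowInt L (fun w => F w * (starRingEnd ℂ) (F w)) y = ((rowSq L F y : ℝ) : ℂ) := by
    rw [rowSq, rowInt, ← intervalIntegral.integral_ofReal]
    refine intervalIntegral.integral_congr fun x _ => ?_
    simp [Complex.mul_conj, Complex.normSq_eq_norm_sq]
  simp [this]

theorem rowSq_nonneg {L : ℝ} (hL : 0 < L) (F : ℂ → ℂ) (y : ℝ) : 0 ≤ rowSq L F y :=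
  intervalIntegral.integral_nonneg hL.le fun _ _ => by positivity

theorem fourier_eq_e {L : ℝ} (n : ℤ) (x : ℝ) :
    fourier n (x : AddCircle L) = e (n / L * x) := by
  rw [fourier_coe_apply, e]
  push_cast
  ring_nf

theorem fourierCoeffOn_eq_fcoeff {F : ℂ → ℂ} {L : ℝ} (hL : 0 < L) (β y : ℝ) (n : ℤ) :
    fourierCoeffOn hL (fun x : ℝ => F (x + y * Complex.I) * e (-(β / L) * x)) n =
      fcoeff L ((n + β) / L) F y := by
  rw [fourierCoeffOn_eq_integral, fcoeff, rowInt, sub_zero, one_div, Complex.real_smul,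
    Complex.ofReal_inv]
  congr 1
  refine intervalIntegral.integral_congr fun x _ => ?_
  simp only [Complex.add_re, Complex.ofReal_re, Complex.mul_re, Complex.I_re, mul_zero,
    Complex.ofReal_im, Complex.I_im, mul_one, sub_self, add_zero, smul_eq_mul]
  rw [fourier_eq_e, mul_left_comm, ← e_add]
  congr 2
  push_cast
  ring

/-- Parseval for `F · e(-βx/L)` on one segment; the twist moves the frequencies from `n/L` to `(n +
β)/L` without changing the modulus. -/
theorem hasSum_norm_sq_fcoeff {F : ℂ → ℂ} (hF : AnalyticOnNhd ℝ F upperHalfPlaneSet) {L : ℝ}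
    (hL : 0 < L) (β : ℝ) {y : ℝ} (hy : 0 < y) :
    HasSum (fun n : ℤ => ‖fcoeff L ((n + β) / L) F y‖ ^ 2) (L⁻¹ * rowSq L F y) := by
  have ce : Continuous fun x : ℝ => e (-(β / L) * x) :=
    continuous_iff_continuousAt.2 fun x => (hasDerivAt_e _ x).continuousAt
  have hc := (continuous_row hF hy).mul ce
  have hm : MemLp (fun x : ℝ => F (x + y * Complex.I) * e (-(β / L) * x)) 2
      (volume.restrict (Ioc 0 L)) := by
    obtain ⟨M, hM⟩ := isCompact_Icc.exists_bound_of_continuousOn (hc.continuousOn (s := Icc 0 L))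
    refine MemLp.of_bound hc.aestronglyMeasurable M ?_
    filter_upwards [ae_restrict_mem measurableSet_Ioc] with x hx
    exact hM x (Ioc_subset_Icc_self hx)
  have h := hasSum_sq_fourierCoeffOn hL hm
  simp only [fourierCoeffOn_eq_fcoeff, sub_zero, smul_eq_mul, norm_mul, norm_e, mul_one] at h
  exact h

/-- Quasi-periodicity makes `F · e(-βx/L)` a continuous function on the circle, whose Fourier series
converges pointwise once the coefficients are summable. -/
theorem hasSum_fcoeff_mul_e {F : ℂ → ℂ} (hF : AnalyticOnNhd ℝ F upperHalfPlaneSet) {L : ℝ}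
    (hL : 0 < L) {β : ℝ} (hp : ∀ w ∈ upperHalfPlaneSet, F (w + L) = e β * F w) {y : ℝ} (hy : 0 < y)
    (hs : Summable fun n : ℤ => ‖fcoeff L ((n + β) / L) F y‖) (x : ℝ) :
    HasSum (fun n : ℤ => fcoeff L ((n + β) / L) F y * e ((n + β) / L * x))
      (F (x + y * Complex.I)) := by
  have : Fact (0 < L) := ⟨hL⟩
  have ce : Continuous fun x : ℝ => e (-(β / L) * x) :=
    continuous_iff_continuousAt.2 fun x => (hasDerivAt_e _ x).continuousAt
  have hc := (continuous_row hF hy).mul ce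
  have hper : Function.Periodic (fun x : ℝ => F (x + y * Complex.I) * e (-(β / L) * x)) L := by
    intro x
    have := hp _ (add_mul_I_mem_U x hy)
    beta_reduce
    rw [show (((x + L : ℝ) : ℂ) + y * Complex.I) = x + y * Complex.I + L by push_cast; ring, this,
      mul_assoc, mul_left_comm, ← e_add]
    congr 2
    field_simp
    ring
  let g : C(AddCircle L, ℂ) := ⟨hper.lift, continuous_coinduced_dom.mpr hc⟩
  have hg : ∀ n, fourierCoeff g n = fcoeff L ((n + β) / L) F y := fun n => by
    rw [← fourierCoeffOn_eq_fcoeff hL, fourierCoeffOn_eq_integral,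
      fourierCoeff_eq_intervalIntegral _ _ 0]
    simp only [fourier_eq_e, sub_zero, zero_add]
    rfl
  have h := has_pointwise_sum_fourier_series_of_summable (f := g)
    (by simpa only [funext hg] using hs.of_norm) x
  simp only [hg, smul_eq_mul] at h
  have h2 := h.mul_right (e (β / L * x))
  have e1 : g (x : AddCircle L) * e (β / L * x) = F (x + y * Complex.I) := by
    change F (x + y * Complex.I) * e (-(β / L) * x) * e (β / L * x) = _
    rw [mul_assoc, ← e_add, neg_mul, neg_add_cancel, e_zero, mul_one]
  rw [e1] at h2
  refine (congrArg (HasSum · _ _) (funext fun n => ?_)).mp h2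
  simp only [fourier_eq_e, mul_assoc, ← e_add]
  congr 2
  ring

/-! ### Pointwise bounds for eigenfunctions -/

/-- Completing the square: half of `4π²ν²` absorbs the term linear in `ν`. -/
theorem fourierQ_ge {k lam ν y y₀ : ℝ} (hy₀ : 0 < y₀) (hy : y₀ ≤ y) :
    2 * Real.pi ^ 2 * ν ^ 2 - (k ^ 2 / (2 * y₀ ^ 2) + |lam| / y₀ ^ 2) ≤ fourierQ k lam ν y := by
  have hy' : 0 < y := hy₀.trans_le hy
  have h1 : 2 * Real.pi * k * ν / y ≤ 2 * Real.pi ^ 2 * ν ^ 2 + k ^ 2 / (2 * y ^ 2) := by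
    have : 0 ≤ (2 * Real.pi * ν - k / y) ^ 2 / 2 := by positivity
    have e1 : (2 * Real.pi * ν - k / y) ^ 2 / 2 = 2 * Real.pi ^ 2 * ν ^ 2 + k ^ 2 / (2 * y ^ 2) -
      2 * Real.pi * k * ν / y := by field_simp; ring
    linarith
  have h2 : k ^ 2 / (2 * y ^ 2) ≤ k ^ 2 / (2 * y₀ ^ 2) := by gcongr
  have h3 : lam / y ^ 2 ≤ |lam| / y₀ ^ 2 :=
    (div_le_div_of_nonneg_right (le_abs_self lam) (by positivity)).trans (by gcongr)
  rw [fourierQ]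
  linarith

theorem summable_inv_one_add_sq {L : ℝ} (hL : 0 < L) (β : ℝ) :
    Summable fun n : ℤ => (2 * Real.pi ^ 2 * ((n + β) / L) ^ 2 + 1)⁻¹ := by
  have h := ((Real.summable_one_div_int_add_rpow β 2).2 (by norm_num)).mul_left
    (L ^ 2 / (2 * Real.pi ^ 2))
  refine h.of_norm_bounded_eventually ?_
  have hf : {n : ℤ | (n : ℝ) + β = 0}.Finite :=
    Set.Subsingleton.finite fun a ha b hb => by
      simp only [mem_ofPred_eq] at ha hb
      exact_mod_cast (by linarith : (a : ℝ) = b)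
  filter_upwards [hf.compl_mem_cofinite] with n hn
  have hn' : (n : ℝ) + β ≠ 0 := hn
  have : 0 < ((n : ℝ) + β) ^ 2 := by positivity
  rw [Real.norm_of_nonneg (by positivity), Real.rpow_two, sq_abs]
  have e1 : L ^ 2 / (2 * Real.pi ^ 2) * (1 / ((n : ℝ) + β) ^ 2) =
      (2 * Real.pi ^ 2 * ((n + β) / L) ^ 2)⁻¹ := by field_simp
  rw [e1]
  exact inv_anti₀ (by positivity) (by linarith)

theorem exp_period_eq {L : ℝ} (hL : 0 < L) (β : ℝ) (n : ℤ) : e ((n + β) / L * L) = e β := by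
  rw [div_mul_cancel₀ _ hL.ne', e_add, e_int, one_mul]

/-- By `SolvesOn.norm_sq_le` with `m = 2π²ν² - Q`, the quantity `(2π²ν² + 1) |c_ν(y)|²` is bounded
by a local mean square of `c_ν`. Parseval sums these, and Cauchy–Schwarz against the convergent
series of `(2π²ν² + 1)⁻¹` bounds the sum of the moduli. Working with finite sums makes absolute
convergence of the Fourier series a consequence. -/
theorem exists_sum_fcoeff_bound (k lam β : ℝ) {L δ y₀ : ℝ} (hL : 0 < L) (hδ : 0 < δ)
    (hy₀ : 0 < y₀) : ∃ C : ℝ, 0 ≤ C ∧ ∀ F, IsEigen k lam F →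
      (∀ w ∈ upperHalfPlaneSet, F (w + L) = e β * F w) → ∀ y, y₀ + 2 * δ ≤ y → ∀ s : Finset ℤ,
      (∑ n ∈ s, ‖fcoeff L ((n + β) / L) F y‖) ^ 2 ≤
        C * ∫ t in (y - 2 * δ)..(y + 2 * δ), rowSq L F t := by
  set Q : ℝ := k ^ 2 / (2 * y₀ ^ 2) + |lam| / y₀ ^ 2 with hQ
  have hQ0 : 0 ≤ Q := by positivity
  set K : ℝ := 1 / (2 * δ ^ 3) + (Q + 1) * (1 / δ + Q * δ) / 2 with hK
  have hK0 : 0 ≤ K := by positivity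
  set S : ℝ := ∑' n : ℤ, (2 * Real.pi ^ 2 * ((n + β) / L) ^ 2 + 1)⁻¹ with hS
  have hsum := summable_inv_one_add_sq hL β
  have hS0 : 0 ≤ S := tsum_nonneg fun n => by positivity
  refine ⟨S * (K * L⁻¹), by positivity, fun F hF hp y hy s => ?_⟩
  have hpos : ∀ t ∈ uIcc (y - 2 * δ) (y + 2 * δ), 0 < t := fun t ht => by
    rw [uIcc_of_le (by linarith)] at ht
    linarith [ht.1]
  have hsol : ∀ n : ℤ, SolvesOn (fun y => (fourierQ k lam ((n + β) / L) y : ℂ))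
      (fcoeff L ((n + β) / L) F) (fcoeff L ((n + β) / L) (Dy F)) := fun n =>
    solvesOn_fcoeff hF fun w hw => by rw [exp_period_eq hL, hp w hw]
  have hcont : ∀ n : ℤ, IntervalIntegrable (fun t => ‖fcoeff L ((n + β) / L) F t‖ ^ 2) volume
      (y - 2 * δ) (y + 2 * δ) := fun n => ContinuousOn.intervalIntegrable fun t ht =>
    (((hsol n).deriv₁ t (hpos t ht)).continuousAt.norm.pow 2).continuousWithinAt
  have h1 : ∀ n : ℤ, (2 * Real.pi ^ 2 * ((n + β) / L) ^ 2 + 1) *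
      ‖fcoeff L ((n + β) / L) F y‖ ^ 2 ≤
      K * ∫ t in (y - 2 * δ)..(y + 2 * δ), ‖fcoeff L ((n + β) / L) F t‖ ^ 2 := fun n => by
    have := (hsol n).norm_sq_le (δ := δ) (y := y) (Q := Q)
      (m := 2 * Real.pi ^ 2 * ((n + β) / L) ^ 2 - Q) hδ (by linarith) hQ0
      (by have : 0 ≤ 2 * Real.pi ^ 2 * ((n + β) / L) ^ 2 := by positivity
          linarith)
      (fun t ht => fourierQ_ge hy₀ (by linarith [ht.1]))
    convert this using 2
    ring
  have h2 : ∑ n ∈ s, (2 * Real.pi ^ 2 * ((n + β) / L) ^ 2 + 1) *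
      ‖fcoeff L ((n + β) / L) F y‖ ^ 2 ≤
      K * L⁻¹ * ∫ t in (y - 2 * δ)..(y + 2 * δ), rowSq L F t := by
    refine (Finset.sum_le_sum fun n _ => h1 n).trans ?_
    rw [← Finset.mul_sum, ← intervalIntegral.integral_finsetSum fun n _ => hcont n, mul_assoc,
      ← intervalIntegral.integral_const_mul L⁻¹]
    refine mul_le_mul_of_nonneg_left (intervalIntegral.integral_mono_on (by linarith)
      (by simpa only [Finset.sum_fn] using IntervalIntegrable.sum s fun n _ => hcont n) ?_
      fun t ht => ?_) hK0
    · exact (((continuousOn_rowSq hF.analytic L).mono hpos).const_smul L⁻¹).intervalIntegrable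
    · have := hasSum_norm_sq_fcoeff hF.analytic hL β (hpos t (by rwa [uIcc_of_le (by linarith)]))
      exact sum_le_hasSum s (fun _ _ => by positivity) this
  have h3 := Finset.sum_sq_le_sum_mul_sum_of_sq_le_mul s
    (r := fun n : ℤ => ‖fcoeff L ((n + β) / L) F y‖)
    (f := fun n : ℤ => (2 * Real.pi ^ 2 * ((n + β) / L) ^ 2 + 1)⁻¹)
    (g := fun n : ℤ => (2 * Real.pi ^ 2 * ((n + β) / L) ^ 2 + 1) *
      ‖fcoeff L ((n + β) / L) F y‖ ^ 2) (fun _ _ => by positivity) (fun _ _ => by positivity)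
    (fun n _ => by
      have : 2 * Real.pi ^ 2 * (((n : ℝ) + β) / L) ^ 2 + 1 ≠ 0 := by positivity
      rw [inv_mul_cancel_left₀ this])
  refine h3.trans ((mul_le_mul (hsum.sum_le_tsum s fun _ _ => by positivity) h2
    (Finset.sum_nonneg fun _ _ => by positivity) hS0).trans_eq ?_)
  ring

theorem summable_of_sq_sum_le {f : ℤ → ℝ} {B : ℝ} (hf : ∀ n, 0 ≤ f n)
    (h : ∀ s : Finset ℤ, (∑ n ∈ s, f n) ^ 2 ≤ B) : Summable f :=
  summable_of_sum_le hf fun s => Real.le_sqrt_of_sq_le (h s)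

theorem norm_sq_le_of_sum_fcoeff {F : ℂ → ℂ} (hF : AnalyticOnNhd ℝ F upperHalfPlaneSet) {L : ℝ}
    (hL : 0 < L) {β : ℝ} (hp : ∀ w ∈ upperHalfPlaneSet, F (w + L) = e β * F w) {w : ℂ}
    (hw : w ∈ upperHalfPlaneSet) {B : ℝ}
    (h : ∀ s : Finset ℤ, (∑ n ∈ s, ‖fcoeff L ((n + β) / L) F w.im‖) ^ 2 ≤ B) :
    ‖F w‖ ^ 2 ≤ B := by
  have hB : 0 ≤ B := by simpa using h ∅
  have hs := summable_of_sq_sum_le (fun _ => norm_nonneg _) h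
  have h1 := hasSum_fcoeff_mul_e hF hL hp hw hs w.re
  rw [Complex.re_add_im] at h1
  have hs' : Summable fun n : ℤ =>
      ‖fcoeff L ((n + β) / L) F w.im * e ((n + β) / L * w.re)‖ := by
    simpa only [norm_mul, norm_e, mul_one] using hs
  have h2 : ‖F w‖ ≤ Real.sqrt B := by
    rw [← h1.tsum_eq]
    refine (norm_tsum_le_tsum_norm hs').trans ?_
    simp only [norm_mul, norm_e, mul_one]
    exact hs.tsum_le_of_sum_le fun s => Real.le_sqrt_of_sq_le (h s)
  calc ‖F w‖ ^ 2 ≤ Real.sqrt B ^ 2 := by gcongr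
    _ = B := Real.sq_sqrt hB

theorem hasSum_fcoeff {k lam : ℝ} {F : ℂ → ℂ} (hF : IsEigen k lam F) {L : ℝ}
    (hL : 0 < L) {β : ℝ} (hp : ∀ w ∈ upperHalfPlaneSet, F (w + L) = e β * F w) {w : ℂ}
    (hw : w ∈ upperHalfPlaneSet) :
    HasSum (fun n : ℤ => fcoeff L ((n + β) / L) F w.im * e ((n + β) / L * w.re)) (F w) := by
  have hw' : 0 < w.im := hw
  obtain ⟨C, _, h⟩ := exists_sum_fcoeff_bound k lam β (δ := w.im / 4) (y₀ := w.im / 2) hL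
    (by positivity) (by positivity)
  have hs := summable_of_sq_sum_le (fun _ => norm_nonneg _) (h F hF hp w.im (by linarith))
  have h1 := hasSum_fcoeff_mul_e hF.analytic hL hp hw hs w.re
  rwa [Complex.re_add_im] at h1

/-- The nonzero frequencies keep a distance from zero, so one height serves all of them in
`fourierQ_nonneg`. -/
theorem exists_le_abs_int_add (β : ℝ) : ∃ η : ℝ, 0 < η ∧ ∀ n : ℤ, (n : ℝ) + β ≠ 0 →
    η ≤ |(n : ℝ) + β| := by
  have hβ := Int.floor_add_fract β
  have key : ∀ n : ℤ, (n : ℝ) + β = ((n + ⌊β⌋ : ℤ) : ℝ) + Int.fract β := fun n => by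
    push_cast
    linarith
  rcases eq_or_lt_of_le (Int.fract_nonneg β) with h | h
  · refine ⟨1, one_pos, fun n hn => ?_⟩
    rw [key, ← h, add_zero] at hn ⊢
    have : n + ⌊β⌋ ≠ 0 := by exact_mod_cast hn
    exact_mod_cast Int.one_le_abs this
  · have h1 := Int.fract_lt_one β
    refine ⟨min (Int.fract β) (1 - Int.fract β), lt_min h (by linarith), fun n _ => ?_⟩
    rw [key]
    generalize n + ⌊β⌋ = j
    rcases le_or_gt 0 j with hj | hj
    · have : (0 : ℝ) ≤ j := by exact_mod_cast hj
      exact (min_le_left _ _).trans (le_trans (by linarith) (le_abs_self _))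
    · have : (j : ℝ) ≤ -1 := by exact_mod_cast Int.le_sub_one_of_lt hj
      exact (min_le_right _ _).trans (le_trans (by linarith) (neg_le_abs _))

theorem fourierQ_nonneg {k lam ν η y : ℝ} (hlam : 0 ≤ lam) (hη : 0 < η) (hν : η ≤ |ν|)
    (hy : 1 + |k| / (Real.pi * η) + lam / η ^ 2 ≤ y) : 0 ≤ fourierQ k lam ν y := by
  have hpi := Real.pi_pos
  have p1 : 0 ≤ |k| / (Real.pi * η) := by positivity
  have p2 : 0 ≤ lam / η ^ 2 := by positivity
  have hy1 : 1 ≤ y := by linarith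
  have hy0 : 0 < y := by linarith
  have a1 : |k| ≤ y * (Real.pi * η) := (div_le_iff₀ (by positivity)).1 (by linarith)
  have a2 : lam ≤ y * η ^ 2 := (div_le_iff₀ (by positivity)).1 (by linarith)
  have a3 : η ^ 2 ≤ ν ^ 2 := by
    rw [← sq_abs ν]
    gcongr
  have b1 : k * ν ≤ y * Real.pi * ν ^ 2 := by
    calc k * ν ≤ |k| * |ν| := by rw [← abs_mul]; exact le_abs_self _
      _ ≤ y * (Real.pi * |ν|) * |ν| := by gcongr; exact a1.trans (by gcongr)
      _ = y * Real.pi * ν ^ 2 := by rw [← sq_abs ν]; ring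
  have b2 : lam ≤ y ^ 2 * ν ^ 2 := by
    calc lam ≤ y * η ^ 2 := a2
      _ ≤ y ^ 2 * ν ^ 2 := by gcongr; nlinarith
  have e1 : fourierQ k lam ν y = (4 * Real.pi ^ 2 * ν ^ 2 * y ^ 2 - 2 * Real.pi * y * (k * ν) -
      lam) / y ^ 2 := by rw [fourierQ]; field_simp
  rw [e1]
  refine div_nonneg ?_ (by positivity)
  have c1 : 2 * Real.pi * y * (k * ν) ≤ 2 * Real.pi * y * (y * Real.pi * ν ^ 2) := by gcongr
  have c2 : y ^ 2 * ν ^ 2 ≤ Real.pi ^ 2 * (y ^ 2 * ν ^ 2) :=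
    le_mul_of_one_le_left (by positivity) (by nlinarith [Real.pi_gt_three])
  nlinarith [sq_nonneg (y * ν * Real.pi)]

/-- The Fourier coefficients of an eigenfunction which is square integrable near `i∞`: the zero
frequency does not occur, and the others are non-increasing in absolute value. -/
theorem fcoeff_of_integrable {k lam β L η : ℝ} (hL : 0 < L) (hlam : 1 / 4 < lam) (hη : 0 < η)
    {F : ℂ → ℂ} (hF : IsEigen k lam F) (hp : ∀ w ∈ upperHalfPlaneSet, F (w + L) = e β * F w)
    (hi : IntegrableOn (fun y => rowSq L F y / y ^ 2) (Ioi 1)) (n : ℤ) :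
    ((n : ℝ) + β = 0 → ∀ y, 0 < y → fcoeff L ((n + β) / L) F y = 0) ∧
    (η ≤ |(n + β) / L| → AntitoneOn (fun y => ‖fcoeff L ((n + β) / L) F y‖ ^ 2)
      (Ici (1 + |k| / (Real.pi * η) + lam / η ^ 2))) := by
  have hsol : SolvesOn (fun y => (fourierQ k lam ((n + β) / L) y : ℂ))
      (fcoeff L ((n + β) / L) F) (fcoeff L ((n + β) / L) (Dy F)) :=
    solvesOn_fcoeff hF fun w hw => by rw [exp_period_eq hL, hp w hw]
  have hint : IntegrableOn (fun y => ‖fcoeff L ((n + β) / L) F y‖ ^ 2 / y ^ 2) (Ioi 1) := by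
    refine (hi.const_mul L⁻¹).mono' ?_ ?_
    · refine ContinuousOn.aestronglyMeasurable (fun t ht => ?_) measurableSet_Ioi
      have ht' : 0 < t := one_pos.trans ht
      exact (((hsol.deriv₁ t ht').continuousAt.norm.pow 2).div
        (continuousAt_id.pow 2) (pow_ne_zero 2 ht'.ne')).continuousWithinAt
    · filter_upwards [ae_restrict_mem measurableSet_Ioi] with t ht
      have ht' : 0 < t := one_pos.trans ht
      have := le_hasSum (hasSum_norm_sq_fcoeff hF.analytic hL β ht') n fun _ _ => by positivity
      rw [Real.norm_of_nonneg (by positivity), ← mul_div_assoc]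
      gcongr
  refine ⟨fun h0 y hy => ?_, fun hν => ?_⟩
  · rw [h0, zero_div] at hsol hint ⊢
    have hq : (fun y => (fourierQ k lam 0 y : ℂ)) = fun y => ((-lam / y ^ 2 : ℝ) : ℂ) := by
      funext y
      simp [fourierQ, neg_div]
    rw [hq] at hsol
    exact hsol.eq_zero_of_oscillating hlam hint hy
  · have p1 : 0 ≤ |k| / (Real.pi * η) := by positivity
    have p2 : 0 ≤ lam / η ^ 2 := by positivity
    exact hsol.antitone_norm_sq (by linarith) (fun y hy => fourierQ_nonneg (by linarith) hη hν hy)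
      (hint.mono_set (Ioi_subset_Ioi (by linarith)))

/-- Up to a fixed height the local bound applies. Above it the zero frequency is absent and every
other coefficient is no larger than at that height, so the estimate made there persists. The
constants do not depend on `F`. -/
theorem exists_sup_bound (k lam β : ℝ) {L : ℝ} (hL : 0 < L) (hlam : 1 / 4 < lam) :
    ∃ C Y : ℝ, 0 ≤ C ∧ 1 / 2 ≤ Y ∧ ∀ F, IsEigen k lam F →
      (∀ w ∈ upperHalfPlaneSet, F (w + L) = e β * F w) →
      IntegrableOn (fun y => rowSq L F y / y ^ 2) (Ioi 1) →
      ∀ w : ℂ, 3 / 4 ≤ w.im → ‖F w‖ ^ 2 ≤ C * ∫ y in (1 / 2 : ℝ)..Y, rowSq L F y := by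
  -- With `δ = 1/8` the windows around heights in `[3/4, Y]` have radius `1/4` and stay inside
  -- `[1/2, Y + 1/4]`. The value `3/4` lies below `√3/2`, the least height in the standard
  -- fundamental domain.
  obtain ⟨C, hC, hb⟩ := exists_sum_fcoeff_bound k lam β (δ := 1 / 8) (y₀ := 1 / 2) hL
    (by norm_num) (by norm_num)
  obtain ⟨η₀, hη₀, hη⟩ := exists_le_abs_int_add β
  set η := η₀ / L with hηdef
  have hη' : 0 < η := by positivity
  set Y := 1 + |k| / (Real.pi * η) + lam / η ^ 2 with hY
  have p1 : 0 ≤ |k| / (Real.pi * η) := by positivity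
  have p2 : 0 ≤ lam / η ^ 2 := by positivity
  have hY1 : 1 ≤ Y := by linarith
  refine ⟨C, Y + 1 / 4, hC, by linarith, fun F hF hp hi w hw => ?_⟩
  have hw' : w ∈ upperHalfPlaneSet := mem_U.2 (by linarith)
  have hloc : ∀ y, 3 / 4 ≤ y → y ≤ Y → ∀ s : Finset ℤ,
      (∑ n ∈ s, ‖fcoeff L ((n + β) / L) F y‖) ^ 2 ≤
        C * ∫ y in (1 / 2 : ℝ)..(Y + 1 / 4), rowSq L F y := fun y h1 h2 s => by
    refine (hb F hF hp y (by linarith) s).trans (mul_le_mul_of_nonneg_left ?_ hC)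
    refine intervalIntegral.integral_mono_interval (by linarith) (by linarith) (by linarith)
      (Eventually.of_forall fun t => rowSq_nonneg hL F t)
      (((continuousOn_rowSq hF.analytic L).mono fun t ht => ?_).intervalIntegrable)
    rw [uIcc_of_le (by linarith)] at ht
    exact lt_of_lt_of_le (by norm_num) ht.1
  refine norm_sq_le_of_sum_fcoeff hF.analytic hL hp hw' fun s => ?_
  rcases le_or_gt w.im Y with h | h
  · exact hloc _ hw h s
  · refine le_trans ?_ (hloc Y (by linarith) le_rfl s)
    refine pow_le_pow_left₀ (Finset.sum_nonneg fun _ _ => norm_nonneg _)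
      (Finset.sum_le_sum fun n _ => ?_) 2
    have hc := fcoeff_of_integrable hL hlam hη' hF hp hi n
    by_cases h0 : (n : ℝ) + β = 0
    · rw [hc.1 h0 _ hw']
      simp
    · have hν : η ≤ |(n + β) / L| := by
        rw [abs_div, abs_of_pos hL]
        exact div_le_div_of_nonneg_right (hη n h0) hL.le
      exact (sq_le_sq₀ (norm_nonneg _) (norm_nonneg _)).1
        (hc.2 hν (mem_Ici.2 le_rfl) (mem_Ici.2 h.le) h.le)

/-! ### The slash operator preserves eigenfunctions -/

theorem Dx_congr {F G : ℂ → ℂ} {w : ℂ} (h : F =ᶠ[𝓝 w] G) : Dx F w = Dx G w := by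
  rw [Dx, Dx, h.fderiv_eq]

theorem Dy_congr {F G : ℂ → ℂ} {w : ℂ} (h : F =ᶠ[𝓝 w] G) : Dy F w = Dy G w := by
  rw [Dy, Dy, h.fderiv_eq]

theorem Dx_mul {F G : ℂ → ℂ} {w : ℂ} (hF : DifferentiableAt ℝ F w) (hG : DifferentiableAt ℝ G w) :
    Dx (fun w => F w * G w) w = Dx F w * G w + F w * Dx G w := by
  rw [Dx, fderiv_fun_mul hF hG, Dx, Dx]
  simp
  ring

theorem Dy_mul {F G : ℂ → ℂ} {w : ℂ} (hF : DifferentiableAt ℝ F w) (hG : DifferentiableAt ℝ G w) :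
    Dy (fun w => F w * G w) w = Dy F w * G w + F w * Dy G w := by
  rw [Dy, fderiv_fun_mul hF hG, Dy, Dy]
  simp
  ring

theorem Dx_add {F G : ℂ → ℂ} {w : ℂ} (hF : DifferentiableAt ℝ F w) (hG : DifferentiableAt ℝ G w) :
    Dx (fun w => F w + G w) w = Dx F w + Dx G w := by
  rw [Dx, fderiv_fun_add hF hG]
  rfl

theorem Dy_add {F G : ℂ → ℂ} {w : ℂ} (hF : DifferentiableAt ℝ F w) (hG : DifferentiableAt ℝ G w) :
    Dy (fun w => F w + G w) w = Dy F w + Dy G w := by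
  rw [Dy, fderiv_fun_add hF hG]
  rfl

theorem fderiv_comp_holomorphic {F g : ℂ → ℂ} {w g' : ℂ} (hF : DifferentiableAt ℝ F (g w))
    (hg : HasDerivAt g g' w) (t : ℂ) :
    fderiv ℝ (fun w => F (g w)) w t = (g' * t).re * Dx F (g w) + (g' * t).im * Dy F (g w) := by
  have h1 : HasFDerivAt g ((ContinuousLinearMap.toSpanSingleton ℂ g').restrictScalars ℝ) w :=
    hg.hasFDerivAt.restrictScalars ℝ
  have h2 : HasFDerivAt (fun w => F (g w)) _ w := hF.hasFDerivAt.comp w h1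
  rw [h2.fderiv]
  simp only [ContinuousLinearMap.comp_apply, ContinuousLinearMap.coe_restrictScalars',
    ContinuousLinearMap.toSpanSingleton_apply, smul_eq_mul, Dx, Dy]
  rw [mul_comm t g']
  conv_lhs => rw [show g' * t = (g' * t).re • (1 : ℂ) + (g' * t).im • Complex.I by
    rw [Complex.real_smul, Complex.real_smul, mul_one]; exact (Complex.re_add_im _).symm]
  rw [map_add, map_smul, map_smul, Complex.real_smul, Complex.real_smul]

theorem Dx_comp {F g : ℂ → ℂ} {w g' : ℂ} (hF : DifferentiableAt ℝ F (g w))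
    (hg : HasDerivAt g g' w) :
    Dx (fun w => F (g w)) w = g'.re * Dx F (g w) + g'.im * Dy F (g w) := by
  rw [Dx, fderiv_comp_holomorphic hF hg, mul_one]

theorem Dy_comp {F g : ℂ → ℂ} {w g' : ℂ} (hF : DifferentiableAt ℝ F (g w))
    (hg : HasDerivAt g g' w) :
    Dy (fun w => F (g w)) w = -g'.im * Dx F (g w) + g'.re * Dy F (g w) := by
  rw [Dy, fderiv_comp_holomorphic hF hg]
  simp

theorem analyticOnNhd_comp_holomorphic {F g g₁ : ℂ → ℂ} {U V : Set ℂ} (hU : IsOpen U)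
    (hF : AnalyticOnNhd ℝ F V) (hg : ∀ w ∈ U, HasDerivAt g (g₁ w) w) (hm : MapsTo g U V) :
    AnalyticOnNhd ℝ (fun w => F (g w)) U := by
  have h : AnalyticOnNhd ℂ g U :=
    DifferentiableOn.analyticOnNhd (fun w hw => (hg w hw).differentiableAt.differentiableWithinAt) hU
  exact fun w hw => AnalyticAt.comp (hF _ (hm hw)) ((h w hw).restrictScalars (𝕜 := ℝ))

theorem analyticOnNhd_re : AnalyticOnNhd ℝ (fun w : ℂ => (w.re : ℂ)) univ := fun w _ =>
  (Complex.ofRealCLM.comp Complex.reCLM).analyticAt w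

theorem analyticOnNhd_im : AnalyticOnNhd ℝ (fun w : ℂ => (w.im : ℂ)) univ := fun w _ =>
  (Complex.ofRealCLM.comp Complex.imCLM).analyticAt w

theorem fderiv_re (w : ℂ) : fderiv ℝ (fun w : ℂ => (w.re : ℂ)) w =
    Complex.ofRealCLM.comp Complex.reCLM :=
  (Complex.ofRealCLM.comp Complex.reCLM).fderiv

theorem fderiv_im (w : ℂ) : fderiv ℝ (fun w : ℂ => (w.im : ℂ)) w =
    Complex.ofRealCLM.comp Complex.imCLM :=
  (Complex.ofRealCLM.comp Complex.imCLM).fderiv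

theorem Dx_re_comp {g : ℂ → ℂ} {w g' : ℂ} (hg : HasDerivAt g g' w) :
    Dx (fun w => ((g w).re : ℂ)) w = g'.re := by
  rw [Dx_comp (F := fun w : ℂ => (w.re : ℂ)) (analyticOnNhd_re _ trivial).differentiableAt hg]
  simp [Dx, Dy, fderiv_re]

theorem Dy_re_comp {g : ℂ → ℂ} {w g' : ℂ} (hg : HasDerivAt g g' w) :
    Dy (fun w => ((g w).re : ℂ)) w = -g'.im := by
  rw [Dy_comp (F := fun w : ℂ => (w.re : ℂ)) (analyticOnNhd_re _ trivial).differentiableAt hg]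
  simp [Dx, Dy, fderiv_re]

theorem Dx_im_comp {g : ℂ → ℂ} {w g' : ℂ} (hg : HasDerivAt g g' w) :
    Dx (fun w => ((g w).im : ℂ)) w = g'.im := by
  rw [Dx_comp (F := fun w : ℂ => (w.im : ℂ)) (analyticOnNhd_im _ trivial).differentiableAt hg]
  simp [Dx, Dy, fderiv_im]

theorem Dy_im_comp {g : ℂ → ℂ} {w g' : ℂ} (hg : HasDerivAt g g' w) :
    Dy (fun w => ((g w).im : ℂ)) w = g'.re := by
  rw [Dy_comp (F := fun w : ℂ => (w.im : ℂ)) (analyticOnNhd_im _ trivial).differentiableAt hg]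
  simp [Dx, Dy, fderiv_im]

/-- Conformal change of variables in the Laplacian. -/
theorem laplacian_comp {F g g₁ g₂ : ℂ → ℂ} {U V : Set ℂ} (hU : IsOpen U)
    (hF : AnalyticOnNhd ℝ F V) (hg : ∀ w ∈ U, HasDerivAt g (g₁ w) w)
    (hg₁ : ∀ w ∈ U, HasDerivAt g₁ (g₂ w) w) (hm : MapsTo g U V) {w : ℂ} (hw : w ∈ U) :
    Dx (Dx fun w => F (g w)) w + Dy (Dy fun w => F (g w)) w =
      ((g₁ w).re ^ 2 + (g₁ w).im ^ 2) * (Dx (Dx F) (g w) + Dy (Dy F) (g w)) := by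
  have aX : AnalyticOnNhd ℝ (Dx F) V := fun z hz =>
    ((ContinuousLinearMap.apply ℝ ℂ (1 : ℂ)).analyticAt _).comp (hF.fderiv z hz)
  have aY : AnalyticOnNhd ℝ (Dy F) V := fun z hz =>
    ((ContinuousLinearMap.apply ℝ ℂ Complex.I).analyticAt _).comp (hF.fderiv z hz)
  have dX := (aX _ (hm hw)).differentiableAt
  have dY := (aY _ (hm hw)).differentiableAt
  have cX := (analyticOnNhd_comp_holomorphic hU aX hg hm w hw).differentiableAt
  have cY := (analyticOnNhd_comp_holomorphic hU aY hg hm w hw).differentiableAt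
  have dr := (analyticOnNhd_comp_holomorphic hU analyticOnNhd_re hg₁ (mapsTo_univ _ _) w
    hw).differentiableAt
  have di := (analyticOnNhd_comp_holomorphic hU analyticOnNhd_im hg₁ (mapsTo_univ _ _) w
    hw).differentiableAt
  have e1 : Dx (fun w => F (g w)) =ᶠ[𝓝 w]
      fun w => ((g₁ w).re : ℂ) * Dx F (g w) + ((g₁ w).im : ℂ) * Dy F (g w) := by
    filter_upwards [hU.mem_nhds hw] with z hz
    exact Dx_comp (hF _ (hm hz)).differentiableAt (hg z hz)
  have e2 : Dy (fun w => F (g w)) =ᶠ[𝓝 w]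
      fun w => (-1 : ℂ) * (((g₁ w).im : ℂ) * Dx F (g w)) + ((g₁ w).re : ℂ) * Dy F (g w) := by
    filter_upwards [hU.mem_nhds hw] with z hz
    rw [Dy_comp (hF _ (hm hz)).differentiableAt (hg z hz)]
    ring
  have dc : Dy (fun _ => (-1 : ℂ)) w = 0 := by simp [Dy]
  rw [Dx_congr e1, Dy_congr e2, Dx_add (dr.fun_mul cX) (di.fun_mul cY), Dx_mul dr cX, Dx_mul di cY,
    Dy_add ((differentiableAt_const _).fun_mul (di.fun_mul cX)) (dr.fun_mul cY), Dy_mul dr cY,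
    Dy_mul (differentiableAt_const _) (di.fun_mul cX), Dy_mul di cX, Dx_re_comp (hg₁ w hw),
    Dx_im_comp (hg₁ w hw), Dy_re_comp (hg₁ w hw), Dy_im_comp (hg₁ w hw), Dx_comp dX (hg w hw),
    Dx_comp dY (hg w hw), Dy_comp dX (hg w hw), Dy_comp dY (hg w hw), dc]
  ring

theorem laplacian_mul {F G : ℂ → ℂ} {U : Set ℂ} (hU : IsOpen U) (hF : AnalyticOnNhd ℝ F U)
    (hG : AnalyticOnNhd ℝ G U) {w : ℂ} (hw : w ∈ U) :
    Dx (Dx fun w => F w * G w) w + Dy (Dy fun w => F w * G w) w =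
      (Dx (Dx F) w + Dy (Dy F) w) * G w + 2 * (Dx F w * Dx G w + Dy F w * Dy G w) +
        F w * (Dx (Dx G) w + Dy (Dy G) w) := by
  have aX : ∀ {F : ℂ → ℂ}, AnalyticOnNhd ℝ F U → DifferentiableAt ℝ (Dx F) w := fun h =>
    (((ContinuousLinearMap.apply ℝ ℂ (1 : ℂ)).analyticAt _).comp (h.fderiv w hw)).differentiableAt
  have aY : ∀ {F : ℂ → ℂ}, AnalyticOnNhd ℝ F U → DifferentiableAt ℝ (Dy F) w := fun h =>
    (((ContinuousLinearMap.apply ℝ ℂ Complex.I).analyticAt _).comp (h.fderiv w hw)).differentiableAt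
  have d1 := (hF w hw).differentiableAt
  have d2 := (hG w hw).differentiableAt
  have e1 : Dx (fun w => F w * G w) =ᶠ[𝓝 w] fun w => Dx F w * G w + F w * Dx G w := by
    filter_upwards [hU.mem_nhds hw] with z hz
    exact Dx_mul (hF z hz).differentiableAt (hG z hz).differentiableAt
  have e2 : Dy (fun w => F w * G w) =ᶠ[𝓝 w] fun w => Dy F w * G w + F w * Dy G w := by
    filter_upwards [hU.mem_nhds hw] with z hz
    exact Dy_mul (hF z hz).differentiableAt (hG z hz).differentiableAt
  rw [Dx_congr e1, Dy_congr e2, Dx_add ((aX hF).fun_mul d2) (d1.fun_mul (aX hG)),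
    Dy_add ((aY hF).fun_mul d2) (d1.fun_mul (aY hG)), Dx_mul (aX hF) d2, Dx_mul d1 (aX hG),
    Dy_mul (aY hF) d2, Dy_mul d1 (aY hG)]
  ring

/-- `exp(-ik Im ζ)`. -/
def phase (k : ℝ) (ζ : ℂ) : ℂ := Complex.exp (-(Complex.I * k) * ζ.im)

theorem analyticOnNhd_phase (k : ℝ) : AnalyticOnNhd ℝ (phase k) univ := fun w _ => by
  have h2 : AnalyticAt ℂ (fun z : ℂ => Complex.exp (-(Complex.I * k) * z)) ((w.im : ℝ) : ℂ) := by
    fun_prop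
  exact AnalyticAt.comp (g := fun z : ℂ => Complex.exp (-(Complex.I * k) * z))
    (f := fun w : ℂ => (w.im : ℂ)) (h2.restrictScalars (𝕜 := ℝ)) (analyticOnNhd_im w trivial)

theorem fderiv_phase (k : ℝ) (w t : ℂ) :
    fderiv ℝ (phase k) w t = -(Complex.I * k) * t.im * phase k w := by
  have h1 := (Complex.ofRealCLM.comp Complex.imCLM).hasFDerivAt (x := w)
  have h2 := (h1.const_mul (-(Complex.I * k))).cexp
  have h3 : HasFDerivAt (phase k) _ w := h2
  rw [h3.fderiv]
  simp [phase]
  ring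

theorem Dx_phase (k : ℝ) : Dx (phase k) = fun _ => 0 := by
  funext w
  simp [Dx, fderiv_phase]

theorem Dy_phase (k : ℝ) (w : ℂ) : Dy (phase k) w = -(Complex.I * k) * phase k w := by
  simp [Dy, fderiv_phase]

/-- The factor `exp(-ik arg(cw + d))` is `phase k` composed with the holomorphic function `log(cw +
d)`, so `laplacian_comp` handles it and `arg` is never differentiated. -/
theorem laplacian_phase (k : ℝ) (w : ℂ) :
    Dx (Dx (phase k)) w + Dy (Dy (phase k)) w = -k ^ 2 * phase k w := by
  have e1 : Dy (phase k) = fun w => -(Complex.I * k) * phase k w := funext (Dy_phase k)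
  have d := (analyticOnNhd_phase k w trivial).differentiableAt
  rw [Dx_phase, e1, Dy_mul (differentiableAt_const _) d, Dy_phase]
  simp only [Dx, Dy, fderiv_fun_const, Pi.zero_apply, zero_apply]
  linear_combination (k : ℂ) ^ 2 * phase k w * Complex.I_sq

/-- The denominator `cw + d`. -/
def den (c d : ℝ) (w : ℂ) : ℂ := c * w + d

theorem den_ne_zero {c d : ℝ} (h : c ≠ 0 ∨ d ≠ 0) {w : ℂ} (hw : w ∈ upperHalfPlaneSet) :
    den c d w ≠ 0 := by
  intro h0
  have h1 := congrArg Complex.re h0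
  have h2 := congrArg Complex.im h0
  simp [den] at h1 h2
  have hw' : w.im ≠ 0 := (mem_U.1 hw).ne'
  have hc : c = 0 := by tauto
  rw [hc] at h1
  simp at h1
  tauto

theorem hasDerivAt_den (c d : ℝ) (w : ℂ) : HasDerivAt (den c d) c w := by
  simpa [den] using HasDerivAt.congr_deriv (f := den c d)
    (((hasDerivAt_id w).const_mul (c : ℂ)).add_const (d : ℂ)) (mul_one _)

/-- For `c ≠ 0` the denominator is not real. For `c = 0` it may lie on the branch cut, but then the
function is constant. -/
theorem hasDerivAt_log_den {c d : ℝ} (h : c ≠ 0 ∨ d ≠ 0) {w : ℂ} (hw : w ∈ upperHalfPlaneSet) :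
    HasDerivAt (fun w => Complex.log (den c d w)) (c / den c d w) w := by
  by_cases hc : c = 0
  · subst hc
    have : (fun w => Complex.log (den 0 d w)) = fun _ => Complex.log d := by
      funext w
      simp [den]
    rw [this]
    simpa using hasDerivAt_const w (Complex.log d)
  · refine (hasDerivAt_den c d w).clog (Complex.mem_slitPlane_iff.2 (Or.inr ?_))
    simp [den, hc, (mem_U.1 hw).ne']

/-- The action of a real matrix on the upper half-plane. -/
def moebius (a b c d : ℝ) (w : ℂ) : ℂ := (a * w + b) / den c d w

theorem hasDerivAt_moebius {a b c d : ℝ} (h : a * d - b * c = 1) {w : ℂ}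
    (hw : w ∈ upperHalfPlaneSet) :
    HasDerivAt (moebius a b c d) (1 / den c d w ^ 2) w := by
  have hne : den c d w ≠ 0 := den_ne_zero (by by_contra! hh; simp [hh.1, hh.2] at h) hw
  have h1 := (hasDerivAt_den a b w).div (hasDerivAt_den c d w) hne
  refine HasDerivAt.congr_deriv (f := moebius a b c d) h1 ?_
  have hC : (a : ℂ) * d - b * c = 1 := by exact_mod_cast h
  congr 1
  simp only [den]
  linear_combination hC

theorem im_moebius {a b c d : ℝ} (h : a * d - b * c = 1) (w : ℂ) :
    (moebius a b c d w).im = w.im / Complex.normSq (den c d w) := by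
  rw [moebius, Complex.div_im]
  simp only [den, Complex.add_re, Complex.mul_re, Complex.ofReal_re, Complex.ofReal_im,
    Complex.add_im, Complex.mul_im, zero_mul, sub_zero, add_zero]
  rw [← sub_div]
  congr 1
  linear_combination w.im * h

/-- `e^{-ik arg(cw+d)} F((aw+b)/(cw+d))`. -/
def slash (k a b c d : ℝ) (F : ℂ → ℂ) (w : ℂ) : ℂ :=
  phase k (Complex.log (den c d w)) * F (moebius a b c d w)

/-- The product rule and conformal invariance of the Laplacian reduce the claim to an identity in
the values of `F`, its first derivatives and its Laplacian at the image point. It holds modulo the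
single relation `s · |cw + d|² = 1`. -/
theorem IsEigen.slash {k lam a b c d : ℝ} {F : ℂ → ℂ} (hF : IsEigen k lam F)
    (h : a * d - b * c = 1) : IsEigen k lam (slash k a b c d F) := by
  have hcd : c ≠ 0 ∨ d ≠ 0 := by by_contra! hh; simp [hh.1, hh.2] at h
  have hne : ∀ w ∈ upperHalfPlaneSet, den c d w ≠ 0 := fun w hw => den_ne_zero hcd hw
  have hm : MapsTo (moebius a b c d) upperHalfPlaneSet upperHalfPlaneSet := fun w hw => by
    rw [mem_U, im_moebius h]
    exact div_pos hw (Complex.normSq_pos.2 (hne w hw))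
  have a1 := analyticOnNhd_comp_holomorphic isOpen_U (analyticOnNhd_phase k)
    (fun w hw => hasDerivAt_log_den hcd hw) (mapsTo_univ _ _)
  have a2 := analyticOnNhd_comp_holomorphic isOpen_U hF.analytic
    (fun w hw => hasDerivAt_moebius h hw) hm
  refine ⟨a1.mul a2, fun w hw => ?_⟩
  have hl2 : ∀ w ∈ upperHalfPlaneSet,
      HasDerivAt (fun w => (c : ℂ) / den c d w) (-c ^ 2 / den c d w ^ 2) w := fun w hw => by
    refine ((hasDerivAt_const w (c : ℂ)).div (hasDerivAt_den c d w) (hne w hw)).congr_deriv ?_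
    ring
  have hg2 : ∀ w ∈ upperHalfPlaneSet,
      HasDerivAt (fun w => (1 : ℂ) / den c d w ^ 2) (-2 * c / den c d w ^ 3) w := fun w hw => by
    refine ((hasDerivAt_const w (1 : ℂ)).div ((hasDerivAt_den c d w).pow 2)
      (pow_ne_zero 2 (hne w hw))).congr_deriv ?_
    have := hne w hw
    simp only [Pi.pow_apply]
    field_simp
    push_cast
    ring
  have l1 := laplacian_comp isOpen_U (analyticOnNhd_phase k)
    (fun w hw => hasDerivAt_log_den hcd hw) hl2 (mapsTo_univ _ _) hw
  have l2 := laplacian_comp isOpen_U hF.analytic (fun w hw => hasDerivAt_moebius h hw) hg2 hm hw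
  have dp := (analyticOnNhd_phase k (Complex.log (den c d w)) trivial).differentiableAt
  have dF := (hF.analytic _ (hm hw)).differentiableAt
  have x1 := Dx_comp (g := fun w => Complex.log (den c d w)) dp (hasDerivAt_log_den hcd hw)
  have y1 := Dy_comp (g := fun w => Complex.log (den c d w)) dp (hasDerivAt_log_den hcd hw)
  have x2 := Dx_comp dF (hasDerivAt_moebius h hw)
  have y2 := Dy_comp dF (hasDerivAt_moebius h hw)
  have eq := hF.eqn _ (hm hw)
  rw [laplacian_phase] at l1
  rw [Dx_phase, Dy_phase] at x1 y1
  simp only [mul_zero, zero_add] at x1 y1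
  rw [im_moebius h] at eq
  unfold MaassWaveform.slash
  rw [laplacian_mul isOpen_U a1 a2 hw, Dx_mul (a1 w hw).differentiableAt
    (a2 w hw).differentiableAt, l1, l2, x1, y1, x2, y2]
  have hJ := hne w hw
  have hr : Complex.normSq (den c d w) ≠ 0 := (Complex.normSq_pos.2 hJ).ne'
  have q1 : ((c : ℂ) / den c d w).re = c * (den c d w).re / Complex.normSq (den c d w) := by
    simp [Complex.div_re]
  have q2 : ((c : ℂ) / den c d w).im = -(c * (den c d w).im / Complex.normSq (den c d w)) := by
    simp [Complex.div_im]
  have q3 : ((1 : ℂ) / den c d w ^ 2).re =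
      ((den c d w).re ^ 2 - (den c d w).im ^ 2) / Complex.normSq (den c d w) ^ 2 := by
    rw [one_div, Complex.inv_re, map_pow, sq (den c d w), Complex.mul_re]
    ring
  have q4 : ((1 : ℂ) / den c d w ^ 2).im =
      -(2 * (den c d w).re * (den c d w).im) / Complex.normSq (den c d w) ^ 2 := by
    rw [one_div, Complex.inv_im, map_pow, sq (den c d w), Complex.mul_im]
    ring
  have hQ : (den c d w).im = c * w.im := by simp [den]
  have hn : Complex.normSq (den c d w) = (den c d w).re ^ 2 + (c * w.im) ^ 2 := by
    rw [Complex.normSq_apply, hQ]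
    ring
  rw [q1, q2, q3, q4, hQ]
  rw [hn] at hr eq ⊢
  generalize (den c d w).re = P at *
  generalize w.im = y at *
  generalize phase k (Complex.log (den c d w)) = φ at *
  generalize Dx (Dx F) (moebius a b c d w) + Dy (Dy F) (moebius a b c d w) = lap at *
  generalize Dx F (moebius a b c d w) = X at *
  generalize Dy F (moebius a b c d w) = Y at *
  generalize F (moebius a b c d w) = Z at *
  have hr' : (P : ℂ) ^ 2 + (c * y) ^ 2 ≠ 0 := by exact_mod_cast hr
  push_cast at eq ⊢
  simp only [div_eq_mul_inv, ← inv_pow] at eq ⊢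
  have hs := mul_inv_cancel₀ hr'
  generalize ((P : ℂ) ^ 2 + (c * y) ^ 2)⁻¹ = s at *
  linear_combination φ * eq - k ^ 2 * c ^ 2 * y ^ 2 * s * φ * Z * Complex.I_sq +
    (-k ^ 2 * φ * Z * c ^ 2 * y ^ 2 * s +
      φ * y ^ 2 * lap * s ^ 2 * (s * (P ^ 2 + (c * y) ^ 2) + 1) -
      Complex.I * k * φ * X * y * (2 * c ^ 2 * y ^ 2 * s ^ 2 + s) -
      2 * Complex.I * k * φ * Y * y ^ 2 * c * P * s ^ 2) * hs

/-! ### The slash operator of the modular group -/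

/-- `f` slashed by an element of the modular group, as a function on `ℂ`. -/
def slashSL (k : ℝ) (A : SL(2, ℤ)) (f : ℍ → ℂ) : ℂ → ℂ :=
  slash k (A 0 0) (A 0 1) (A 1 0) (A 1 1) fun w => f (ofComplex w)

theorem det_eq_one (A : SL(2, ℤ)) : A 0 0 * A 1 1 - A 0 1 * A 1 0 = 1 := by
  rw [← Matrix.det_fin_two, A.det_coe]

theorem det_real_eq_one (A : SL(2, ℤ)) :
    ((A 0 0 : ℤ) : ℝ) * (A 1 1 : ℤ) - (A 0 1 : ℤ) * (A 1 0 : ℤ) = 1 := by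
  exact_mod_cast det_eq_one A

theorem moebius_coe (A : SL(2, ℤ)) (z : ℍ) :
    moebius (A 0 0) (A 0 1) (A 1 0) (A 1 1) z = ((A • z : ℍ) : ℂ) := by
  rw [UpperHalfPlane.coe_specialLinearGroup_apply]
  simp [moebius, den]

theorem norm_phase (k : ℝ) (ζ : ℂ) : ‖phase k ζ‖ = 1 := by
  rw [phase, show -(Complex.I * k) * (ζ.im : ℂ) = ((-(k * ζ.im) : ℝ) : ℂ) * Complex.I by
    push_cast; ring]
  exact Complex.norm_exp_ofReal_mul_I _

theorem slashSL_coe (k : ℝ) (A : SL(2, ℤ)) (f : ℍ → ℂ) (z : ℍ) :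
    slashSL k A f z = phase k (Complex.log (den (A 1 0) (A 1 1) z)) * f (A • z) := by
  rw [slashSL, slash, moebius_coe, ofComplex_apply]

theorem norm_slashSL (k : ℝ) (A : SL(2, ℤ)) (f : ℍ → ℂ) (z : ℍ) :
    ‖slashSL k A f z‖ = ‖f (A • z)‖ := by
  rw [slashSL_coe, norm_mul, norm_phase, one_mul]

theorem autFactor_eq_phase (k : ℝ) (A : SL(2, ℤ)) (z : ℍ) :
    autFactor k A z = phase (-k) (Complex.log (den (A 1 0) (A 1 1) z)) := by
  rw [autFactor, phase, Complex.log_im]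
  simp [den]

theorem norm_autFactor (k : ℝ) (A : SL(2, ℤ)) (z : ℍ) : ‖autFactor k A z‖ = 1 := by
  rw [autFactor_eq_phase, norm_phase]

/-- `T^N` lies in `Γ(N)`, which is normal in `SL(2, ℤ)` and contained in `Γ₀(N)`. Hence translation
by `N` is a quasi-period at every cusp. -/
theorem conj_T_zpow_mem_Gamma0 (N : ℕ) (A : SL(2, ℤ)) :
    A * ModularGroup.T ^ (N : ℤ) * A⁻¹ ∈ CongruenceSubgroup.Gamma0 N := by
  have h1 := (CongruenceSubgroup.Gamma_normal N).conj_mem _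
    (CongruenceSubgroup.ModularGroup_T_pow_mem_Gamma N N dvd_rfl) A
  exact CongruenceSubgroup.Gamma0_mem.2 (CongruenceSubgroup.Gamma_mem.1 h1).2.2.1

theorem isPreconnected_U : IsPreconnected upperHalfPlaneSet :=
  (convex_halfSpace_im_gt 0).isPreconnected

/-- Exponentiating gives the cocycle relation for `cz + d`, so the left side takes values in `2πiℤ`.
It is continuous on a connected set with countable image, hence constant. For real weight this
constancy is needed to have a multiplier independent of `z`. -/
theorem exists_log_den_eq (N : ℕ) (A : SL(2, ℤ)) : ∃ n : ℤ, ∀ z : ℍ,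
    Complex.log (den ((A * ModularGroup.T ^ (N : ℤ) * A⁻¹) 1 0)
      ((A * ModularGroup.T ^ (N : ℤ) * A⁻¹) 1 1) (A • z : ℍ)) +
      Complex.log (den (A 1 0) (A 1 1) z) - Complex.log (den (A 1 0) (A 1 1) (z + N)) =
      n * (2 * Real.pi * Complex.I) := by
  set B := A * ModularGroup.T ^ (N : ℤ) * A⁻¹ with hB
  have hcd : ∀ A : SL(2, ℤ), ((A 1 0 : ℤ) : ℝ) ≠ 0 ∨ ((A 1 1 : ℤ) : ℝ) ≠ 0 := fun A => by
    by_contra! hh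
    have := det_real_eq_one A
    rw [hh.1, hh.2] at this
    simp at this
  have hBA : B * A = A * ModularGroup.T ^ (N : ℤ) := by simp [hB]
  set E : ℂ → ℂ := fun w => Complex.log (den (B 1 0) (B 1 1)
      (moebius (A 0 0) (A 0 1) (A 1 0) (A 1 1) w)) +
      Complex.log (den (A 1 0) (A 1 1) w) - Complex.log (den (A 1 0) (A 1 1) (w + N)) with hE
  have hm : MapsTo (moebius (A 0 0) (A 0 1) (A 1 0) (A 1 1)) upperHalfPlaneSet
      upperHalfPlaneSet := fun w hw => by
    have := moebius_coe A ⟨w, hw⟩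
    rw [this]
    exact (A • (⟨w, hw⟩ : ℍ)).2
  have hs : ∀ w ∈ upperHalfPlaneSet, w + N ∈ upperHalfPlaneSet := fun w hw => by
    simpa [mem_U] using hw
  have hc : ContinuousOn E upperHalfPlaneSet := fun w hw => by
    have h1 := (hasDerivAt_log_den (hcd B) (hm hw)).continuousAt
    have h2 := (hasDerivAt_log_den (hcd A) hw).continuousAt
    have h3 := (hasDerivAt_log_den (hcd A) (hs w hw)).continuousAt
    have h4 := (hasDerivAt_moebius (det_real_eq_one A) hw).continuousAt
    refine ContinuousAt.continuousWithinAt (((ContinuousAt.comp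
      (g := fun w => Complex.log (den (B 1 0) (B 1 1) w)) h1 h4).add h2).sub ?_)
    exact ContinuousAt.comp (g := fun w => Complex.log (den (A 1 0) (A 1 1) w))
      (f := fun w => w + (N : ℂ)) h3 (by fun_prop)
  have hexp : ∀ w ∈ upperHalfPlaneSet, ∃ n : ℤ, E w = n * (2 * Real.pi * Complex.I) := by
    intro w hw
    have n1 := den_ne_zero (hcd B) (hm hw)
    have n2 := den_ne_zero (hcd A) hw
    have n3 := den_ne_zero (hcd A) (hs w hw)
    rw [← Complex.exp_eq_one_iff, hE]
    beta_reduce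
    rw [Complex.exp_sub, Complex.exp_add, Complex.exp_log n1, Complex.exp_log n2,
      Complex.exp_log n3, div_eq_one_iff_eq n3]
    have e0 := congrArg (fun M : SL(2, ℤ) => M 1 0) hBA
    have e1 := congrArg (fun M : SL(2, ℤ) => M 1 1) hBA
    simp only [Matrix.SpecialLinearGroup.coe_mul, Matrix.mul_apply, ModularGroup.coe_T_zpow,
      Fin.sum_univ_two] at e0 e1
    simp at e0 e1
    have e0' : ((B 1 0 : ℤ) : ℂ) * (A 0 0 : ℤ) + (B 1 1 : ℤ) * (A 1 0 : ℤ) = (A 1 0 : ℤ) := by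
      exact_mod_cast e0
    have e1' : ((B 1 0 : ℤ) : ℂ) * (A 0 1 : ℤ) + (B 1 1 : ℤ) * (A 1 1 : ℤ) =
      (A 1 0 : ℤ) * N + (A 1 1 : ℤ) := by exact_mod_cast e1
    have hmd : moebius (A 0 0) (A 0 1) (A 1 0) (A 1 1) w * den (A 1 0) (A 1 1) w =
        (A 0 0 : ℤ) * w + (A 0 1 : ℤ) := by
      rw [moebius, div_mul_cancel₀ _ n2]
      simp
    generalize moebius (A 0 0) (A 0 1) (A 1 0) (A 1 1) w = M at *
    simp only [den, Complex.ofReal_intCast] at *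
    linear_combination (B 1 0 : ℂ) * hmd + w * e0' + e1'
  have hconst : ∀ w ∈ upperHalfPlaneSet, E w = E Complex.I := by
    have hcount : (range fun n : ℤ => (n : ℂ) * (2 * Real.pi * Complex.I)).Countable :=
      countable_range _
    have hsub : E '' upperHalfPlaneSet ⊆ range fun n : ℤ => (n : ℂ) * (2 * Real.pi * Complex.I) := by
      rintro _ ⟨w, hw, rfl⟩
      obtain ⟨n, hn⟩ := hexp w hw
      exact ⟨n, hn.symm⟩
    exact fun w hw => hcount.isTotallyDisconnected _ hsub (isPreconnected_U.image E hc)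
      ⟨w, hw, rfl⟩ ⟨Complex.I, by simp, rfl⟩
  obtain ⟨n, hn⟩ := hexp Complex.I (by simp)
  refine ⟨n, fun z => ?_⟩
  rw [← hn, ← hconst z z.2, hE]
  beta_reduce
  rw [moebius_coe]

theorem exists_e_eq {c : ℂ} (hc : ‖c‖ = 1) : ∃ β : ℝ, e β = c := by
  refine ⟨Complex.arg c / (2 * Real.pi), ?_⟩
  have := Complex.norm_mul_exp_arg_mul_I c
  rw [hc] at this
  conv_rhs => rw [← this]
  rw [e]
  have hpi : (Real.pi : ℂ) ≠ 0 := by exact_mod_cast Real.pi_ne_zero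
  push_cast
  rw [one_mul]
  congr 1
  field_simp

/-- Translation by `N` corresponds to `B = A T^N A⁻¹`; the multiplier is `v(B)` times the branch
correction from `exists_log_den_eq`. The number `β` depends on `A` but not on `f`, which keeps later
constants uniform. -/
theorem exists_quasiPeriod (k : ℝ) {N : ℕ} {v : SL(2, ℤ) → ℂ}
    (hv : ∀ A ∈ CongruenceSubgroup.Gamma0 N, ‖v A‖ = 1) (A : SL(2, ℤ)) :
    ∃ β : ℝ, ∀ f : ℍ → ℂ, (∀ A ∈ CongruenceSubgroup.Gamma0 N, ∀ z : ℍ,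
      f (A • z) = v A * autFactor k A z * f z) → ∀ w ∈ upperHalfPlaneSet,
      slashSL k A f (w + (N : ℝ)) = e β * slashSL k A f w := by
  obtain ⟨n, hn⟩ := exists_log_den_eq N A
  set B := A * ModularGroup.T ^ (N : ℤ) * A⁻¹ with hB
  have hBmem : B ∈ CongruenceSubgroup.Gamma0 N := conj_T_zpow_mem_Gamma0 N A
  obtain ⟨β, hβ⟩ := exists_e_eq (c := v B * Complex.exp (Complex.I * k * (n * (2 * Real.pi))))
    (by
      rw [norm_mul, hv B hBmem, one_mul, show Complex.I * k * (n * (2 * Real.pi)) =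
        ((k * (n * (2 * Real.pi)) : ℝ) : ℂ) * Complex.I by push_cast; ring]
      exact Complex.norm_exp_ofReal_mul_I _)
  refine ⟨β, fun f hf w hw => ?_⟩
  have h1 : (w + (N : ℝ) : ℂ) = ((ModularGroup.T ^ (N : ℤ) • (⟨w, hw⟩ : ℍ) : ℍ) : ℂ) := by
    rw [ModularGroup.coe_T_zpow_smul_eq]
    simp
  have h2 : A • ModularGroup.T ^ (N : ℤ) • (⟨w, hw⟩ : ℍ) = B • A • (⟨w, hw⟩ : ℍ) := by
    simp [hB, smul_smul]
  have h3 := slashSL_coe k A f (ModularGroup.T ^ (N : ℤ) • (⟨w, hw⟩ : ℍ))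
  have h4 := slashSL_coe k A f ⟨w, hw⟩
  have h5 := congrArg Complex.im (hn ⟨w, hw⟩)
  rw [← h1, h2, hf B hBmem, autFactor_eq_phase] at h3
  rw [hβ, h3, h4]
  simp only [Complex.sub_im, Complex.add_im] at h5
  rw [show ((n : ℂ) * (2 * Real.pi * Complex.I)).im = n * (2 * Real.pi) by
    simp] at h5
  have h6 : (Complex.log (den (A 1 0) (A 1 1) (w + (N : ℝ)))).im =
      (Complex.log (den (B 1 0) (B 1 1) (A • (⟨w, hw⟩ : ℍ) : ℍ))).im +
      (Complex.log (den (A 1 0) (A 1 1) w)).im - n * (2 * Real.pi) := by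
    have : (w + (N : ℝ) : ℂ) = w + N := by simp
    rw [this]
    linarith
  unfold phase
  rw [h6]
  have key : Complex.exp (-(Complex.I * k) * (((Complex.log (den (B 1 0) (B 1 1)
      (A • (⟨w, hw⟩ : ℍ) : ℍ))).im + (Complex.log (den (A 1 0) (A 1 1) w)).im -
      n * (2 * Real.pi) : ℝ) : ℂ)) * Complex.exp (-(Complex.I * (-k : ℝ)) *
      ((Complex.log (den (B 1 0) (B 1 1) (A • (⟨w, hw⟩ : ℍ) : ℍ))).im : ℂ)) =
      Complex.exp (Complex.I * k * (n * (2 * Real.pi))) *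
      Complex.exp (-(Complex.I * k) * ((Complex.log (den (A 1 0) (A 1 1) w)).im : ℂ)) := by
    rw [← Complex.exp_add, ← Complex.exp_add]
    congr 1
    push_cast
    ring
  linear_combination v B * f (A • ⟨w, hw⟩) * key

/-! ### Symmetry of the multiplier systems -/

theorem sawtooth_neg (x : ℝ) : sawtooth (-x) = -sawtooth x := by
  unfold sawtooth
  by_cases h : Int.fract x = 0
  · rw [if_pos h, if_pos (Int.fract_neg_eq_zero.2 h), neg_zero]
  · rw [if_neg h, if_neg (fun h' => h (Int.fract_neg_eq_zero.1 h')), Int.fract_neg h]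
    ring

theorem dedekindSum_neg (d c : ℤ) : dedekindSum (-d) c = -dedekindSum d c := by
  unfold dedekindSum
  rw [← Finset.sum_neg_distrib]
  refine Finset.sum_congr rfl fun n _ => ?_
  rw [Int.cast_neg, neg_mul, neg_div, sawtooth_neg, mul_neg]

/-- Conjugation of `A` by the reflection `z ↦ -z̄`. -/
def reflect (A : SL(2, ℤ)) : SL(2, ℤ) :=
  ⟨!![A 0 0, -A 0 1; -A 1 0, A 1 1], by
    rw [Matrix.det_fin_two_of]
    linear_combination det_eq_one A⟩

theorem reflect_mem_Gamma0 {N : ℕ} {A : SL(2, ℤ)} (hA : A ∈ CongruenceSubgroup.Gamma0 N) :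
    reflect A ∈ CongruenceSubgroup.Gamma0 N := by
  rw [CongruenceSubgroup.Gamma0_mem] at hA ⊢
  simp [reflect, hA]

theorem norm_etaMultiplier (k : ℝ) (A : SL(2, ℤ)) : ‖etaMultiplier k A‖ = 1 := by
  simp only [etaMultiplier]
  split_ifs <;> simp [norm_e]

theorem odd_of_mem_Gamma0 {N : ℕ} (hN : 4 ∣ N) {A : SL(2, ℤ)}
    (hA : A ∈ CongruenceSubgroup.Gamma0 N) : (A 1 1) % 2 = 1 := by
  have h1 : (N : ℤ) ∣ A 1 0 := (ZMod.intCast_zmod_eq_zero_iff_dvd _ _).1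
    (CongruenceSubgroup.Gamma0_mem.1 hA)
  have h2 : (4 : ℤ) ∣ A 1 0 := dvd_trans (by exact_mod_cast hN) h1
  obtain ⟨t, ht⟩ := h2
  have h3 := det_eq_one A
  rw [ht] at h3
  rcases Int.emod_two_eq_zero_or_one (A 1 1) with h | h
  · exfalso
    obtain ⟨s, hs⟩ := Int.dvd_of_emod_eq_zero h
    rw [hs] at h3
    have : 2 * (A 0 0 * s - A 0 1 * (2 * t)) = 1 := by linear_combination h3
    omega
  · exact h

theorem gcd_lower_row (A : SL(2, ℤ)) : (A 1 0).gcd (A 1 1) = 1 :=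
  Int.isCoprime_iff_gcd_eq_one.1 ⟨-A 0 1, A 0 0, by linear_combination det_eq_one A⟩

theorem norm_thetaMultiplier (A : SL(2, ℤ)) : ‖thetaMultiplier A‖ = 1 := by
  have h1 : ‖epsilonFactor (A 1 1)‖ = 1 := by
    unfold epsilonFactor
    split_ifs <;> simp
  have hg := gcd_lower_row A
  have hJ : jacobiSym (A 1 0) (A 1 1).natAbs = 1 ∨ jacobiSym (A 1 0) (A 1 1).natAbs = -1 :=
    jacobiSym.eq_one_or_neg_one (by simpa only [Int.gcd, Int.natAbs_natCast] using hg)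
  have h2 : extSymbol (A 1 0) (A 1 1) = 1 ∨ extSymbol (A 1 0) (A 1 1) = -1 := by
    unfold extSymbol
    split_ifs with hc hd hd
    · exact Or.inl rfl
    · rw [hc, Int.gcd_zero_left] at hg
      omega
    · exact hJ
    · rcases lt_or_gt_of_ne hc with h | h
      · rw [Int.sign_eq_neg_one_of_neg h]
        rcases hJ with h | h <;> simp [h]
      · rw [Int.sign_eq_one_of_pos h]
        rcases hJ with h | h <;> simp [h]
  rw [thetaMultiplier, norm_mul, RCLike.norm_conj, h1, one_mul]
  rcases h2 with h | h <;> simp [h]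

/-- Reflection sends `(a, b, c, d)` to `(a, -b, -c, d)` and so exchanges the branches `c > 0` and `c
< 0`. The Dedekind sum is odd in `d`, and the extra `e(k/2)` compensates the constant `-3c/(12c) =
-1/4`. For `c = 0`, `d < 0` the factor `e(-k/2)` would be conjugated with nothing to compensate it.
-/
theorem conj_etaMultiplier_reflect (k : ℝ) {A : SL(2, ℤ)} (hA : A 1 0 ≠ 0 ∨ 0 < A 1 1) :
    (starRingEnd ℂ) (etaMultiplier k (reflect A)) = etaMultiplier k A := by
  simp only [etaMultiplier, reflect, Matrix.SpecialLinearGroup.coe_mk, Matrix.of_apply,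
    Matrix.cons_val', Matrix.cons_val_zero, Matrix.cons_val_one, Matrix.cons_val_fin_one]
  generalize A 0 0 = a at *
  generalize A 0 1 = b at *
  generalize A 1 0 = c at *
  generalize A 1 1 = d at *
  rcases lt_trichotomy c 0 with h | h | h
  · have hc : (c : ℝ) ≠ 0 := by exact_mod_cast h.ne
    rw [if_pos (by omega), if_neg (by omega), if_pos h, conj_e, ← e_add, dedekindSum_neg]
    congr 1
    push_cast
    field_simp
    ring
  · subst h
    have hd : 0 < d := by tauto
    rw [if_neg (by omega), if_neg (by omega), if_pos hd, if_neg (by omega), if_neg (by omega),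
      if_pos hd, conj_e]
    congr 1
    push_cast
    ring
  · have hc : (c : ℝ) ≠ 0 := by exact_mod_cast h.ne'
    rw [if_neg (by omega), if_pos (by omega), if_pos h, ← e_add, conj_e, dedekindSum_neg, neg_neg]
    congr 1
    push_cast
    field_simp
    ring

/-- Conjugation changes `conj ε_d` to `ε_d`, a factor `±1` according to `d` modulo `4`, while
replacing `c` by `-c` multiplies the Jacobi symbol by `χ₄(|d|)`. For `d < 0` the sign `sgn(-c) =
-sgn(c)` corrects `χ₄(|d|)` to `χ₄(d)`. -/
theorem conj_thetaMultiplier_reflect {N : ℕ} (hN : 4 ∣ N) {A : SL(2, ℤ)}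
    (hm : A ∈ CongruenceSubgroup.Gamma0 N) (hA : A 1 0 ≠ 0 ∨ 0 < A 1 1) :
    (starRingEnd ℂ) (thetaMultiplier (reflect A)) = thetaMultiplier A := by
  have hodd := odd_of_mem_Gamma0 hN hm
  have hg := gcd_lower_row A
  simp only [thetaMultiplier, reflect, Matrix.SpecialLinearGroup.coe_mk, Matrix.of_apply,
    Matrix.cons_val', Matrix.cons_val_zero, Matrix.cons_val_one, Matrix.cons_val_fin_one]
  generalize A 1 0 = c at *
  generalize A 1 1 = d at *
  rw [map_mul, Complex.conj_conj, map_intCast]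
  by_cases hc : c = 0
  · subst hc
    rw [Int.gcd_zero_left] at hg
    have : d = 1 := by omega
    subst this
    simp [extSymbol, epsilonFactor]
  · have hJ : jacobiSym (-c) d.natAbs = ZMod.χ₄ d.natAbs * jacobiSym c d.natAbs :=
      jacobiSym.neg c (Nat.odd_iff.2 (by omega))
    unfold extSymbol
    rw [if_neg (by omega), if_neg hc, hJ, Int.sign_neg]
    rcases (by omega : d % 4 = 1 ∨ d % 4 = 3) with h4 | h4
    · rw [epsilonFactor, if_pos h4]
      by_cases hd : 0 < d
      · rw [ZMod.χ₄_nat_one_mod_four (by omega)]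
        simp [hd]
      · rw [ZMod.χ₄_nat_three_mod_four (by omega)]
        simp [hd]
    · rw [epsilonFactor, if_neg (by omega)]
      by_cases hd : 0 < d
      · rw [ZMod.χ₄_nat_three_mod_four (by omega)]
        simp [hd]
      · rw [ZMod.χ₄_nat_one_mod_four (by omega)]
        simp [hd]

/-- The properties of the multiplier systems used for the reality of the Fourier coefficients. -/
structure IsSymmetric (N : ℕ) (v : SL(2, ℤ) → ℂ) : Prop where
  norm_eq : ∀ A ∈ CongruenceSubgroup.Gamma0 N, ‖v A‖ = 1
  conj_reflect : ∀ A ∈ CongruenceSubgroup.Gamma0 N, A 1 0 ≠ 0 ∨ 0 < A 1 1 →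
    (starRingEnd ℂ) (v (reflect A)) = v A

theorem isSymmetric_etaMultiplier (N : ℕ) (k : ℝ) : IsSymmetric N (etaMultiplier k) :=
  ⟨fun A _ => norm_etaMultiplier k A, fun _ _ h => conj_etaMultiplier_reflect k h⟩

theorem isSymmetric_thetaMultiplier {N : ℕ} (hN : 4 ∣ N) : IsSymmetric N thetaMultiplier :=
  ⟨fun A _ => norm_thetaMultiplier A, fun _ hm h => conj_thetaMultiplier_reflect hN hm h⟩

/-! ### Hyperbolic area -/

theorem lintegral_strip {G : ℂ → ℝ≥0∞} (hG : AEMeasurable G (volume.restrict upperHalfPlaneSet))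
    {X S : Set ℝ} (hX : MeasurableSet X) (hS : MeasurableSet S) (hS0 : S ⊆ Ioi 0) :
    ∫⁻ z : ℍ in {z | z.re ∈ X ∧ z.im ∈ S}, G z =
      ∫⁻ y in S, ∫⁻ x in X, ENNReal.ofReal (1 / y ^ 2) * G (x + y * Complex.I) := by
  have hA : MeasurableSet {z : ℍ | z.re ∈ X ∧ z.im ∈ S} :=
    (UpperHalfPlane.continuous_re.measurable hX).inter (UpperHalfPlane.continuous_im.measurable hS)
  have hmp : MeasurePreserving UpperHalfPlane.coe (volume.comap UpperHalfPlane.coe)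
      (volume.restrict (range UpperHalfPlane.coe)) :=
    ⟨measurable_coe, by rw [measurableEmbedding_coe.map_comap]⟩
  have hd : Measurable fun z : ℍ => ((((1 / NNReal.mk z.im z.im_pos.le) ^ 2 : NNReal)) : ℝ≥0∞) := by
    have : Measurable fun z : ℍ => NNReal.mk z.im z.im_pos.le :=
      UpperHalfPlane.continuous_im.measurable.subtype_mk
    fun_prop
  set H : ℂ → ℝ≥0∞ := fun w => ENNReal.ofReal (1 / w.im ^ 2) * G w with hH
  have hHm : AEMeasurable H (volume.restrict upperHalfPlaneSet) :=
    (by fun_prop : Measurable fun w : ℂ => ENNReal.ofReal (1 / w.im ^ 2)).aemeasurable.mul hG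
  have e1 : ∀ z : ℍ, ((fun z : ℍ => ((((1 / NNReal.mk z.im z.im_pos.le) ^ 2 : NNReal)) : ℝ≥0∞)) *
      fun z : ℍ => G z) z = H z := fun z => by
    simp only [hH, Pi.mul_apply]
    congr 1
    rw [← ENNReal.ofReal_coe_nnreal]
    congr 1
    push_cast
    rw [one_div, inv_pow, one_div]
    rfl
  have e2 : UpperHalfPlane.coe '' {z : ℍ | z.re ∈ X ∧ z.im ∈ S} =
      Complex.measurableEquivRealProd.symm '' (X ×ˢ S) := by
    ext w
    constructor
    · rintro ⟨z, hz, rfl⟩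
      exact ⟨(z.re, z.im), hz, rfl⟩
    · rintro ⟨p, hp, rfl⟩
      exact ⟨⟨Complex.measurableEquivRealProd.symm p, hS0 hp.2⟩, hp, rfl⟩
  have hsub : Complex.measurableEquivRealProd.symm '' (X ×ˢ S) ⊆ upperHalfPlaneSet := by
    rintro _ ⟨p, hp, rfl⟩
    exact hS0 hp.2
  have hemb := Complex.measurableEquivRealProd.symm.measurableEmbedding
  have hpres := Complex.volume_preserving_equiv_real_prod.symm
  rw [volume_def, setLIntegral_withDensity_eq_setLIntegral_mul_non_measurable _ hd _ hA
    (Eventually.of_forall fun z => ENNReal.coe_lt_top)]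
  simp_rw [e1]
  rw [hmp.setLIntegral_comp_emb measurableEmbedding_coe,
    Measure.restrict_restrict_of_subset (image_subset_range _ _), e2,
    ← hpres.setLIntegral_comp_emb hemb, Measure.volume_eq_prod, setLIntegral_prod_symm]
  · refine setLIntegral_congr_fun hS fun y _ => lintegral_congr fun x => ?_
    have : Complex.measurableEquivRealProd.symm (x, y) = x + y * Complex.I :=
      Complex.mk_eq_add_mul_I x y
    rw [this, hH]
    simp
  · rw [← Measure.volume_eq_prod]
    have h3 := (hpres.restrict_image_emb hemb (X ×ˢ S))
    exact (hHm.mono_measure (Measure.restrict_mono hsub le_rfl)).comp_quasiMeasurePreserving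
      h3.quasiMeasurePreserving

theorem measurePreserving_smul_SL (A : SL(2, ℤ)) :
    MeasurePreserving (fun z : ℍ => A • z) volume volume :=
  measurePreserving_smul ((Matrix.SpecialLinearGroup.mapGL ℝ A : GL (Fin 2) ℝ)) volume

theorem measurableEmbedding_smul_SL (A : SL(2, ℤ)) : MeasurableEmbedding fun z : ℍ => A • z :=
  measurableEmbedding_const_smul ((Matrix.SpecialLinearGroup.mapGL ℝ A : GL (Fin 2) ℝ))

theorem volume_fd_lt_top : volume ModularGroup.fd < ∞ := by
  have hsub : ModularGroup.fd ⊆ {z : ℍ | z.re ∈ Icc (-1 / 2) (1 / 2) ∧ z.im ∈ Ioi (1 / 2)} := by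
    intro z hz
    have h1 := ModularGroup.three_le_four_mul_im_sq_of_mem_fd hz
    have h2 := abs_le.1 hz.2
    refine ⟨⟨by linarith [h2.1], h2.2⟩, ?_⟩
    have := z.im_pos
    change 1 / 2 < z.im
    nlinarith
  refine (measure_mono hsub).trans_lt ?_
  have h := lintegral_strip (G := fun _ => 1) aemeasurable_const
    (measurableSet_Icc (a := (-1 / 2 : ℝ)) (b := 1 / 2)) (measurableSet_Ioi (a := (1 / 2 : ℝ)))
    (Ioi_subset_Ioi (by norm_num))
  rw [setLIntegral_one] at h
  rw [h]
  simp only [mul_one, lintegral_const, Measure.restrict_apply MeasurableSet.univ, univ_inter,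
    Real.volume_Icc]
  rw [lintegral_mul_const _ (by fun_prop)]
  refine ENNReal.mul_lt_top ?_ ENNReal.ofReal_lt_top
  have hi : IntegrableOn (fun y : ℝ => y ^ (-2 : ℝ)) (Ioi (1 / 2)) :=
    integrableOn_Ioi_rpow_of_lt (by norm_num) (by norm_num)
  have := hi.lintegral_lt_top
  refine lt_of_eq_of_lt (setLIntegral_congr_fun measurableSet_Ioi fun y hy => ?_) this
  have hy' : (0 : ℝ) < y := lt_trans (by norm_num) hy
  rw [Real.rpow_neg hy'.le, Real.rpow_two, one_div]

theorem volume_fd_diff_fdo : volume (ModularGroup.fd \ ModularGroup.fdo) = 0 := by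
  rw [volume_def]
  refine withDensity_absolutelyContinuous _ _ ?_
  rw [measurableEmbedding_coe.comap_apply]
  have hre : ∀ a : ℝ, volume {w : ℂ | w.re = a} = 0 := fun a => by
    have h := Complex.volume_preserving_equiv_real_prod.measure_preimage_emb
      Complex.measurableEquivRealProd.measurableEmbedding ({a} ×ˢ univ)
    rw [Measure.volume_eq_prod, Measure.prod_prod] at h
    simp only [measure_singleton, zero_mul] at h
    refine (congrArg volume ?_).trans h
    ext w
    simp [Complex.measurableEquivRealProd_apply]
  have hs : volume (Metric.sphere (0 : ℂ) 1) = 0 := Measure.addHaar_sphere volume 0 1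
  refine measure_mono_null ?_ (measure_union_null (measure_union_null (hre (1 / 2))
    (hre (-1 / 2))) hs)
  rintro _ ⟨z, ⟨⟨h1, h2⟩, h3⟩, rfl⟩
  by_contra hcon
  simp only [mem_union, mem_ofPred_eq, not_or, mem_sphere_iff_norm, sub_zero] at hcon
  refine h3 ⟨lt_of_le_of_ne h1 fun h => hcon.2 ?_, lt_of_le_of_ne h2 fun h => ?_⟩
  · have : ‖(z : ℂ)‖ ^ 2 = 1 := by rw [← Complex.normSq_eq_norm_sq, ← h]
    exact (pow_eq_one_iff_of_nonneg (norm_nonneg _) two_ne_zero).1 this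
  · rcases abs_eq (by norm_num : (0 : ℝ) ≤ 1 / 2) |>.1 h with h | h
    · exact hcon.1.1 h
    · exact hcon.1.2 (by rw [neg_div]; exact h)

/-! ### A fundamental domain of a subgroup of finite index -/

/-- The union of the translates of the standard fundamental domain of the modular group by
representatives of the cosets of `Γ`. -/
def cosetDomain (Γ : Subgroup SL(2, ℤ)) : Set ℍ :=
  ⋃ q : SL(2, ℤ) ⧸ Γ, (fun z : ℍ => q.out • z) ⁻¹' ModularGroup.fd

theorem measurableSet_cosetDomain (Γ : Subgroup SL(2, ℤ)) [Γ.FiniteIndex] :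
    MeasurableSet (cosetDomain Γ) :=
  MeasurableSet.iUnion fun q =>
    (measurePreserving_smul_SL q.out).measurable ModularGroup.isClosed_fd.measurableSet

theorem volume_cosetDomain_lt_top (Γ : Subgroup SL(2, ℤ)) [Γ.FiniteIndex] :
    volume (cosetDomain Γ) < ∞ := by
  have : Fintype (SL(2, ℤ) ⧸ Γ) := Γ.fintypeQuotientOfFiniteIndex
  refine (measure_iUnion_fintype_le _ _).trans_lt (ENNReal.sum_lt_top.2 fun q _ => ?_)
  rw [(measurePreserving_smul_SL q.out).measure_preimage_emb (measurableEmbedding_smul_SL _)]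
  exact volume_fd_lt_top

/-- The transformations of the upper half-plane induced by `Γ`. -/
abbrev transformations (Γ : Subgroup SL(2, ℤ)) : Subgroup (Equiv.Perm ℍ) :=
  Γ.map (MulAction.toPermHom SL(2, ℤ) ℍ)

theorem transformations_smul {Γ : Subgroup SL(2, ℤ)} (g : transformations Γ) :
    ∃ A ∈ Γ, ∀ z : ℍ, g • z = A • z := by
  obtain ⟨_, A, hA, rfl⟩ := g
  exact ⟨A, hA, fun z => rfl⟩

theorem measurePreserving_transformations {Γ : Subgroup SL(2, ℤ)} (g : transformations Γ) :
    MeasurePreserving (fun z : ℍ => g • z) volume volume := by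
  obtain ⟨A, _, h⟩ := transformations_smul g
  simp_rw [h]
  exact measurePreserving_smul_SL A

instance (Γ : Subgroup SL(2, ℤ)) : Countable (transformations Γ) := by
  have : Countable (Matrix (Fin 2) (Fin 2) ℤ) := inferInstanceAs (Countable (Fin 2 → Fin 2 → ℤ))
  have : Countable SL(2, ℤ) := Subtype.countable
  exact Set.Countable.to_subtype ((Set.to_countable (Γ : Set SL(2, ℤ))).image _)

instance (Γ : Subgroup SL(2, ℤ)) : MeasurableConstSMul (transformations Γ) ℍ :=
  ⟨fun g => (measurePreserving_transformations g).measurable⟩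

instance (Γ : Subgroup SL(2, ℤ)) : SMulInvariantMeasure (transformations Γ) ℍ volume :=
  ⟨fun g _ hs => (measurePreserving_transformations g).measure_preimage hs.nullMeasurableSet⟩

/-- The quotient consists of the cosets `gΓ`, so it is the inverses of the representatives that
represent `Γ \ SL(2, ℤ)`. This is why `cosetDomain` uses preimages under `q.out`. -/
theorem exists_mul_out (Γ : Subgroup SL(2, ℤ)) (A : SL(2, ℤ)) :
    ∃ B ∈ Γ, ∃ q : SL(2, ℤ) ⧸ Γ, A = B * q.out⁻¹ := by
  obtain ⟨B, hB⟩ := QuotientGroup.mk_out_eq_mul Γ A⁻¹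
  exact ⟨B, B.2, (A⁻¹ : SL(2, ℤ)), by rw [hB]; simp⟩

/-- Off the null set of boundary translates, an overlap of the domain with its image under `A` puts
a point of `fdo` and an equivalent point of `fd` in play. The representatives then agree up to `A`
and a sign, which forces `A = ±1`; that `-1 ∈ Γ` is used for the sign `-`. -/
theorem isFundDomain_cosetDomain {Γ : Subgroup SL(2, ℤ)} [Γ.FiniteIndex] (hΓ : -1 ∈ Γ) :
    IsFundDomain Γ (cosetDomain Γ) := by
  refine IsFundamentalDomain.mk'' (measurableSet_cosetDomain Γ).nullMeasurableSet
    (Eventually.of_forall fun z => ?_) (fun g hg => ?_)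
    fun g => (measurePreserving_transformations g).quasiMeasurePreserving
  · obtain ⟨A, hA⟩ := ModularGroup.exists_smul_mem_fd z
    obtain ⟨B, hB, q, hq⟩ := exists_mul_out Γ A⁻¹
    refine ⟨⟨_, B⁻¹, inv_mem hB, rfl⟩, mem_iUnion.2 ⟨q, ?_⟩⟩
    change q.out • B⁻¹ • z ∈ ModularGroup.fd
    have : q.out * B⁻¹ = A := by
      rw [← inv_inv A, hq, mul_inv_rev, inv_inv]
    rwa [smul_smul, this]
  · obtain ⟨A, hA, hgA⟩ := transformations_smul g
    have hA1 : A ≠ 1 ∧ A ≠ -1 := by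
      constructor <;> rintro rfl <;> refine hg (Subtype.ext (Equiv.ext fun z => ?_))
      · exact (hgA z).trans (one_smul _ z)
      · exact (hgA z).trans (by
          rw [ModularGroup.SL_neg_smul, one_smul]
          rfl)
    have hsub : g • cosetDomain Γ ∩ cosetDomain Γ ⊆ ⋃ q : SL(2, ℤ) ⧸ Γ,
        (fun z : ℍ => q.out • z) ⁻¹' (ModularGroup.fd \ ModularGroup.fdo) := by
      rintro _ ⟨⟨z, hz, rfl⟩, hz'⟩
      obtain ⟨q, hq⟩ := mem_iUnion.1 hz
      obtain ⟨q', hq'⟩ := mem_iUnion.1 hz'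
      refine mem_iUnion.2 ⟨q', hq', fun h => ?_⟩
      change q.out • z ∈ ModularGroup.fd at hq
      change q'.out • g • z ∈ ModularGroup.fdo at h
      rw [hgA, smul_smul] at h
      have e1 : q.out • z = (q.out * (q'.out * A)⁻¹) • (q'.out * A) • z := by
        rw [smul_smul, inv_mul_cancel_right]
      rw [e1] at hq
      have hcoset : ∀ C ∈ Γ, q.out = q'.out * C → C = 1 := fun C hC h => by
        have hqq : q = q' := by
          rw [← q.out_eq', ← q'.out_eq', h]
          exact QuotientGroup.mk_mul_of_mem _ hC
        rw [hqq] at h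
        exact left_eq_mul.1 h
      rcases ModularGroup.eq_one_or_neg_one_of_mem_fdo_mem_fd h hq with h1 | h1
      · exact hA1.1 (hcoset A hA (mul_inv_eq_one.1 h1))
      · have h2 : q.out = q'.out * (-A) := by
          rw [mul_inv_eq_iff_eq_mul.1 h1]
          simp
        have h3 : -A ∈ Γ := by
          rw [← neg_one_mul]
          exact mul_mem hΓ hA
        exact hA1.2 (neg_eq_iff_eq_neg.1 (hcoset (-A) h3 h2))
    refine measure_mono_null hsub (measure_iUnion_null fun q => ?_)
    rw [(measurePreserving_smul_SL q.out).measure_preimage_emb (measurableEmbedding_smul_SL _)]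
    exact volume_fd_diff_fdo

/-! ### Covering a vertical strip by translates of the fundamental domain -/

/-- If `c = 0` the height is unchanged; otherwise `|cz + d|² ≥ y²`, so the new height is at most `1
/ y ≤ 2`. Images of the low rectangle in the fundamental domain thus lie in a compact truncation. -/
theorem im_smul_le {z : ℍ} (h1 : 1 / 2 ≤ z.im) (h2 : z.im ≤ 1) (A : SL(2, ℤ)) :
    (A • z).im ≤ 2 := by
  have hz := z.im_pos
  rw [ModularGroup.im_smul_eq_div_normSq, ModularGroup.denom_apply, Complex.normSq_apply]
  have e1 : ((A 1 0 : ℂ) * z + (A 1 1 : ℂ)).im = (A 1 0 : ℝ) * z.im := by simp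
  have e2 : ((A 1 0 : ℂ) * z + (A 1 1 : ℂ)).re = (A 1 0 : ℝ) * z.re + (A 1 1 : ℝ) := by simp
  rw [e1, e2]
  by_cases hc : A 1 0 = 0
  · have hd := det_eq_one A
    rw [hc, mul_zero, sub_zero] at hd
    have : (A 1 1 : ℝ) * (A 1 1 : ℝ) = 1 := by
      exact_mod_cast (Int.isUnit_mul_self (IsUnit.of_mul_eq_one_right _ hd))
    rw [hc]
    simp only [Int.cast_zero, zero_mul, zero_add, this, add_zero, div_one]
    linarith
  · have hc0 : 0 < (A 1 0) ^ 2 := by positivity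
    have hc1 : (1 : ℝ) ≤ (A 1 0 : ℝ) ^ 2 := by exact_mod_cast hc0
    have h3 : z.im ^ 2 ≤ ((A 1 0 : ℝ) * z.re + (A 1 1 : ℝ)) * ((A 1 0 : ℝ) * z.re + (A 1 1 : ℝ)) +
        (A 1 0 : ℝ) * z.im * ((A 1 0 : ℝ) * z.im) := by
      nlinarith [sq_nonneg ((A 1 0 : ℝ) * z.re + (A 1 1 : ℝ)), sq_nonneg z.im]
    rw [div_le_iff₀ (lt_of_lt_of_le (by positivity) h3)]
    nlinarith

theorem finite_setOf_smul_mem {K L : Set ℍ} (hK : IsCompact K) (hL : IsCompact L) :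
    {A : SL(2, ℤ) | ∃ z ∈ K, A • z ∈ L}.Finite := by
  have h := properlyDiscontinuousSL2ZRange.finite_disjoint_inter_image hK hL
  have hinj : Function.Injective (Matrix.SpecialLinearGroup.mapGL (n := Fin 2) (R := ℤ) ℝ) :=
    Matrix.SpecialLinearGroup.isClosedEmbedding_mapGLInt.injective
  have hinj' := MonoidHom.rangeRestrict_injective_iff.2 hinj
  refine (h.preimage hinj'.injOn).subset ?_
  rintro A ⟨z, hz, hA⟩
  exact ⟨A • z, ⟨z, hz, rfl⟩, hA⟩

theorem isCompact_rectangle (N : ℕ) :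
    IsCompact {z : ℍ | z.re ∈ Icc 0 (N : ℝ) ∧ z.im ∈ Icc (1 / 2) 1} := by
  rw [UpperHalfPlane.isEmbedding_coe.isCompact_iff]
  have : UpperHalfPlane.coe '' {z : ℍ | z.re ∈ Icc 0 (N : ℝ) ∧ z.im ∈ Icc (1 / 2) 1} =
      Icc 0 (N : ℝ) ×ℂ Icc (1 / 2) 1 := by
    ext w
    constructor
    · rintro ⟨z, hz, rfl⟩
      exact hz
    · intro hw
      exact ⟨⟨w, lt_of_lt_of_le (by norm_num) hw.2.1⟩, hw, rfl⟩
  rw [this]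
  exact isCompact_Icc.reProdIm isCompact_Icc

theorem exists_finset_cover (N : ℕ) : ∃ P : Finset SL(2, ℤ), ∀ z : ℍ, z.re ∈ Ioc 0 (N : ℝ) →
    1 / 2 < z.im → ∃ p ∈ P, p • z ∈ ModularGroup.fd := by
  classical
  have hf := finite_setOf_smul_mem (isCompact_rectangle N)
    (ModularGroup.isCompact_truncatedFundamentalDomain 2)
  -- Heights in `(1/2, 1]` are covered by the finitely many matrices that proper discontinuity
  -- allows; above height `1`, translation by the nearest integer suffices.
  refine ⟨hf.toFinset ∪ (Finset.Icc (0 : ℤ) N).image fun n => ModularGroup.T ^ (-n),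
    fun z hx hy => ?_⟩
  rcases le_or_gt z.im 1 with h | h
  · obtain ⟨A, hA⟩ := ModularGroup.exists_smul_mem_fd z
    refine ⟨A, Finset.mem_union_left _ (hf.mem_toFinset.2 ⟨z, ⟨Ioc_subset_Icc_self hx, hy.le, h⟩,
      hA, im_smul_le hy.le h A⟩), hA⟩
  · refine ⟨ModularGroup.T ^ (-round z.re), Finset.mem_union_right _ (Finset.mem_image_of_mem _
      (Finset.mem_Icc.2 ⟨?_, ?_⟩)), ?_, ?_⟩
    · rw [round_eq, Int.le_floor]
      push_cast
      linarith [hx.1]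
    · rw [round_eq, Int.floor_le_iff]
      push_cast
      linarith [hx.2]
    · rw [Complex.normSq_apply]
      change 1 ≤ _ + (ModularGroup.T ^ (-round z.re) • z).im * (ModularGroup.T ^ (-round z.re) • z).im
      rw [ModularGroup.im_T_zpow_smul]
      nlinarith [mul_self_nonneg (ModularGroup.T ^ (-round z.re) • z : ℍ).re,
        show ((ModularGroup.T ^ (-round z.re) • z : ℍ) : ℂ).re =
          (ModularGroup.T ^ (-round z.re) • z : ℍ).re from rfl]
    · rw [ModularGroup.re_T_zpow_smul]
      have := abs_sub_round z.re
      push_cast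
      rwa [← sub_eq_add_neg]

theorem lintegral_fd_smul_le {Γ : Subgroup SL(2, ℤ)} {φ : ℍ → ℝ≥0∞}
    (hφ : ∀ A ∈ Γ, ∀ z : ℍ, φ (A • z) = φ z) (B : SL(2, ℤ)) :
    ∫⁻ z in ModularGroup.fd, φ (B • z) ≤ ∫⁻ z in cosetDomain Γ, φ z := by
  obtain ⟨C, hC, q, rfl⟩ := exists_mul_out Γ B
  simp_rw [mul_smul, hφ C hC]
  rw [← (measurePreserving_smul_SL q.out).setLIntegral_comp_preimage_emb
    (measurableEmbedding_smul_SL _)]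
  simp_rw [inv_smul_smul]
  exact lintegral_mono_set (subset_iUnion (fun q : SL(2, ℤ) ⧸ Γ =>
    (fun z : ℍ => q.out • z) ⁻¹' ModularGroup.fd) q)

/-- The strip is covered by finitely many translates of the standard domain, and `Γ`-invariance
bounds the integral over each by the integral over `cosetDomain Γ`. The count `m` is independent of
`φ` and of `B`, so it serves every cusp. -/
theorem exists_lintegral_strip_le (N : ℕ) : ∃ m : ℕ, ∀ (Γ : Subgroup SL(2, ℤ)) (φ : ℍ → ℝ≥0∞),
    (∀ A ∈ Γ, ∀ z : ℍ, φ (A • z) = φ z) → ∀ B : SL(2, ℤ),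
    ∫⁻ z : ℍ in {z | z.re ∈ Ioc 0 (N : ℝ) ∧ z.im ∈ Ioi (1 / 2)}, φ (B • z) ≤
      m * ∫⁻ z in cosetDomain Γ, φ z := by
  obtain ⟨P, hP⟩ := exists_finset_cover N
  refine ⟨P.card, fun Γ φ hφ B => ?_⟩
  have hsub : {z : ℍ | z.re ∈ Ioc 0 (N : ℝ) ∧ z.im ∈ Ioi (1 / 2)} ⊆
      ⋃ p : P, (fun z : ℍ => (p : SL(2, ℤ)) • z) ⁻¹' ModularGroup.fd := fun z hz => by
    obtain ⟨p, hp, h⟩ := hP z hz.1 hz.2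
    exact mem_iUnion.2 ⟨⟨p, hp⟩, h⟩
  refine (lintegral_mono_set hsub).trans ((lintegral_iUnion_le _ _).trans ?_)
  rw [tsum_fintype]
  refine (Finset.sum_le_card_nsmul _ _ (∫⁻ z in cosetDomain Γ, φ z) fun p _ => ?_).trans_eq ?_
  · have h := (measurePreserving_smul_SL (p : SL(2, ℤ))).setLIntegral_comp_preimage_emb
      (measurableEmbedding_smul_SL _) (fun z => φ ((B * (p : SL(2, ℤ))⁻¹) • z)) ModularGroup.fd
    simp_rw [smul_smul, inv_mul_cancel_right] at h
    rw [h]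
    exact lintegral_fd_smul_le hφ _
  · simp

/-! ### Maass forms are bounded -/

theorem lintegral_rowSq {F : ℂ → ℂ} (hF : AnalyticOnNhd ℝ F upperHalfPlaneSet) {L : ℝ}
    (hL : 0 < L) :
    ∫⁻ y in Ioi (1 / 2 : ℝ), ENNReal.ofReal (rowSq L F y / y ^ 2) =
      ∫⁻ z : ℍ in {z | z.re ∈ Ioc 0 L ∧ z.im ∈ Ioi (1 / 2)}, ‖F z‖ₑ ^ 2 := by
  have hm : AEMeasurable (fun w => ‖F w‖ₑ ^ 2) (volume.restrict upperHalfPlaneSet) :=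
    ((hF.continuousOn.aestronglyMeasurable isOpen_U.measurableSet).enorm).pow_const 2
  rw [lintegral_strip hm measurableSet_Ioc measurableSet_Ioi (Ioi_subset_Ioi (by norm_num))]
  refine setLIntegral_congr_fun measurableSet_Ioi fun y hy => ?_
  have hy' : (0 : ℝ) < y := lt_trans (by norm_num) hy
  rw [lintegral_const_mul' _ _ ENNReal.ofReal_ne_top, rowSq, intervalIntegral.integral_of_le hL.le,
    div_eq_inv_mul, ENNReal.ofReal_mul (by positivity), one_div,
    ofReal_integral_eq_lintegral_ofReal]
  · congr 1
    refine lintegral_congr fun x => ?_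
    rw [ENNReal.ofReal_pow (norm_nonneg _), ofReal_norm]
  · exact (((continuous_row hF hy').norm.pow 2).intervalIntegrable 0 L).1
  · exact Eventually.of_forall fun x => by positivity

theorem integrableOn_rowSq {F : ℂ → ℂ} (hF : AnalyticOnNhd ℝ F upperHalfPlaneSet) {L : ℝ}
    (hL : 0 < L) (h : ∫⁻ z : ℍ in {z | z.re ∈ Ioc 0 L ∧ z.im ∈ Ioi (1 / 2)}, ‖F z‖ₑ ^ 2 ≠ ∞) :
    IntegrableOn (fun y => rowSq L F y / y ^ 2) (Ioi (1 / 2)) ∧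
      ∫ y in Ioi (1 / 2 : ℝ), rowSq L F y / y ^ 2 =
        (∫⁻ z : ℍ in {z | z.re ∈ Ioc 0 L ∧ z.im ∈ Ioi (1 / 2)}, ‖F z‖ₑ ^ 2).toReal := by
  have hc : ContinuousOn (fun y => rowSq L F y / y ^ 2) (Ioi (1 / 2)) :=
    ((continuousOn_rowSq hF L).mono (Ioi_subset_Ioi (by norm_num))).div (by fun_prop)
      fun y hy => pow_ne_zero 2 (lt_trans (by norm_num) hy : (0 : ℝ) < y).ne'
  have hm := hc.aestronglyMeasurable (μ := volume) measurableSet_Ioi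
  have hn : 0 ≤ᵐ[volume.restrict (Ioi (1 / 2 : ℝ))] fun y => rowSq L F y / y ^ 2 :=
    Eventually.of_forall fun y => div_nonneg (rowSq_nonneg hL F y) (sq_nonneg y)
  rw [← lintegral_rowSq hF hL] at h ⊢
  exact ⟨(lintegral_ofReal_ne_top_iff_integrable hm hn).1 h,
    integral_eq_lintegral_of_nonneg_ae hn hm⟩

theorem norm_smul_eq {N : ℕ} {v : SL(2, ℤ) → ℂ} {k : ℝ}
    (hv : ∀ A ∈ CongruenceSubgroup.Gamma0 N, ‖v A‖ = 1) {f : ℍ → ℂ}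
    (hf : ∀ A ∈ CongruenceSubgroup.Gamma0 N, ∀ z : ℍ, f (A • z) = v A * autFactor k A z * f z)
    {A : SL(2, ℤ)} (hA : A ∈ CongruenceSubgroup.Gamma0 N) (z : ℍ) : ‖f (A • z)‖ = ‖f z‖ := by
  rw [hf A hA z, norm_mul, norm_mul, hv A hA, norm_autFactor, one_mul, one_mul]

theorem neg_one_mem_Gamma0 (N : ℕ) : -1 ∈ CongruenceSubgroup.Gamma0 N := by
  rw [CongruenceSubgroup.Gamma0_mem]
  simp

/-- The square of the `L²` norm. -/
def energy (N : ℕ) (f : ℍ → ℂ) : ℝ :=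
  ∫ z in cosetDomain (CongruenceSubgroup.Gamma0 N), ‖f z‖ ^ 2

/-- The slashed form is an eigenfunction with quasi-period `N`, so `exists_sup_bound` applies. On
`(1/2, Y]` one has `1 ≤ Y² / y²`, which turns the row integrals into hyperbolic area, and the strip
costs at most `m` copies of the energy. -/
theorem exists_cusp_bound {N : ℕ} [NeZero N] {v : SL(2, ℤ) → ℂ} {k lam : ℝ} (hlam : 1 / 4 < lam)
    (hv : ∀ A ∈ CongruenceSubgroup.Gamma0 N, ‖v A‖ = 1) (A : SL(2, ℤ)) :
    ∃ C : ℝ, 0 ≤ C ∧ ∀ f : ℍ → ℂ, IsMaassForm (CongruenceSubgroup.Gamma0 N) v k lam f →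
      ∀ z : ℍ, 3 / 4 ≤ z.im → ‖f (A • z)‖ ^ 2 ≤ C * energy N f := by
  have hN : (0 : ℝ) < N := by exact_mod_cast Nat.pos_of_ne_zero (NeZero.ne N)
  obtain ⟨β, hβ⟩ := exists_quasiPeriod k hv A
  obtain ⟨C, Y, hC, hY, hb⟩ := exists_sup_bound k lam β hN hlam
  obtain ⟨m, hm⟩ := exists_lintegral_strip_le N
  refine ⟨C * (Y ^ 2 * m), by positivity, fun f hf z hz => ?_⟩
  set h := slashSL k A f with hh
  have hE : IsEigen k lam h :=
    (isEigen_iff.2 ⟨hf.realAnalytic, hf.eigenfunction⟩).slash (det_real_eq_one A)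
  have hint := hf.squareIntegrable _ (isFundDomain_cosetDomain (neg_one_mem_Gamma0 N))
  have e1 : ∫⁻ z in cosetDomain (CongruenceSubgroup.Gamma0 N), ‖f z‖ₑ ^ 2 =
      ENNReal.ofReal (energy N f) := by
    rw [energy, ofReal_integral_eq_lintegral_ofReal hint (Eventually.of_forall fun z => by positivity)]
    refine lintegral_congr fun z => ?_
    rw [ENNReal.ofReal_pow (norm_nonneg _), ofReal_norm]
  have hle := hm (CongruenceSubgroup.Gamma0 N) (fun z => ‖f z‖ₑ ^ 2) (fun B hB z => by
    rw [← ofReal_norm, norm_smul_eq hv hf.automorphic hB, ofReal_norm]) A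
  have e2 : ∀ z : ℍ, ‖f (A • z)‖ₑ ^ 2 = ‖h z‖ₑ ^ 2 := fun z => by
    rw [← ofReal_norm, ← norm_slashSL k, ofReal_norm]
  simp_rw [e2, e1] at hle
  have hE0 : 0 ≤ energy N f := integral_nonneg fun z => by positivity
  rw [show (m : ℝ≥0∞) = ENNReal.ofReal m by simp, ← ENNReal.ofReal_mul (by positivity)] at hle
  obtain ⟨i1, i2⟩ := integrableOn_rowSq hE.analytic hN (ne_top_of_le_ne_top ENNReal.ofReal_ne_top hle)
  have h1 := hb h hE (hβ f hf.automorphic) (i1.mono_set (Ioi_subset_Ioi (by norm_num))) z hz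
  rw [hh, norm_slashSL] at h1
  refine h1.trans ?_
  rw [mul_assoc]
  refine mul_le_mul_of_nonneg_left ?_ hC
  have h2 : ∫ y in Ioi (1 / 2 : ℝ), rowSq N h y / y ^ 2 ≤ m * energy N f := by
    rw [i2]
    exact ENNReal.toReal_le_of_le_ofReal (by positivity) hle
  rw [mul_assoc]
  refine le_trans ?_ (mul_le_mul_of_nonneg_left h2 (sq_nonneg Y))
  rw [intervalIntegral.integral_of_le hY, ← integral_const_mul]
  have i3 : IntegrableOn (fun y => Y ^ 2 * (rowSq N h y / y ^ 2)) (Ioi (1 / 2)) := i1.const_mul _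
  refine le_trans (setIntegral_mono_on ?_ (i3.mono_set Ioc_subset_Ioi_self) measurableSet_Ioc
    fun y hy => ?_) (setIntegral_mono_set i3 (Eventually.of_forall fun y =>
      mul_nonneg (sq_nonneg Y) (div_nonneg (rowSq_nonneg hN h y) (sq_nonneg y)))
      (LE.le.eventuallyLE Ioc_subset_Ioi_self))
  · have : IntervalIntegrable (rowSq N h) volume (1 / 2) Y :=
      ((continuousOn_rowSq hE.analytic N).mono fun t ht => by
        rw [uIcc_of_le hY] at ht
        exact lt_of_lt_of_le (by norm_num) ht.1).intervalIntegrable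
    exact this.1
  · have hy0 : 0 < y := lt_trans (by norm_num) hy.1
    rw [mul_div_assoc', le_div_iff₀ (by positivity), mul_comm]
    gcongr
    · exact rowSq_nonneg hN h y
    · exact hy.2

/-- Every point is `Γ₀(N)`-equivalent to some `q.out⁻¹ • w` with `w` in the standard domain, hence
of height above `3/4`. Finitely many cusp bounds therefore cover the half-plane. -/
theorem exists_global_bound {N : ℕ} [NeZero N] {v : SL(2, ℤ) → ℂ} {k lam : ℝ} (hlam : 1 / 4 < lam)
    (hv : ∀ A ∈ CongruenceSubgroup.Gamma0 N, ‖v A‖ = 1) :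
    ∃ C : ℝ, 0 ≤ C ∧ ∀ f : ℍ → ℂ, IsMaassForm (CongruenceSubgroup.Gamma0 N) v k lam f →
      ∀ z : ℍ, ‖f z‖ ^ 2 ≤ C * energy N f := by
  have : Fintype (SL(2, ℤ) ⧸ CongruenceSubgroup.Gamma0 N) :=
    (CongruenceSubgroup.Gamma0 N).fintypeQuotientOfFiniteIndex
  choose C hC hb using fun q : SL(2, ℤ) ⧸ CongruenceSubgroup.Gamma0 N =>
    exists_cusp_bound (k := k) hlam hv q.out⁻¹
  refine ⟨∑ q, C q, Finset.sum_nonneg fun q _ => hC q, fun f hf z => ?_⟩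
  obtain ⟨A, hA⟩ := ModularGroup.exists_smul_mem_fd z
  obtain ⟨B, hB, q, hq⟩ := exists_mul_out (CongruenceSubgroup.Gamma0 N) A⁻¹
  have h1 : f z = f (B • q.out⁻¹ • A • z) := by
    rw [← mul_smul, ← hq, inv_smul_smul]
  have h3 := ModularGroup.three_le_four_mul_im_sq_of_mem_fd hA
  have hE0 : 0 ≤ energy N f := integral_nonneg fun z => by positivity
  rw [h1, norm_smul_eq hv hf.automorphic hB]
  refine (hb q f hf (A • z) (by nlinarith [(A • z).im_pos])).trans
    (mul_le_mul_of_nonneg_right (Finset.single_le_sum (fun q _ => hC q) (Finset.mem_univ q)) hE0)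

/-! ### Finite dimension of spaces of bounded square integrable functions -/

section FiniteDimension

variable {X : Type*} [MeasurableSpace X] {μ : Measure X} {V : Submodule ℂ (X → ℂ)}

/-- The inclusion into `L²`. -/
def toL2 (hm : ∀ f ∈ V, MemLp f 2 μ) : V →ₗ[ℂ] Lp ℂ 2 μ where
  toFun f := (hm f f.2).toLp f
  map_add' f g := MemLp.toLp_add (hm f f.2) (hm g g.2)
  map_smul' c f := MemLp.toLp_const_smul c (hm f f.2)

theorem norm_toL2_sq (hm : ∀ f ∈ V, MemLp f 2 μ) (f : V) :
    ‖toL2 hm f‖ ^ 2 = ∫ x, ‖(f : X → ℂ) x‖ ^ 2 ∂μ := by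
  have h : ((‖toL2 hm f‖ ^ 2 : ℝ) : ℂ) = ((∫ x, ‖(f : X → ℂ) x‖ ^ 2 ∂μ : ℝ) : ℂ) := by
    have h1 := inner_self_eq_norm_sq_to_K (𝕜 := ℂ) (toL2 hm f)
    rw [L2.inner_def] at h1
    rw [← integral_complex_ofReal]
    refine (by exact_mod_cast h1.symm : ((‖toL2 hm f‖ ^ 2 : ℝ) : ℂ) = _).trans ?_
    refine integral_congr_ae ?_
    filter_upwards [(hm f f.2).coeFn_toLp] with x hx
    have : (toL2 hm f : X → ℂ) x = (f : X → ℂ) x := hx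
    rw [this, inner_self_eq_norm_sq_to_K]
    norm_cast
  exact_mod_cast h

/-- A reproducing kernel argument: for an orthonormal basis `g_i` the diagonal `∑ |g_i(x)|²` is at
most `C` at every point, while its integral is the dimension. -/
theorem finrank_le_of_sup_bound [IsFiniteMeasure μ] (hm : ∀ f ∈ V, MemLp f 2 μ) {C : ℝ}
    (hC : 0 ≤ C) (hb : ∀ f ∈ V, ∀ x, ‖f x‖ ^ 2 ≤ C * ∫ y, ‖f y‖ ^ 2 ∂μ) (S : Submodule ℂ V)
    [FiniteDimensional ℂ S] : (Module.finrank ℂ S : ℝ) ≤ C * μ.real univ := by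
  have hinj : Function.Injective (toL2 hm) := by
    rw [injective_iff_map_eq_zero]
    intro f hf
    have h0 := norm_toL2_sq hm f
    rw [hf, norm_zero] at h0
    ext x
    have := hb f f.2 x
    rw [← h0] at this
    have h1 : ‖(f : X → ℂ) x‖ ^ 2 = 0 := le_antisymm (by simpa using this) (sq_nonneg _)
    simpa using h1
  have hfr : Module.finrank ℂ (S.map (toL2 hm)) = Module.finrank ℂ S :=
    (Submodule.equivMapOfInjective (toL2 hm) hinj S).finrank_eq.symm
  rw [← hfr]
  set b := stdOrthonormalBasis ℂ (S.map (toL2 hm))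
  have hb' : ∀ i, ∃ g : V, toL2 hm g = b i := fun i => by
    obtain ⟨g, _, hg⟩ := (b i).2
    exact ⟨g, hg⟩
  choose g hg using hb'
  have hon : Orthonormal ℂ fun i => toL2 hm (g i) := by
    simp_rw [hg]
    exact b.orthonormal.comp_linearIsometry (S.map (toL2 hm)).subtypeₗᵢ
  have key : ∀ x, ∑ i, ‖(g i : X → ℂ) x‖ ^ 2 ≤ C := fun x => by
    set T := ∑ i, ‖(g i : X → ℂ) x‖ ^ 2 with hT
    have hT0 : 0 ≤ T := Finset.sum_nonneg fun i _ => sq_nonneg _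
    -- The extremal element at `x`: both its value at `x` and its squared norm equal `T`, so the sup
    -- bound reads `T² ≤ C T`.
    set f : V := ∑ i, (starRingEnd ℂ) ((g i : X → ℂ) x) • g i with hf
    have h1 : (f : X → ℂ) x = (T : ℂ) := by
      rw [hf, hT]
      simp [Finset.sum_apply, Complex.conj_mul']
    have h2 : ‖toL2 hm f‖ ^ 2 = T := by
      have h3 : ((‖toL2 hm f‖ ^ 2 : ℝ) : ℂ) = (T : ℂ) := by
        have h4 := inner_self_eq_norm_sq_to_K (𝕜 := ℂ) (toL2 hm f)
        refine (by exact_mod_cast h4.symm : ((‖toL2 hm f‖ ^ 2 : ℝ) : ℂ) = _).trans ?_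
        rw [hf, map_sum]
        simp_rw [map_smul]
        rw [hon.inner_sum, hT]
        simp [Complex.mul_conj']
      exact_mod_cast h3
    have h5 := hb f f.2 x
    rw [← norm_toL2_sq hm f, h2, h1, Complex.norm_real, Real.norm_of_nonneg hT0, sq] at h5
    rcases hT0.eq_or_lt with h | h
    · rwa [← h]
    · exact le_of_mul_le_mul_right h5 h
  have h6 : ∫ x, ∑ i, ‖(g i : X → ℂ) x‖ ^ 2 ∂μ = Module.finrank ℂ (S.map (toL2 hm)) := by
    rw [integral_finsetSum _ fun i _ => (hm (g i) (g i).2).integrable_norm_pow two_ne_zero]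
    simp_rw [← norm_toL2_sq hm, hon.1]
    simp
  rw [← h6]
  refine (integral_mono_of_nonneg (Eventually.of_forall fun x => Finset.sum_nonneg fun i _ =>
    sq_nonneg _) (integrable_const C) (Eventually.of_forall key)).trans_eq ?_
  simp [mul_comm]

theorem finiteDimensional_of_sup_bound [IsFiniteMeasure μ] (hm : ∀ f ∈ V, MemLp f 2 μ) {C : ℝ}
    (hC : 0 ≤ C) (hb : ∀ f ∈ V, ∀ x, ‖f x‖ ^ 2 ≤ C * ∫ y, ‖f y‖ ^ 2 ∂μ) : FiniteDimensional ℂ V := by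
  have h : Module.rank ℂ V ≤ (⌊C * μ.real univ⌋₊ : ℕ) := rank_le fun s hs => by
    have h1 := finrank_le_of_sup_bound hm hC hb (Submodule.span ℂ (s : Set V))
    have h2 : Module.finrank ℂ (Submodule.span ℂ (s : Set V)) = s.card :=
      finrank_span_finset_eq_card hs
    rw [h2] at h1
    exact Nat.le_floor h1
  exact Module.rank_lt_aleph0_iff.1 (h.trans_lt (Cardinal.natCast_lt_aleph0))

end FiniteDimension

/-! ### The reflection `f*(z) = conj f(-z̄)` -/

theorem IsEigen.congr {k lam : ℝ} {F G : ℂ → ℂ} (hF : IsEigen k lam F)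
    (h : EqOn F G upperHalfPlaneSet) : IsEigen k lam G := by
  have hx : ∀ {F G : ℂ → ℂ}, EqOn F G upperHalfPlaneSet → EqOn (Dx F) (Dx G) upperHalfPlaneSet :=
    fun h w hw => Dx_congr (h.eventuallyEq_of_mem (isOpen_U.mem_nhds hw))
  have hy : ∀ {F G : ℂ → ℂ}, EqOn F G upperHalfPlaneSet → EqOn (Dy F) (Dy G) upperHalfPlaneSet :=
    fun h w hw => Dy_congr (h.eventuallyEq_of_mem (isOpen_U.mem_nhds hw))
  refine ⟨hF.analytic.congr isOpen_U h, fun w hw => ?_⟩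
  rw [← hx (hx h) hw, ← hy (hy h) hw, ← hx h hw, ← h hw]
  exact hF.eqn w hw

theorem fderiv_conj_comp {F : ℂ → ℂ} {w : ℂ} (hF : DifferentiableAt ℝ F (-conj w)) (t : ℂ) :
    fderiv ℝ (fun w => conj (F (-conj w))) w t = conj (fderiv ℝ F (-conj w) (-conj t)) := by
  have h1 : HasFDerivAt (fun w : ℂ => -conj w) (-Complex.conjCLE.toContinuousLinearMap) w :=
    (Complex.conjCLE.toContinuousLinearMap.hasFDerivAt).neg
  have h2 := Complex.conjCLE.toContinuousLinearMap.hasFDerivAt.comp w (hF.hasFDerivAt.comp w h1)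
  have h3 : HasFDerivAt (fun w => conj (F (-conj w))) _ w := h2
  rw [h3.fderiv]
  simp

theorem Dx_conj_comp {F : ℂ → ℂ} {w : ℂ} (hF : DifferentiableAt ℝ F (-conj w)) :
    Dx (fun w => conj (F (-conj w))) w = -conj (Dx F (-conj w)) := by
  rw [Dx, fderiv_conj_comp hF]
  simp [Dx]

theorem Dy_conj_comp {F : ℂ → ℂ} {w : ℂ} (hF : DifferentiableAt ℝ F (-conj w)) :
    Dy (fun w => conj (F (-conj w))) w = conj (Dy F (-conj w)) := by
  rw [Dy, fderiv_conj_comp hF]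
  simp [Dy]

theorem neg_conj_mem_U {w : ℂ} (hw : w ∈ upperHalfPlaneSet) : -conj w ∈ upperHalfPlaneSet := by
  simpa [mem_U] using hw

/-- The reflection changes the sign of `∂/∂x` and conjugation changes the sign of `i`, so the first
order term `-iky ∂/∂x` is preserved. -/
theorem IsEigen.conj_comp {k lam : ℝ} {F : ℂ → ℂ} (hF : IsEigen k lam F) :
    IsEigen k lam fun w => conj (F (-conj w)) := by
  refine ⟨fun w hw => ?_, fun w hw => ?_⟩
  · have h1 : AnalyticAt ℝ (fun w : ℂ => -conj w) w :=
      (Complex.conjCLE.toContinuousLinearMap.analyticAt w).neg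
    have h2 : AnalyticAt ℝ (fun w : ℂ => F (-conj w)) w :=
      AnalyticAt.comp (hF.analytic _ (neg_conj_mem_U hw)) h1
    exact (Complex.conjCLE.toContinuousLinearMap.analyticAt _).comp h2
  · have hd : ∀ {G : ℂ → ℂ}, AnalyticOnNhd ℝ G upperHalfPlaneSet → ∀ w ∈ upperHalfPlaneSet,
        DifferentiableAt ℝ G (-conj w) := fun h w hw => (h _ (neg_conj_mem_U hw)).differentiableAt
    have aX := analyticOnNhd_Dx hF.analytic
    have aY := analyticOnNhd_Dy hF.analytic
    have e1 : Dx (fun w => conj (F (-conj w))) =ᶠ[𝓝 w] fun w => -conj (Dx F (-conj w)) := by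
      filter_upwards [isOpen_U.mem_nhds hw] with z hz
      exact Dx_conj_comp (hd hF.analytic z hz)
    have e2 : Dy (fun w => conj (F (-conj w))) =ᶠ[𝓝 w] fun w => conj (Dy F (-conj w)) := by
      filter_upwards [isOpen_U.mem_nhds hw] with z hz
      exact Dy_conj_comp (hd hF.analytic z hz)
    have e3 : Dx (fun w => -conj (Dx F (-conj w))) w = conj (Dx (Dx F) (-conj w)) := by
      have : Dx (fun w => -conj (Dx F (-conj w))) w = -Dx (fun w => conj (Dx F (-conj w))) w := by
        rw [Dx, fderiv_fun_neg]
        rfl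
      rw [this, Dx_conj_comp (hd aX w hw), neg_neg]
    rw [Dx_congr e1, Dy_congr e2, e3, Dy_conj_comp (hd aY w hw), e1.eq_of_nhds]
    have h := congrArg conj (hF.eqn _ (neg_conj_mem_U hw))
    simp only [map_add, map_sub, map_mul, map_pow, Complex.conj_ofReal, Complex.conj_I,
      map_zero] at h
    rw [show (-conj w).im = w.im by simp] at h
    linear_combination h

/-- The reflection `z ↦ -z̄` of the upper half-plane. -/
def flip (z : ℍ) : ℍ := ⟨-conj (z : ℂ), neg_conj_mem_U z.2⟩

theorem coe_flip (z : ℍ) : (flip z : ℂ) = -conj (z : ℂ) := rfl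

theorem flip_flip (z : ℍ) : flip (flip z) = z := by
  ext
  simp [coe_flip]

theorem flip_smul (A : SL(2, ℤ)) (z : ℍ) : flip (A • z) = reflect A • flip z := by
  ext
  rw [coe_flip, UpperHalfPlane.coe_specialLinearGroup_apply,
    UpperHalfPlane.coe_specialLinearGroup_apply, coe_flip]
  simp only [reflect, Matrix.SpecialLinearGroup.coe_mk, Matrix.of_apply, Matrix.cons_val',
    Matrix.cons_val_zero, Matrix.cons_val_one, Matrix.cons_val_fin_one, map_div₀, map_add, map_mul,
    algebraMap_int_eq, Int.coe_castRingHom, Complex.ofReal_intCast,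
    map_intCast]
  push_cast
  rw [← neg_div]
  congr 1 <;> ring

/-- `f*(z) = conj f(-z̄)`. -/
def conjFlip (f : ℍ → ℂ) (z : ℍ) : ℂ := conj (f (flip z))

theorem conjFlip_conjFlip (f : ℍ → ℂ) : conjFlip (conjFlip f) = f := by
  funext z
  simp [conjFlip, flip_flip]

/-- The principal argument is odd under conjugation except on the negative real axis, which `cz + d`
meets only if `c = 0` and `d < 0`. -/
theorem autFactor_reflect (k : ℝ) {A : SL(2, ℤ)} (hA : A 1 0 ≠ 0 ∨ 0 < A 1 1) (z : ℍ) :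
    conj (autFactor k (reflect A) (flip z)) = autFactor k A z := by
  have h1 : ((reflect A 1 0 : ℤ) : ℂ) * (flip z : ℂ) + ((reflect A 1 1 : ℤ) : ℂ) =
      conj ((A 1 0 : ℂ) * z + (A 1 1 : ℂ)) := by
    rw [coe_flip]
    simp [reflect]
  have h2 : ((A 1 0 : ℂ) * z + (A 1 1 : ℂ)).arg ≠ Real.pi := by
    intro h
    rw [Complex.arg_eq_pi_iff] at h
    simp only [Complex.add_re, Complex.mul_re, Complex.intCast_re, Complex.intCast_im, zero_mul,
      sub_zero, Complex.add_im, Complex.mul_im, add_zero, mul_eq_zero, Int.cast_eq_zero] at h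
    have hz := z.im_pos.ne'
    rcases h.2 with h0 | h0
    · have hd : 0 < A 1 1 := by tauto
      have hd' : (0 : ℝ) < (A 1 1 : ℤ) := by exact_mod_cast hd
      rw [h0] at h
      simp at h
      linarith
    · exact hz h0
  rw [autFactor, autFactor, h1, Complex.arg_conj, if_neg h2, ← Complex.exp_conj]
  congr 1
  simp

/-- The matrices with `c = 0`, `d < 0` are treated through `-A`, which acts in the same way. No
cocycle relation is assumed for `v`: if `f` is not zero, comparing its transformation under `A` and
`-A` at a point where it does not vanish supplies the needed equality of factors. -/
theorem conjFlip_automorphic {N : ℕ} {v : SL(2, ℤ) → ℂ} {k : ℝ} (hv : IsSymmetric N v) {f : ℍ → ℂ}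
    (hf : ∀ A ∈ CongruenceSubgroup.Gamma0 N, ∀ z : ℍ, f (A • z) = v A * autFactor k A z * f z) :
    ∀ A ∈ CongruenceSubgroup.Gamma0 N, ∀ z : ℍ,
      conjFlip f (A • z) = v A * autFactor k A z * conjFlip f z := by
  have main : ∀ A ∈ CongruenceSubgroup.Gamma0 N, A 1 0 ≠ 0 ∨ 0 < A 1 1 → ∀ z : ℍ,
      conjFlip f (A • z) = v A * autFactor k A z * conjFlip f z := fun A hA h z => by
    rw [conjFlip, flip_smul, hf _ (reflect_mem_Gamma0 hA), map_mul, map_mul, hv.conj_reflect A hA h,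
      autFactor_reflect k h, conjFlip]
  intro A hA z
  by_cases h : A 1 0 ≠ 0 ∨ 0 < A 1 1
  · exact main A hA h z
  · by_cases h0 : ∀ z, f z = 0
    · simp [conjFlip, h0]
    · push Not at h h0
      obtain ⟨z₀, hz₀⟩ := h0
      have hnA : -A ∈ CongruenceSubgroup.Gamma0 N := by
        rw [← neg_one_mul]
        exact mul_mem (neg_one_mem_Gamma0 N) hA
      have hdet := det_eq_one A
      rw [h.1, mul_zero, sub_zero] at hdet
      have hd : 0 < (-A) 1 1 := by
        have : A 1 1 ≠ 0 := by
          rintro h1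
          rw [h1] at hdet
          simp at hdet
        change 0 < -(A 1 1)
        omega
      have hc : ∀ z : ℍ, autFactor k A z = autFactor k A z₀ := fun z => by
        simp [autFactor, h.1]
      have hc' : ∀ z : ℍ, autFactor k (-A) z = autFactor k (-A) z₀ := fun z => by
        simp [autFactor, h.1]
      have e1 := hf A hA z₀
      have e2 := hf (-A) hnA z₀
      rw [ModularGroup.SL_neg_smul] at e2
      have e3 : v A * autFactor k A z₀ = v (-A) * autFactor k (-A) z₀ :=
        mul_right_cancel₀ hz₀ (e1.symm.trans e2)
      have e4 := main (-A) hnA (Or.inr hd) z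
      rw [ModularGroup.SL_neg_smul] at e4
      rw [e4, hc z, hc' z, e3]

/-- Square integrability is obtained without reflecting fundamental domains: `f` is bounded by
`exists_global_bound`, and every fundamental domain has the finite area of `cosetDomain`. -/
theorem isMaassForm_conjFlip {N : ℕ} [NeZero N] {v : SL(2, ℤ) → ℂ} {k lam : ℝ}
    (hlam : 1 / 4 < lam) (hv : IsSymmetric N v) {f : ℍ → ℂ}
    (hf : IsMaassForm (CongruenceSubgroup.Gamma0 N) v k lam f) :
    IsMaassForm (CongruenceSubgroup.Gamma0 N) v k lam (conjFlip f) := by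
  have hE : IsEigen k lam fun w => conjFlip f (ofComplex w) := by
    refine (isEigen_iff.2 ⟨hf.realAnalytic, hf.eigenfunction⟩).conj_comp.congr fun w hw => ?_
    have : flip (ofComplex w) = ofComplex (-conj w) := by
      ext
      rw [coe_flip, ofComplex_apply_of_im_pos hw, ofComplex_apply_of_im_pos (neg_conj_mem_U hw)]
    simp [conjFlip, this]
  obtain ⟨h1, h2⟩ := isEigen_iff.1 hE
  obtain ⟨C, hC, hb⟩ := exists_global_bound (k := k) hlam hv.norm_eq
  refine ⟨h1, conjFlip_automorphic hv hf.automorphic, h2, fun F hF => ?_⟩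
  have hvol : volume F < ∞ := by
    rw [IsFundamentalDomain.measure_eq hF (isFundDomain_cosetDomain (neg_one_mem_Gamma0 N))]
    exact volume_cosetDomain_lt_top _
  have hc := continuous_of_analytic h1
  refine Measure.integrableOn_of_bounded (M := C * energy N f) hvol.ne
    ((hc.norm.pow 2).aestronglyMeasurable) (Eventually.of_forall fun z => ?_)
  rw [Real.norm_of_nonneg (by positivity), conjFlip, RCLike.norm_conj]
  exact hb f hf _

/-! ### The Fourier coefficients as Whittaker functions -/

/-- `κ = sgn(ν) k/2`. -/
def kappa (k ν : ℝ) : ℂ := SignType.sign ν * ((k : ℂ) / 2)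

theorem kappa_eq (k ν : ℝ) : kappa k ν = ((SignType.sign ν * (k / 2) : ℝ) : ℂ) := by
  rw [kappa]
  rcases lt_trichotomy ν 0 with h | h | h <;> simp [h]

/-- With `x = 4π|ν|y` the constant term of the potential becomes `1/4`, the sign of `ν` passes into
`κ`, and `1/4 - μ² = λ` for `μ = i √(λ - 1/4)`. -/
theorem solvesOn_rescale {k lam ν : ℝ} (hlam : 1 / 4 < lam) (hν : ν ≠ 0) {u u' : ℝ → ℂ}
    (hu : SolvesOn (fun y => (fourierQ k lam ν y : ℂ)) u u') :
    SolvesOn (whitQ (kappa k ν) (Complex.I * Real.sqrt (lam - 1 / 4)))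
      (fun x => u (x / (4 * Real.pi * |ν|)))
      (fun x => u' (x / (4 * Real.pi * |ν|)) / ((4 * Real.pi * |ν| : ℝ) : ℂ)) := by
  have hs : 0 < 4 * Real.pi * |ν| := by positivity
  set s := 4 * Real.pi * |ν| with hsdef
  have hd : ∀ x : ℝ, HasDerivAt (fun x : ℝ => x / s) (1 / s) x := fun x =>
    (hasDerivAt_id x).div_const s
  refine ⟨fun x hx => ?_, fun x hx => ?_⟩
  · have h := (hu.deriv₁ (x / s) (by positivity)).scomp x (hd x)
    refine h.congr_deriv ?_
    rw [Complex.real_smul]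
    push_cast
    ring
  · have h := ((hu.deriv₂ (x / s) (by positivity)).scomp x (hd x)).div_const (s : ℂ)
    refine h.congr_deriv ?_
    have hq : ((fourierQ k lam ν (x / s) / s ^ 2 : ℝ) : ℂ) =
        whitQ (kappa k ν) (Complex.I * Real.sqrt (lam - 1 / 4)) x := by
      have h1 : fourierQ k lam ν (x / s) / s ^ 2 =
          1 / 4 - SignType.sign ν * (k / 2) / x - lam / x ^ 2 := by
        have hsign : (SignType.sign ν : ℝ) * |ν| = ν := sign_mul_abs ν
        have habs : |ν| ^ 2 = ν ^ 2 := sq_abs ν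
        have hν' : |ν| ≠ 0 := by positivity
        rw [fourierQ, hsdef]
        have e1 : 2 * Real.pi * k * ν = 2 * Real.pi * k * (SignType.sign ν * |ν|) := by rw [hsign]
        rw [e1, ← habs]
        field_simp
        ring
      rw [h1, kappa_eq, whitQ, mul_pow, Complex.I_sq, ← Complex.ofReal_pow,
        Real.sq_sqrt (by linarith)]
      push_cast
      ring
    rw [← hq, Complex.real_smul]
    push_cast
    ring

theorem rowInt_eq_of_periodic {g : ℝ → ℂ} (hg : Function.Periodic g 1) :
    ∫ x in (0 : ℝ)..1, g (-x) = ∫ x in (0 : ℝ)..1, g x := by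
  rw [intervalIntegral.integral_comp_neg]
  have := hg.intervalIntegral_add_eq (-1) 0
  simpa using this

/-- The integrand is genuinely periodic of period `1`, so `x ↦ -x` preserves the integral; combined
with `f* = f` this is its conjugation. -/
theorem conj_fcoeff {F : ℂ → ℂ} {α : ℝ}
    (hp : ∀ w ∈ upperHalfPlaneSet, F (w + (1 : ℝ)) = e α * F w)
    (hc : ∀ w ∈ upperHalfPlaneSet, conj (F (-conj w)) = F w) (n : ℤ) {y : ℝ} (hy : 0 < y) :
    conj (fcoeff 1 ((n + α) / 1) F y) = fcoeff 1 ((n + α) / 1) F y := by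
  have hper : Function.Periodic (fun x : ℝ => F (x + y * Complex.I) *
      e (-((n + α) / 1) * (x + y * Complex.I : ℂ).re)) 1 := fun x => by
    have h1 := hp _ (add_mul_I_mem_U x hy)
    have e1 : (((x + 1 : ℝ) : ℂ) + y * Complex.I) = x + y * Complex.I + (1 : ℝ) := by
      push_cast
      ring
    beta_reduce
    rw [e1, h1, mul_comm (e α), mul_assoc, ← e_add, div_one]
    congr 1
    have : α + -(n + α) * ((x + y * Complex.I : ℂ) + (1 : ℝ)).re =
        -(n + α) * (x + y * Complex.I : ℂ).re + ((-n : ℤ) : ℝ) := by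
      simp
      ring
    rw [this, e_add, e_int, mul_one]
  have hflip : conj (∫ x in (0 : ℝ)..1, F (x + y * Complex.I) *
      e (-((n + α) / 1) * (x + y * Complex.I : ℂ).re)) = ∫ x in (0 : ℝ)..1,
      F (x + y * Complex.I) * e (-((n + α) / 1) * (x + y * Complex.I : ℂ).re) := by
    conv_lhs => rw [← rowInt_eq_of_periodic hper]
    rw [← intervalIntegral.intervalIntegral_conj]
    refine intervalIntegral.integral_congr fun x _ => ?_
    have h1 := hc _ (add_mul_I_mem_U x hy)
    have e1 : -conj ((x : ℂ) + y * Complex.I) = ((-x : ℝ) : ℂ) + y * Complex.I := by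
      simp
      ring
    rw [e1] at h1
    rw [map_mul, h1, conj_e]
    congr 2
    simp
  rw [fcoeff, map_mul]
  congr 1
  simp

theorem exists_fcoeff_eq {k lam α : ℝ} (hlam : 1 / 4 < lam) {F : ℂ → ℂ} (hF : IsEigen k lam F)
    (hp : ∀ w ∈ upperHalfPlaneSet, F (w + (1 : ℝ)) = e α * F w)
    (hc : ∀ w ∈ upperHalfPlaneSet, conj (F (-conj w)) = F w)
    (hi : IntegrableOn (fun y => rowSq 1 F y / y ^ 2) (Ioi 1)) (n : ℤ)
    (hn : (n : ℝ) + α ≠ 0) : ∃ c : ℝ, ∀ y : ℝ, 0 < y →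
      fcoeff 1 ((n + α) / 1) F y = c * whittakerW (kappa k (n + α))
        (Complex.I * Real.sqrt (lam - 1 / 4)) (4 * Real.pi * |n + α| * y) := by
  obtain ⟨ν, hν⟩ : ∃ ν : ℝ, ν = n + α := ⟨_, rfl⟩
  have hR : 0 < Real.sqrt (lam - 1 / 4) := Real.sqrt_pos.2 (by linarith)
  have hn' : ν ≠ 0 := hν ▸ hn
  have hs : 0 < 4 * Real.pi * |ν| := by positivity
  have hsol : SolvesOn (fun y => (fourierQ k lam ν y : ℂ)) (fcoeff 1 ν F) (fcoeff 1 ν (Dy F)) :=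
    solvesOn_fcoeff hF fun w hw => by rw [mul_one, hν, e_add, e_int, one_mul, hp w hw]
  have hanti := (fcoeff_of_integrable one_pos hlam (abs_pos.2 hn) hF hp hi n).2 (by rw [div_one])
  have hconj := fun y hy => conj_fcoeff hp hc n (y := y) hy
  have hk : (kappa k ν).im = 0 := by rw [kappa_eq, Complex.ofReal_im]
  have hμ : (Complex.I * (Real.sqrt (lam - 1 / 4) : ℂ)).im ≠ 0 := by simpa using hR.ne'
  have hμr : (Complex.I * (Real.sqrt (lam - 1 / 4) : ℂ)).re = 0 := by simp
  rw [← hν, div_one] at hanti ⊢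
  simp only [← hν, div_one] at hconj
  set Y := 1 + |k| / (Real.pi * |ν|) + lam / |ν| ^ 2 with hY
  obtain ⟨C, hC⟩ := (solvesOn_rescale hlam hn' hsol).eq_const_mul_whitW (Y := Y * (4 * Real.pi * |ν|))
    (C := ‖fcoeff 1 ν F Y‖) hk hμ hμr fun x hx => by
      have h1 : Y ≤ x / (4 * Real.pi * |ν|) := (le_div_iff₀ hs).2 hx
      exact (sq_le_sq₀ (norm_nonneg _) (norm_nonneg _)).1
        (hanti (mem_Ici.2 le_rfl) (mem_Ici.2 h1) h1)
  -- It is not necessary to know that `W` is nonzero somewhere: `C W` and `W` are both real, hence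
  -- `C W = (Re C) W`.
  refine ⟨C.re, fun y hy => ?_⟩
  have hy' : 0 < 4 * Real.pi * |ν| * y := by positivity
  have h1 := hC _ hy'
  rw [mul_div_cancel_left₀ _ hs.ne'] at h1
  have h2 := hconj y hy
  rw [h1, map_mul, conj_whitW (by rw [kappa_eq, Complex.conj_ofReal])
    (by simp) hy'] at h2
  rw [whittakerW_eq hy', h1, Complex.re_eq_add_conj]
  linear_combination -(1 / 2) * h2

theorem isMaassForm_T {N : ℕ} {v : SL(2, ℤ) → ℂ} {k lam α : ℝ} {f : ℍ → ℂ}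
    (hf : IsMaassForm (CongruenceSubgroup.Gamma0 N) v k lam f) (hα : v ModularGroup.T = e α) :
    ∀ w ∈ upperHalfPlaneSet, f (ofComplex (w + (1 : ℝ))) = e α * f (ofComplex w) := by
  intro w hw
  have hT : ModularGroup.T ∈ CongruenceSubgroup.Gamma0 N := by
    rw [CongruenceSubgroup.Gamma0_mem]
    simp [ModularGroup.T]
  have h := hf.automorphic _ hT (ofComplex w)
  have e1 : ofComplex (w + (1 : ℝ)) = ModularGroup.T • ofComplex w := by
    ext
    have := ModularGroup.coe_T_zpow_smul_eq (z := ofComplex w) (n := 1)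
    rw [zpow_one] at this
    rw [this, ofComplex_apply_of_im_pos hw, ofComplex_apply_of_im_pos (by simpa using hw)]
    simp
  have e2 : autFactor k ModularGroup.T (ofComplex w) = 1 := by
    simp [autFactor, ModularGroup.T]
  rw [e1, h, e2, hα, mul_one]

theorem exists_real_expansion {N : ℕ} [NeZero N] {v : SL(2, ℤ) → ℂ} {k lam α : ℝ}
    (hlam : 1 / 4 < lam) (hv : IsSymmetric N v) (hα : v ModularGroup.T = e α) {f : ℍ → ℂ}
    (hf : IsMaassForm (CongruenceSubgroup.Gamma0 N) v k lam f) (hc : conjFlip f = f) :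
    ∃ c : ℤ → ℝ, ∀ z : ℍ,
      HasSum (fun n : ℤ => fourierTerm k (Real.sqrt (lam - 1 / 4)) α (c n) n z) (f z) := by
  set F : ℂ → ℂ := fun w => f (ofComplex w) with hFdef
  have hF : IsEigen k lam F := isEigen_iff.2 ⟨hf.realAnalytic, hf.eigenfunction⟩
  have hp := isMaassForm_T hf hα
  have hcF : ∀ w ∈ upperHalfPlaneSet, conj (F (-conj w)) = F w := fun w hw => by
    have h1 : flip (ofComplex w) = ofComplex (-conj w) := by
      ext
      rw [coe_flip, ofComplex_apply_of_im_pos hw, ofComplex_apply_of_im_pos (neg_conj_mem_U hw)]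
    have h2 := congrFun hc (ofComplex w)
    rwa [conjFlip, h1] at h2
  have hi : IntegrableOn (fun y => rowSq 1 F y / y ^ 2) (Ioi 1) := by
    -- At the cusp `∞` the translation by `1` already lies in `Γ₀(N)`, so a strip of width `1` and
    -- the identity matrix suffice.
    obtain ⟨m, hm⟩ := exists_lintegral_strip_le 1
    have hle := hm (CongruenceSubgroup.Gamma0 N) (fun z => ‖f z‖ₑ ^ 2) (fun B hB z => by
      rw [← ofReal_norm, norm_smul_eq hv.norm_eq hf.automorphic hB, ofReal_norm]) 1
    have hint := hf.squareIntegrable _ (isFundDomain_cosetDomain (neg_one_mem_Gamma0 N))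
    have h1 : ∫⁻ z in cosetDomain (CongruenceSubgroup.Gamma0 N), ‖f z‖ₑ ^ 2 ≠ ∞ := by
      have := hint.lintegral_lt_top
      simp_rw [ENNReal.ofReal_pow (norm_nonneg _), ofReal_norm] at this
      exact this.ne
    refine (integrableOn_rowSq hF.analytic one_pos (ne_top_of_le_ne_top
      (ENNReal.mul_ne_top (ENNReal.natCast_ne_top m) h1) ?_)).1.mono_set
      (Ioi_subset_Ioi (by norm_num))
    simpa [hFdef] using hle
  choose! c hcc using fun n hn => exists_fcoeff_eq hlam hF hp hcF hi n hn
  -- The square root undoes the normalization by `1 / √|n + α|` in `fourierTerm`.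
  refine ⟨fun n => c n * Real.sqrt |n + α|, fun z => ?_⟩
  have hsum := hasSum_fcoeff hF one_pos hp z.2
  have hFz : F z = f z := by simp [hFdef]
  rw [hFz] at hsum
  refine (congrArg (HasSum · _ _) (funext fun n => ?_)).mp hsum
  rw [fourierTerm]
  split_ifs with hn
  · rw [(fcoeff_of_integrable one_pos hlam one_pos hF hp hi n).1 hn _ z.2, zero_mul]
  · have hsq : (Real.sqrt |(n : ℝ) + α| : ℂ) ≠ 0 := by
      have : 0 < |(n : ℝ) + α| := abs_pos.2 hn
      exact_mod_cast (Real.sqrt_pos.2 this).ne'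
    rw [hcc n hn _ z.2, div_one]
    push_cast
    rw [mul_div_cancel_right₀ _ hsq]
    rfl

/-! ### A basis of real forms -/

/-- Every `f` is a combination of the fixed vectors `f + σ f` and `i (f - σ f)`, which play the
roles of real and imaginary part. -/
theorem span_fixed_eq_top {V : Type*} [AddCommGroup V] [Module ℂ V] (σ : V → V)
    (hadd : ∀ f g, σ (f + g) = σ f + σ g) (hsmul : ∀ (a : ℂ) f, σ (a • f) = conj a • σ f)
    (hinv : ∀ f, σ (σ f) = f) : Submodule.span ℂ {f | σ f = f} = ⊤ := by
  rw [eq_top_iff]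
  intro f _
  have h1 : f + σ f ∈ Submodule.span ℂ {f | σ f = f} :=
    Submodule.subset_span (by rw [mem_ofPred_eq, hadd, hinv, add_comm])
  have h2 : Complex.I • (f + (-1 : ℂ) • σ f) ∈ Submodule.span ℂ {f | σ f = f} := by
    refine Submodule.subset_span ?_
    rw [mem_ofPred_eq, hsmul, hadd, hsmul, hinv, Complex.conj_I]
    simp only [map_neg, map_one]
    module
  have h3 : f = (1 / 2 : ℂ) • (f + σ f) + (-Complex.I / 2) • Complex.I • (f + (-1 : ℂ) • σ f) := by
    rw [smul_smul, show -Complex.I / 2 * Complex.I = 1 / 2 by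
      linear_combination (-1 / 2 : ℂ) * Complex.I_sq]
    module
  rw [h3]
  exact Submodule.add_mem _ (Submodule.smul_mem _ _ h1) (Submodule.smul_mem _ _ h2)

theorem exists_basis_fixed {V : Type*} [AddCommGroup V] [Module ℂ V] [FiniteDimensional ℂ V]
    {s : Set V} (hs : Submodule.span ℂ s = ⊤) :
    ∃ (m : ℕ) (b : Module.Basis (Fin m) ℂ V), ∀ j, b j ∈ s := by
  have hb := Module.Basis.ofSpan_subset hs.ge
  have hfin := Module.Finite.finite_basis (Module.Basis.ofSpan hs.ge)
  obtain ⟨m, ⟨eq⟩⟩ := Finite.exists_equiv_fin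
    ((linearIndepOn_empty ℂ (id : V → V)).extend (empty_subset s))
  refine ⟨m, (Module.Basis.ofSpan hs.ge).reindex eq, fun j => hb ?_⟩
  rw [Module.Basis.reindex_apply]
  exact mem_range_self _

theorem finiteDimensional_maassSpace {N : ℕ} [NeZero N] {v : SL(2, ℤ) → ℂ} {k lam : ℝ}
    (hlam : 1 / 4 < lam) (hv : ∀ A ∈ CongruenceSubgroup.Gamma0 N, ‖v A‖ = 1) :
    FiniteDimensional ℂ (maassSpace (CongruenceSubgroup.Gamma0 N) v k lam) := by
  have : IsFiniteMeasure (volume.restrict (cosetDomain (CongruenceSubgroup.Gamma0 N))) :=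
    ⟨by rw [Measure.restrict_apply_univ]; exact volume_cosetDomain_lt_top _⟩
  obtain ⟨C, hC, hb⟩ := exists_global_bound (k := k) hlam hv
  refine finiteDimensional_of_sup_bound
    (μ := volume.restrict (cosetDomain (CongruenceSubgroup.Gamma0 N))) (fun f hf => ?_) hC
    fun f hf x => hb f hf x
  have hf' : IsMaassForm (CongruenceSubgroup.Gamma0 N) v k lam f := hf
  exact (memLp_two_iff_integrable_sq_norm
    (continuous_of_analytic hf'.realAnalytic).aestronglyMeasurable).2
    (hf'.squareIntegrable _ (isFundDomain_cosetDomain (neg_one_mem_Gamma0 N)))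

theorem exists_real_basis {N : ℕ} [NeZero N] {v : SL(2, ℤ) → ℂ} {k lam α : ℝ}
    (hlam : 1 / 4 < lam) (hv : IsSymmetric N v) (hα : v ModularGroup.T = e α) :
    ∃ (m : ℕ) (g : Module.Basis (Fin m) ℂ (maassSpace (CongruenceSubgroup.Gamma0 N) v k lam)),
      ∀ j : Fin m, ∃ c : ℤ → ℝ, ∀ z : ℍ,
        HasSum (fun n : ℤ => fourierTerm k (Real.sqrt (lam - 1 / 4)) α (c n) n z)
          ((g j : ℍ → ℂ) z) := by
  have := finiteDimensional_maassSpace (k := k) hlam hv.norm_eq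
  obtain ⟨m, g, hg⟩ := exists_basis_fixed (span_fixed_eq_top
    (V := maassSpace (CongruenceSubgroup.Gamma0 N) v k lam)
    (fun f => ⟨conjFlip f, isMaassForm_conjFlip hlam hv f.2⟩)
    (fun f g => by ext z; simp [conjFlip]) (fun a f => by ext z; simp [conjFlip])
    (fun f => by ext z; simp [conjFlip_conjFlip]))
  exact ⟨m, g, fun j => exists_real_expansion hlam hv hα (g j).2 (congrArg Subtype.val (hg j))⟩

end MaassWaveform

end

theorem mainTheorem4 (N : ℕ) (hN : 0 < N) (k lam : ℝ) (hlam : 1 / 4 < lam)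
    (v : SL(2, ℤ) → ℂ)
    (hv : (∃ r : ℤ, v = MaassWaveform.etaMultiplier (k + 2 * r)) ∨
      (4 ∣ N ∧ v = MaassWaveform.thetaMultiplier))
    (α : ℝ) (hα0 : 0 ≤ α) (hα1 : α < 1) (hα : v ModularGroup.T = MaassWaveform.e α) :
    ∃ (m : ℕ) (g : Module.Basis (Fin m) ℂ
        (MaassWaveform.maassSpace (CongruenceSubgroup.Gamma0 N) v k lam)),
      ∀ j : Fin m, ∃ c : ℤ → ℝ, ∀ z : ℍ,
        HasSum (fun n : ℤ => MaassWaveform.fourierTerm k (Real.sqrt (lam - 1 / 4)) α (c n) n z)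
          ((g j : ℍ → ℂ) z) := by
  have : NeZero N := ⟨hN.ne'⟩
  have hs : MaassWaveform.IsSymmetric N v := by
    rcases hv with ⟨r, rfl⟩ | ⟨h4, rfl⟩
    · exact MaassWaveform.isSymmetric_etaMultiplier N _
    · exact MaassWaveform.isSymmetric_thetaMultiplier h4
  exact MaassWaveform.exists_real_basis hlam hs hα
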